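/- **Orbifolds.** Let $X$ be a Hausdorff, second countable space. A uniformizing system $(V,G,\pi)$ of a connected open set $U\subset X$ consists of a connected smooth $n$-manifold $V$, a finite group $G$ acting smoothly on $V$, and a continuous map $\pi$ inducing a homeomorphism $V/G\cong U$. An injection $(\phi,\lambda):(V',G',\pi')\to(V,G,\pi)$ is a monomorphism $\lambda:G'\to G$ inducing an isomorphism between the subgroups acting trivially, together with a $\lambda$-equivariant smooth open embedding $\phi:V'\to V$ with $\pi\phi=\pi'$. Two systems are equivalent at $p$ if some system of a neighbourhood of $p$ has injections into both. An orbifold structure on $X$ is a family $(V_p,G_p,\pi_p)_{p\in X}$ of systems of neighbourhoods $U_p\ni p$ such that $(V_p,G_p,\pi_p)$ and $(V_q,G_q,\pi_q)$ are equivalent at $q$ for all $q\in U_p$; it is reduced if all groups $G_p$ act effectively. A chart is a system $(V,G,\pi)$ of an open set $U$ that is equivalent to $(V_q,G_q,\pi_q)$ at every $q\in U$. **Good maps.** A lifting of $f:X\to X'$ from a chart $(V,G,\pi)$ to a chart $(V',G',\pi')$ is a smooth map $\tilde f:V\to V'$ over $f$ such that for each $g\in G$ there is $g'\in G'$ with $\tilde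 f(gx)=g'\tilde f(x)$ for all $x$. Two liftings have the same germ at $p$ if, along injections, they restrict to a common map between charts around $p$ and $f(p)$. A smooth map of orbifolds is a continuous map $f$ with liftings $\tilde f_p$ near all points $p$, where $\tilde f_p$ and $\tilde f_q$ have the same germ at $q$ for every $q$ in the domain of $\tilde f_p$; two such are identified if they have the same $f$ and the same germs. A compatible cover of $X$ is a cover $\mathcal U$ by open sets $U$, each with a chart $(V_U,G_U,\pi_U)$, such that $U_1\subset U_2$ implies that there is an injection $V_{U_1}\to V_{U_2}$, and each $p\in U_1\cap U_2$ lies in some $U_3\in\mathcal U$ with $U_3\subset U_1\cap U_2$. A smooth map is good if there are a compatible cover $\mathcal U$ of $X$, an assignment to each $U\in\mathcal U$ of an open set $U'\subset X'$ with a chart $V'_{U'}$ and with $U_1\subset U_2\Rightarrow U_1'\subset U_2'$, liftings $f_U:V_U\to V'_{U'}$ with the given germs, and an assignment $\nu$ sending each injection $i:V_{U_1}\to V_{U_2}$ to an injection $\nu(i):V'_{U_1'}\to V'_{U_2'}$ such that $f_{U_2}\circ i=\nu(i)\circ f_{U_1}$ and $\nu(j\circ i)=\nu(j)\circ\nu(i)$.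 **Groupoids.** All groupoids $\mathcal R\rightrightarrows\mathcal U$ are differentiable, étale ($s,t$ are local diffeomorphisms) and proper ($\mathcal R$ is Hausdorff and $(s,t)$ is proper), on a paracompact Hausdorff manifold $\mathcal U$; morphisms $(\Psi,\psi)$ are smooth functors. A Morita morphism $(\Psi,\psi):(\mathcal R'\rightrightarrows\mathcal U')\to(\mathcal R\rightrightarrows\mathcal U)$ is a morphism such that $s\circ\pi_2:\mathcal U'\times_{\psi,t}\mathcal R\to\mathcal U$ is an étale surjection and $\mathcal R'$ is the fibered product of $\mathcal U'\times\mathcal U'$ and $\mathcal R$ over $\mathcal U\times\mathcal U$. A Morita equivalence between two groupoids is a pair of Morita morphisms from a third groupoid to them. The groupoid $\mathcal G(X)$ of an orbifold has objects $\bigsqcup_pV_p$ and arrows the classes $[\lambda_1,w,\lambda_2]:\lambda_1(w)\to\lambda_2(w)$, where $\lambda_1:W\to V_p$, $\lambda_2:W\to V_q$ are injections of a uniformizing system $W$ and $w\in W$, under the equivalence relation generated by $[\lambda_1,\gamma(w'),\lambda_2]=[\lambda_1\gamma,w',\lambda_2\gamma]$ for injections $\gamma:W'\to W$; it has the quotient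 topology, and the composite of $[\lambda_1,w,\lambda_2]$ followed by $[\lambda_2,w,\lambda_3]$ is $[\lambda_1,w,\lambda_3]$. Given Morita equivalences of $\mathcal H$ with $\mathcal G(X)$ and of $\mathcal H'$ with $\mathcal G(X')$, a morphism $F:\mathcal H\to\mathcal H'$ induces a smooth map $f:X\to X'$ of orbifolds if the germs of $f$ are those of the local maps on objects obtained by lifting along the Morita equivalence from $\mathcal G(X)$ to $\mathcal H$, applying $F$, moving along a continuous family of arrows of $\mathcal H'$, and passing along the Morita equivalence to $\mathcal G(X')$. (For $\mathcal H=\mathcal G(X)$, $\mathcal H'=\mathcal G(X')$ and the identities, these are the local maps given by $F$ on objects.) **Proposition.** Let $X$ and $X'$ be reduced orbifolds, of dimensions $n$ and $m$. 1. $\mathcal G(X)$ and $\mathcal G(X')$ are proper étale differentiable groupoids. 2. Every morphism $\mathcal G(X)\to\mathcal G(X')$ induces a unique smooth map of orbifolds $X\to X'$, and this map is good. 3. More generally, for all groupoids $\mathcal H$, $\mathcal H'$ with Morita equivalences to $\mathcal G(X)$, $\mathcal G(X')$, every morphism $\mathcal H\to\mathcal H'$ induces a unique smooth map of orbifolds $X\to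 X'$, and this map is good. 4. Conversely, for every good map $f:X\to X'$ there are groupoids $\mathcal H$, $\mathcal H'$ with Morita equivalences to $\mathcal G(X)$, $\mathcal G(X')$ and a morphism $\mathcal H\to\mathcal H'$ that induces $f$. -/

import Mathlib

open Topology
open scoped Manifold ContDiff

universe u v

noncomputable section

namespace Orb

/-! ### Uniformizing systems and injections -/

/-- An `n`-dimensional uniformizing system `(V, G, π)` of a connected open subset `U` of `X`:
`V` is a connected smooth `n`-manifold, `G` a finite group acting smoothly on `V`, and `π` is
continuous and induces a homeomorphism of `V / G` onto the open set `U = π(V)`. -/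
structure UniformizingSystem (n : ℕ) (X : Type u) [TopologicalSpace X] where
  V : Type u
  [topV : TopologicalSpace V]
  [chartedV : ChartedSpace (EuclideanSpace ℝ (Fin n)) V]
  [manifoldV : IsManifold (𝓡 n) ∞ V]
  [t2V : T2Space V]
  [secondCountableV : SecondCountableTopology V]
  [connectedV : ConnectedSpace V]
  G : Type u
  [groupG : Group G]
  [finiteG : Finite G]
  [action : MulAction G V]
  smooth_smul : ∀ g : G, ContMDiff (𝓡 n) (𝓡 n) ∞ (fun v : V => g • v)
  proj : V → X
  continuous_proj : Continuous proj
  proj_smul : ∀ (g : G) (v : V), proj (g • v) = proj v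
  isOpenEmbedding_quotient :
    IsOpenEmbedding (Quotient.lift proj (fun a b (h : MulAction.orbitRel G V a b) => by
      obtain ⟨g, rfl⟩ := h
      exact proj_smul g b) : Quotient (MulAction.orbitRel G V) → X)

attribute [instance] UniformizingSystem.topV UniformizingSystem.chartedV
  UniformizingSystem.manifoldV UniformizingSystem.t2V UniformizingSystem.secondCountableV
  UniformizingSystem.connectedV UniformizingSystem.groupG UniformizingSystem.finiteG
  UniformizingSystem.action

namespace UniformizingSystem

variable {n : ℕ} {X : Type u} [TopologicalSpace X]

/-- The uniformized open set `U = π(V)`. -/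
def U (A : UniformizingSystem n X) : Set X := Set.range A.proj

/-- `ker G`: the subgroup of `G` that acts trivially on `V`. -/
def ker (A : UniformizingSystem n X) : Subgroup A.G := (MulAction.toPermHom A.G A.V).ker

end UniformizingSystem

/-- An injection `(φ, λ) : (V', G', π') → (V, G, π)`: a monomorphism `λ : G' → G` restricting to an
isomorphism `ker G' ≅ ker G`, and a `λ`-equivariant smooth open embedding `φ : V' → V` over `X`. -/
@[ext]
structure Injection {n : ℕ} {X : Type u} [TopologicalSpace X]
    (A B : UniformizingSystem n X) where
  toFun : A.V → B.V
  hom : A.G →* B.G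
  hom_injective : Function.Injective hom
  map_ker : A.ker.map hom = B.ker
  isOpenEmbedding : IsOpenEmbedding toFun
  isLocalDiffeomorph : IsLocalDiffeomorph (𝓡 n) (𝓡 n) ∞ toFun
  equivariant : ∀ (g : A.G) (v : A.V), toFun (g • v) = hom g • toFun v
  proj_comp : ∀ v : A.V, B.proj (toFun v) = A.proj v

namespace Injection

variable {n : ℕ} {X : Type u} [TopologicalSpace X]

/-- The identity injection. -/
protected def id (A : UniformizingSystem n X) : Injection A A where
  toFun := fun v => v
  hom := MonoidHom.id A.G
  hom_injective := Function.injective_id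
  map_ker := Subgroup.map_id _
  isOpenEmbedding := IsOpenEmbedding.id
  isLocalDiffeomorph := (Diffeomorph.refl (𝓡 n) A.V ∞).isLocalDiffeomorph
  equivariant := fun _ _ => rfl
  proj_comp := fun _ => rfl

/-- Composition of injections. -/
def comp {A B C : UniformizingSystem n X} (j : Injection B C) (i : Injection A B) :
    Injection A C where
  toFun := fun v => j.toFun (i.toFun v)
  hom := j.hom.comp i.hom
  hom_injective := j.hom_injective.comp i.hom_injective
  map_ker := by rw [← Subgroup.map_map, i.map_ker, j.map_ker]
  isOpenEmbedding := j.isOpenEmbedding.comp i.isOpenEmbedding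
  isLocalDiffeomorph := fun v =>
    (i.isLocalDiffeomorph v).comp (𝓡 n) C.V (j.isLocalDiffeomorph (i.toFun v))
  equivariant := fun g v => by rw [i.equivariant, j.equivariant]; rfl
  proj_comp := fun v => by rw [j.proj_comp, i.proj_comp]

end Injection

/-! ### Orbifolds -/

/-- Two uniformizing systems are equivalent at `p` if they induce a common uniformizing system of
a neighbourhood of `p`. -/
def EquivalentAt {n : ℕ} {X : Type u} [TopologicalSpace X] (p : X)
    (A B : UniformizingSystem n X) : Prop :=
  ∃ W : UniformizingSystem n X,
    p ∈ W.U ∧ Nonempty (Injection W A) ∧ Nonempty (Injection W B)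

/-- An `n`-dimensional orbifold structure on `X`. -/
structure OrbifoldStructure (n : ℕ) (X : Type u) [TopologicalSpace X] where
  chart : X → UniformizingSystem n X
  mem_chart : ∀ p, p ∈ (chart p).U
  equivalentAt : ∀ p, ∀ q ∈ (chart p).U, EquivalentAt q (chart p) (chart q)

namespace OrbifoldStructure

variable {n : ℕ} {X : Type u} [TopologicalSpace X]

/-- An orbifold is reduced if the groups `ker G` of its charts are trivial. -/
def IsReduced (O : OrbifoldStructure n X) : Prop := ∀ p, (O.chart p).ker = ⊥

/-- A uniformizing system that defines the same germs as the orbifold structure. -/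
def IsChart (O : OrbifoldStructure n X) (A : UniformizingSystem n X) : Prop :=
  ∀ q ∈ A.U, EquivalentAt q A (O.chart q)

end OrbifoldStructure

/-! ### Smooth maps of orbifolds and good maps -/

section Maps

variable {n m : ℕ} {X Y : Type u} [TopologicalSpace X] [TopologicalSpace Y]

/-- A smooth local lifting `(V, G, π) → (V', G', π')` of `f : X → Y`: a smooth map `V → V'` over `f`
such that for every `g ∈ G` some `g' ∈ G'` satisfies `lift (g x) = g' (lift x)` for all `x`. -/
structure Lifting (f : X → Y) (A : UniformizingSystem n X) (B : UniformizingSystem m Y) where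
  toFun : A.V → B.V
  contMDiff : ContMDiff (𝓡 n) (𝓡 m) ∞ toFun
  proj_comp : ∀ v, B.proj (toFun v) = f (A.proj v)
  exists_smul : ∀ g : A.G, ∃ g' : B.G, ∀ v, toFun (g • v) = g' • toFun v

/-- Two liftings have the same germ at `p` if, along injections, they induce a common lifting
`h : W → W'` on a neighbourhood of `p`. -/
def SameGerm (p : X) {f f' : X → Y} {A A' : UniformizingSystem n X} {B B' : UniformizingSystem m Y}
    (L : Lifting f A B) (L' : Lifting f' A' B') : Prop :=
  ∃ (W : UniformizingSystem n X) (i : Injection W A) (i' : Injection W A')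
    (Z : UniformizingSystem m Y) (j : Injection Z B) (j' : Injection Z B') (h : W.V → Z.V),
    p ∈ W.U ∧ (∀ w, L.toFun (i.toFun w) = j.toFun (h w)) ∧
      ∀ w, L'.toFun (i'.toFun w) = j'.toFun (h w)

/-- A smooth lifting of a continuous map between orbifolds. -/
structure OrbifoldMap (O : OrbifoldStructure n X) (P : OrbifoldStructure m Y) where
  toFun : X → Y
  continuous_toFun : Continuous toFun
  dom : X → UniformizingSystem n X
  cod : X → UniformizingSystem m Y
  isChart_dom : ∀ p, O.IsChart (dom p)
  isChart_cod : ∀ p, P.IsChart (cod p)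
  mem_dom : ∀ p, p ∈ (dom p).U
  lift : ∀ p, Lifting toFun (dom p) (cod p)
  sameGerm : ∀ p, ∀ q ∈ (dom p).U, SameGerm q (lift q) (lift p)

/-- Two smooth liftings are the same smooth map of orbifolds (a germ of liftings) if they lie over
the same continuous map and have the same germ at every point. -/
def OrbifoldMap.Same {O : OrbifoldStructure n X} {P : OrbifoldStructure m Y}
    (f g : OrbifoldMap O P) : Prop :=
  f.toFun = g.toFun ∧ ∀ p, SameGerm p (f.lift p) (g.lift p)

/-- A compatible cover of an orbifold, `{U_i}` with uniformizing systems `(V_i, G_i, π_i)`. -/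
structure CompatibleCover (O : OrbifoldStructure n X) where
  ι : Type u
  chart : ι → UniformizingSystem n X
  isChart : ∀ i, O.IsChart (chart i)
  injective_U : Function.Injective fun i => (chart i).U
  cover : ∀ p : X, ∃ i, p ∈ (chart i).U
  exists_injection : ∀ i j, (chart i).U ⊆ (chart j).U → Nonempty (Injection (chart i) (chart j))
  exists_mem_inter : ∀ i j, ∀ p ∈ (chart i).U ∩ (chart j).U,
    ∃ k, p ∈ (chart k).U ∧ (chart k).U ⊆ (chart i).U ∩ (chart j).U

/-- A compatible system `{f_{UU'}, ν}` of a smooth map `f` of orbifolds. -/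
structure CompatibleSystem {O : OrbifoldStructure n X} {P : OrbifoldStructure m Y}
    (f : OrbifoldMap O P) where
  cover : CompatibleCover O
  target : cover.ι → UniformizingSystem m Y
  isChart_target : ∀ i, P.IsChart (target i)
  target_mono : ∀ i j, (cover.chart i).U ⊆ (cover.chart j).U → (target i).U ⊆ (target j).U
  lift : ∀ i, Lifting f.toFun (cover.chart i) (target i)
  ν : ∀ {i j}, Injection (cover.chart i) (cover.chart j) → Injection (target i) (target j)
  lift_comp : ∀ {i j} (a : Injection (cover.chart i) (cover.chart j)) (v : (cover.chart i).V),
    (lift j).toFun (a.toFun v) = (ν a).toFun ((lift i).toFun v)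
  ν_comp : ∀ {i j k} (b : Injection (cover.chart j) (cover.chart k))
    (a : Injection (cover.chart i) (cover.chart j)), ν (b.comp a) = (ν b).comp (ν a)
  sameGerm : ∀ i, ∀ p ∈ (cover.chart i).U, SameGerm p (lift i) (f.lift p)

/-- A smooth map of orbifolds is good if it admits a compatible system. -/
def OrbifoldMap.IsGood {O : OrbifoldStructure n X} {P : OrbifoldStructure m Y}
    (f : OrbifoldMap O P) : Prop := Nonempty (CompatibleSystem f)

end Maps

/-! ### Differentiable étale groupoids -/

set_option linter.checkUnivs false in
/-- The data `(R, U, s, t, e, m, i)` of a groupoid with spaces of arrows `R` and objects `U`, where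
`U` has an atlas of dimension `n`. The value `mul r r'` matters only if `tgt r = src r'`; it is the
arrow `src r → tgt r'`. The axioms are in `IsProperEtale`. -/
structure GroupoidData (n : ℕ) where
  Obj : Type u
  Arr : Type v
  [topObj : TopologicalSpace Obj]
  [chartedObj : ChartedSpace (EuclideanSpace ℝ (Fin n)) Obj]
  [topArr : TopologicalSpace Arr]
  src : Arr → Obj
  tgt : Arr → Obj
  one : Obj → Arr
  inv : Arr → Arr
  mul : Arr → Arr → Arr

attribute [instance] GroupoidData.topObj GroupoidData.chartedObj GroupoidData.topArr

namespace GroupoidData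

/-- `A` is a proper étale differentiable groupoid. The manifold of arrows carries the unique smooth
structure for which `src` is a local diffeomorphism; `contMDiffOn_tgt` says that `tgt` is smooth for
it, hence a local diffeomorphism, and the other structure maps are then smooth as well. -/
structure IsProperEtale {n : ℕ} (A : GroupoidData.{u, v} n) : Prop where
  isManifold : IsManifold (𝓡 n) ∞ A.Obj
  t2_obj : T2Space A.Obj
  paracompact_obj : ParacompactSpace A.Obj
  t2_arr : T2Space A.Arr
  src_one : ∀ x, A.src (A.one x) = x
  tgt_one : ∀ x, A.tgt (A.one x) = x
  src_mul : ∀ r r', A.tgt r = A.src r' → A.src (A.mul r r') = A.src r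
  tgt_mul : ∀ r r', A.tgt r = A.src r' → A.tgt (A.mul r r') = A.tgt r'
  mul_assoc : ∀ r r' r'', A.tgt r = A.src r' → A.tgt r' = A.src r'' →
    A.mul (A.mul r r') r'' = A.mul r (A.mul r' r'')
  one_mul : ∀ r, A.mul (A.one (A.src r)) r = r
  mul_one : ∀ r, A.mul r (A.one (A.tgt r)) = r
  inv_inv : ∀ r, A.inv (A.inv r) = r
  src_inv : ∀ r, A.src (A.inv r) = A.tgt r
  tgt_inv : ∀ r, A.tgt (A.inv r) = A.src r
  mul_inv : ∀ r, A.mul r (A.inv r) = A.one (A.src r)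
  inv_mul : ∀ r, A.mul (A.inv r) r = A.one (A.tgt r)
  continuous_one : Continuous A.one
  continuous_inv : Continuous A.inv
  continuousOn_mul :
    ContinuousOn (fun x : A.Arr × A.Arr => A.mul x.1 x.2) {x | A.tgt x.1 = A.src x.2}
  isLocalHomeomorph_src : IsLocalHomeomorph A.src
  isLocalHomeomorph_tgt : IsLocalHomeomorph A.tgt
  contMDiffOn_tgt : ∀ (s : Set A.Obj) (σ : A.Obj → A.Arr), IsOpen s → ContinuousOn σ s →
    (∀ x ∈ s, A.src (σ x) = x) → ContMDiffOn (𝓡 n) (𝓡 n) ∞ (fun x => A.tgt (σ x)) s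
  isProperMap : IsProperMap fun r => (A.src r, A.tgt r)

/-- A morphism `(Ψ, ψ)` of differentiable étale groupoids. Since source maps are local
diffeomorphisms, smoothness of `Ψ` amounts to its continuity together with smoothness of `ψ`. -/
structure Hom {n m : ℕ} (A : GroupoidData.{u, v} n) (B : GroupoidData.{u, v} m) where
  obj : A.Obj → B.Obj
  arr : A.Arr → B.Arr
  contMDiff_obj : ContMDiff (𝓡 n) (𝓡 m) ∞ obj
  continuous_arr : Continuous arr
  src_arr : ∀ r, B.src (arr r) = obj (A.src r)
  tgt_arr : ∀ r, B.tgt (arr r) = obj (A.tgt r)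
  arr_one : ∀ x, arr (A.one x) = B.one (obj x)
  arr_mul : ∀ r r', A.tgt r = A.src r' → arr (A.mul r r') = B.mul (arr r) (arr r')
  arr_inv : ∀ r, arr (A.inv r) = B.inv (arr r)

/-- The identity morphism. -/
def Hom.id {n : ℕ} (A : GroupoidData.{u, v} n) : Hom A A where
  obj := fun x => x
  arr := fun r => r
  contMDiff_obj := contMDiff_id
  continuous_arr := continuous_id
  src_arr := fun _ => rfl
  tgt_arr := fun _ => rfl
  arr_one := fun _ => rfl
  arr_mul := fun _ _ _ => rfl
  arr_inv := fun _ => rfl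

/-- An étale Morita morphism `(Ψ, ψ) : A → B`: the map `s ∘ π₂ : A.Obj ×_{ψ, t} B.Arr → B.Obj` is an
étale surjection and the square formed by `Ψ`, `ψ × ψ` and the maps `(s, t)` is a fibered product.
Locally `s ∘ π₂` is `ψ` followed by a local diffeomorphism `s ∘ t⁻¹`, so it is étale if and only if
`ψ` is a local diffeomorphism. -/
structure Hom.IsMorita {n : ℕ} {A B : GroupoidData.{u, v} n} (φ : Hom A B) : Prop where
  etale : IsLocalDiffeomorph (𝓡 n) (𝓡 n) ∞ φ.obj
  surjective : Function.Surjective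
    fun x : {x : A.Obj × B.Arr // φ.obj x.1 = B.tgt x.2} => B.src x.1.2
  isFiberProduct : IsHomeomorph
    (fun r => ⟨((A.src r, A.tgt r), φ.arr r), by simp [φ.src_arr, φ.tgt_arr]⟩ :
      A.Arr → {x : (A.Obj × A.Obj) × B.Arr //
        (φ.obj x.1.1, φ.obj x.1.2) = (B.src x.2, B.tgt x.2)})

/-- A Morita equivalence between `A` and `B`: Morita morphisms from a third groupoid to both. -/
structure MoritaEquivalence {n : ℕ} (A B : GroupoidData.{u, v} n) where
  mid : GroupoidData.{u, v} n
  isProperEtale : mid.IsProperEtale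
  left : Hom mid A
  right : Hom mid B
  isMorita_left : left.IsMorita
  isMorita_right : right.IsMorita

end GroupoidData

/-! ### The groupoid associated to an orbifold -/

/-- The atlas of a disjoint union. -/
@[reducible]
def sigmaChartedSpace {n : ℕ} {ι : Type u} (M : ι → Type u) [∀ i, TopologicalSpace (M i)]
    [∀ i, ChartedSpace (EuclideanSpace ℝ (Fin n)) (M i)] :
    ChartedSpace (EuclideanSpace ℝ (Fin n)) (Σ i, M i) where
  atlas := ⋃ i, (fun e : OpenPartialHomeomorph (M i) (EuclideanSpace ℝ (Fin n)) =>
    e.lift_openEmbedding (IsOpenEmbedding.sigmaMk (σ := M) (i := i))) ''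
      atlas (EuclideanSpace ℝ (Fin n)) (M i)
  chartAt := fun x => (chartAt (EuclideanSpace ℝ (Fin n)) x.2).lift_openEmbedding
    (IsOpenEmbedding.sigmaMk (σ := M) (i := x.1))
  mem_chart_source := fun x => by
    rw [OpenPartialHomeomorph.lift_openEmbedding_source]
    exact ⟨x.2, mem_chart_source _ x.2, rfl⟩
  chart_mem_atlas := fun x =>
    Set.mem_iUnion.2 ⟨x.1, _, chart_mem_atlas _ x.2, rfl⟩

namespace OrbifoldStructure

variable {n : ℕ} {X : Type u} [TopologicalSpace X]

/-- A pair of injections `λ₁ : W → V_p`, `λ₂ : W → V_q`. -/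
structure Span (O : OrbifoldStructure n X) where
  W : UniformizingSystem n X
  p : X
  q : X
  fst : Injection W (O.chart p)
  snd : Injection W (O.chart q)

/-- The pair `(λ₁ ∘ γ, λ₂ ∘ γ)`. -/
def Span.restrict {O : OrbifoldStructure n X} (D : O.Span) {W' : UniformizingSystem n X}
    (γ : Injection W' D.W) : O.Span := ⟨W', D.p, D.q, D.fst.comp γ, D.snd.comp γ⟩

/-- Triples `(λ₁, w, λ₂)`, topologized as the disjoint union of the `W`s. -/
abbrev Triple (O : OrbifoldStructure n X) := Σ D : O.Span, D.W.V

/-- The identifications `(λ₁, γ(w'), λ₂) ~ (λ₁ ∘ γ, w', λ₂ ∘ γ)`. -/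
inductive TripleRel (O : OrbifoldStructure n X) : O.Triple → O.Triple → Prop
  | mk (D : O.Span) (W' : UniformizingSystem n X) (γ : Injection W' D.W) (w' : W'.V) :
      TripleRel O ⟨D, γ.toFun w'⟩ ⟨D.restrict γ, w'⟩

/-- Arrows: classes `[λ₁, w, λ₂]` under the equivalence relation generated by these
identifications, with the quotient topology. -/
abbrev Arrow (O : OrbifoldStructure n X) := Quot O.TripleRel

/-- The arrow `[λ₁, w, λ₂]`. -/
def arrow (O : OrbifoldStructure n X) {W : UniformizingSystem n X} {p q : X}
    (a : Injection W (O.chart p)) (w : W.V) (b : Injection W (O.chart q)) : O.Arrow :=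
  Quot.mk _ ⟨⟨W, p, q, a, b⟩, w⟩

/-- `c` is the composite of `a` followed by `b`: for some `w ∈ W` and injections `λ₁, λ₂, λ₃` of `W`,
`a = [λ₁, w, λ₂]`, `b = [λ₂, w, λ₃]` and `c = [λ₁, w, λ₃]`. -/
def IsComposite (O : OrbifoldStructure n X) (a b c : O.Arrow) : Prop :=
  ∃ (W : UniformizingSystem n X) (p q r : X) (f : Injection W (O.chart p))
    (g : Injection W (O.chart q)) (h : Injection W (O.chart r)) (w : W.V),
    a = O.arrow f w g ∧ b = O.arrow g w h ∧ c = O.arrow f w h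

open Classical in
/-- The groupoid associated to an orbifold structure. -/
def groupoid (O : OrbifoldStructure n X) : GroupoidData.{u, u + 1} n where
  Obj := Σ p : X, (O.chart p).V
  Arr := O.Arrow
  chartedObj := sigmaChartedSpace fun p : X => (O.chart p).V
  src := Quot.lift (fun x => ⟨x.1.p, x.1.fst.toFun x.2⟩) (by rintro _ _ ⟨⟩; rfl)
  tgt := Quot.lift (fun x => ⟨x.1.q, x.1.snd.toFun x.2⟩) (by rintro _ _ ⟨⟩; rfl)
  one := fun x => O.arrow (Injection.id (O.chart x.1)) x.2 (Injection.id (O.chart x.1))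
  inv := Quot.lift (fun x => O.arrow x.1.snd x.2 x.1.fst) (by
    rintro _ _ ⟨D, W', γ, w'⟩
    exact Quot.sound (TripleRel.mk ⟨D.W, D.q, D.p, D.snd, D.fst⟩ W' γ w'))
  mul := fun a b => if h : ∃ c, O.IsComposite a b c then h.choose else a

end OrbifoldStructure

/-! ### The smooth map induced by a morphism of groupoids -/

/-- Given groupoid morphisms `H ← K → G(O)`, `F : H → H'`, `H' ← K' → G(P)`, the smooth map `f` of
orbifolds is induced by `F`: near every object `k` of `K`, lift a small chart `W` at the image of `k`
in `G(O)` to `K`, apply `K → H` and `F`, move along arrows `ρ` of `H'` to the image of a map into the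
objects of `K'`, and go on to `G(P)`; the result is a local lifting `L` of the continuous map `f`, and
it has the germ of `f`. If all four outer morphisms are identities and `ρ` consists of units, `L` is
simply `F` on objects. -/
def Induces {n m : ℕ} {X Y : Type u} [TopologicalSpace X] [TopologicalSpace Y]
    {O : OrbifoldStructure n X} {P : OrbifoldStructure m Y}
    {H K : GroupoidData.{u, u + 1} n} {H' K' : GroupoidData.{u, u + 1} m}
    (a : K.Hom H) (b : K.Hom O.groupoid) (F : H.Hom H')
    (a' : K'.Hom H') (b' : K'.Hom P.groupoid) (f : OrbifoldMap O P) : Prop :=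
  ∀ k : K.Obj, ∃ (p : X) (W : UniformizingSystem n X) (i : Injection W (O.chart p)) (w₀ : W.V)
    (τ : W.V → K.Obj) (q : Y) (Z : UniformizingSystem m Y) (j : Injection Z (P.chart q))
    (L : Lifting f.toFun W Z) (τ' : W.V → K'.Obj) (ρ : W.V → H'.Arr),
    Continuous τ ∧ τ w₀ = k ∧ (∀ w, b.obj (τ w) = ⟨p, i.toFun w⟩) ∧
    Continuous ρ ∧ (∀ w, H'.src (ρ w) = F.obj (a.obj (τ w))) ∧
    (∀ w, H'.tgt (ρ w) = a'.obj (τ' w)) ∧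
    Continuous τ' ∧ (∀ w, b'.obj (τ' w) = ⟨q, j.toFun (L.toFun w)⟩) ∧
    SameGerm (W.proj w₀) L (f.lift (W.proj w₀))

end Orb

end

-- The proof rests on the rigidity of effective finite group actions. If an element of a finite
-- group of diffeomorphisms fixes a point and has derivative 1 there, averaging its iterates in a
-- chart shows that it is the identity nearby; by connectedness it acts trivially everywhere, so in
-- a reduced system it is 1. With Baire's theorem it follows that two parallel injections of reduced
-- systems differ by a group element (`Injection.exists_smul_eq`). Hence an injection is determined
-- by its germ at one point, and injections with a common value have a common refinement
-- (`exists_pullback`).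
--
-- Two triples therefore give the same arrow exactly when they have a common restriction
-- (`Span.arr_eq_arr_iff`), and each `w ↦ [λ₁, w, λ₂]` is an open embedding. The groupoid axioms can
-- be checked on such charts. Over two points linked by a system `W`, nearby arrows lie in finitely
-- many copies of `W`, one for each element of its group; this gives the Hausdorff property and
-- properness.
--
-- A morphism between Morita equivalent groupoids becomes a `Bridge`: a space `T` étale over the
-- objects of the first orbifold groupoid, with values in the objects of the second and a functorial
-- continuous action on arrows. Sections of `T` give local liftings, and the action joins any two of
-- them by continuous families of arrows, so their germs agree. Local data of any map induced by the
-- morphism again form such a section, whence uniqueness. For goodness, `exists_decorated_basis`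
-- chooses local liftings such that each inclusion of domains is accompanied by injections of
-- domains and of targets. For an injection `c` of domains the family of arrows from `w` to `c w`
-- has locally constant form and so is given by a single injection of targets; this is `ν c`, and
-- functoriality of the action makes `ν` multiplicative.
--
-- Conversely, given a compatible system, shrink the charts of the first orbifold until the liftings
-- land in charts of the second. This changes the groupoid only by a Morita morphism. An arrow of
-- the shrunken groupoid is given by two injections `a`, `b` of a member of the cover at a point
-- `v`; its image is given by `ν a`, `ν b` at the lifted point. Multiplicativity of `ν` makes this
-- independent of the choices and functorial.

universe w

noncomputable section

namespace Orb

section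

/-! ### Finite groups of diffeomorphisms -/

section FiniteActions

variable {n : ℕ} {M : Type*} [TopologicalSpace M] [ChartedSpace (EuclideanSpace ℝ (Fin n)) M]

/-- Two `C¹` maps that agree near points arbitrarily close to `x` have the same derivative at `x`. -/
theorem fderiv_eq_of_frequently_eventuallyEq {E F : Type*} [NormedAddCommGroup E] [NormedSpace ℝ E]
    [NormedAddCommGroup F] [NormedSpace ℝ F] {f g : E → F} {x : E}
    (hf : ContDiffAt ℝ ∞ f x) (hg : ContDiffAt ℝ ∞ g x) (h : ∃ᶠ z in 𝓝 x, f =ᶠ[𝓝 z] g) :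
    fderiv ℝ f x = fderiv ℝ g x := by
  have hf' : ContinuousAt (fderiv ℝ f) x :=
    (hf.fderiv_right (m := 0) (by norm_num)).continuousAt
  have hg' : ContinuousAt (fderiv ℝ g) x :=
    (hg.fderiv_right (m := 0) (by norm_num)).continuousAt
  exact tendsto_nhds_unique_of_frequently_eq hf' hg' (h.mono fun z hz => hz.fderiv_eq)

/-- A map fixing `x`, read in the preferred chart at `x`. -/
def inChart (f : M → M) (x : M) : EuclideanSpace ℝ (Fin n) → EuclideanSpace ℝ (Fin n) :=
  fun u => extChartAt (𝓡 n) x (f ((extChartAt (𝓡 n) x).symm u))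

theorem contDiffAt_inChart {f : M → M} {x : M}
    (hf : ContMDiffAt (𝓡 n) (𝓡 n) ∞ f x) (hx : f x = x) :
    ContDiffAt ℝ ∞ (inChart f x) (extChartAt (𝓡 n) x x) := by
  have h := (contMDiffAt_iff.1 hf).2
  rw [hx] at h
  rw [ModelWithCorners.range_eq_univ, contDiffWithinAt_univ] at h
  exact h

theorem tendsto_extChartAt_symm_nhds {x z : M} (hz : z ∈ (extChartAt (𝓡 n) x).source) :
    Filter.Tendsto (extChartAt (𝓡 n) x).symm (𝓝 (extChartAt (𝓡 n) x z)) (𝓝 z) := by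
  have h := continuousAt_extChartAt_symm' (I := 𝓡 n) hz
  rwa [ContinuousAt, (extChartAt (𝓡 n) x).left_inv hz] at h

theorem fderiv_inChart_eq_of_frequently {f g : M → M} {x : M}
    (hf : ContMDiffAt (𝓡 n) (𝓡 n) ∞ f x) (hg : ContMDiffAt (𝓡 n) (𝓡 n) ∞ g x)
    (hfx : f x = x) (hgx : g x = x) (h : ∃ᶠ z in 𝓝 x, f =ᶠ[𝓝 z] g) :
    fderiv ℝ (inChart f x) (extChartAt (𝓡 n) x x) =
      fderiv ℝ (inChart g x) (extChartAt (𝓡 n) x x) := by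
  refine fderiv_eq_of_frequently_eventuallyEq (contDiffAt_inChart hf hfx)
    (contDiffAt_inChart hg hgx) ?_
  have hc : Filter.Tendsto (extChartAt (𝓡 n) x) (𝓝 x) (𝓝 (extChartAt (𝓡 n) x x)) :=
    continuousAt_extChartAt x
  refine hc.frequently ((h.and_eventually (extChartAt_source_mem_nhds (I := 𝓡 n) x)).mono ?_)
  rintro z ⟨hz, hzs⟩
  filter_upwards [(tendsto_extChartAt_symm_nhds hzs).eventually hz] with u hu
  simp only [inChart, hu]

theorem hasFDerivAt_inChart_id (x : M) :
    HasFDerivAt (inChart (n := n) (fun y : M => y) x)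
      (ContinuousLinearMap.id ℝ (EuclideanSpace ℝ (Fin n))) (extChartAt (𝓡 n) x x) := by
  refine (hasFDerivAt_id _).congr_of_eventuallyEq ?_
  filter_upwards [extChartAt_target_mem_nhds (I := 𝓡 n) x] with u hu
  exact (extChartAt (𝓡 n) x).right_inv hu

/-- A smooth map of finite order that fixes `x` and has derivative `1` at `x` is the identity
near `x`: the sum of its iterates in a chart is an invariant local coordinate. -/
theorem eventually_eq_self_of_iterate [IsManifold (𝓡 n) ∞ M] {g : M → M}
    (hg : ContMDiff (𝓡 n) (𝓡 n) ∞ g)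
    {k : ℕ} (hk : k ≠ 0) (hgk : ∀ y, g^[k] y = y) {x : M} (hx : g x = x)
    (hd : HasFDerivAt (inChart g x) (ContinuousLinearMap.id ℝ (EuclideanSpace ℝ (Fin n)))
      (extChartAt (𝓡 n) x x)) :
    ∀ᶠ y in 𝓝 x, g y = y := by
  set E := EuclideanSpace ℝ (Fin n)
  set φ := extChartAt (𝓡 n) x
  have hgi : ∀ i, ContMDiff (𝓡 n) (𝓡 n) ∞ g^[i] := fun i => by
    induction i with
    | zero => exact contMDiff_id
    | succ i ih => rw [Function.iterate_succ]; exact ih.comp hg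
  have hxi : ∀ i, g^[i] x = x := fun i => Function.iterate_fixed hx i
  have hdi : ∀ i, HasFDerivAt (inChart g^[i] x) (ContinuousLinearMap.id ℝ E) (φ x) := fun i => by
    induction i with
    | zero => exact hasFDerivAt_inChart_id x
    | succ i ih =>
      have h0 : inChart g x (φ x) = φ x := by
        simp only [inChart]
        rw [extChartAt_to_inv, hx]
      have := HasFDerivAt.comp (φ x) (h0.symm ▸ ih) hd
      rw [ContinuousLinearMap.comp_id] at this
      refine this.congr_of_eventuallyEq ?_
      have hs : φ.source ∈ 𝓝 (g x) := by rw [hx]; exact extChartAt_source_mem_nhds x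
      have ht : Filter.Tendsto φ.symm (𝓝 (φ x)) (𝓝 x) :=
        tendsto_extChartAt_symm_nhds (mem_extChartAt_source x)
      filter_upwards [ht.eventually (hg.continuous.continuousAt.eventually hs)] with u hu
      simp only [inChart, Function.comp, Function.iterate_succ]
      rw [φ.left_inv hu]
  -- This sum is invariant under the map because its `k`-th iterate is the identity, and its
  -- derivative at the fixed point is `k` times the identity. By the inverse function theorem it is
  -- injective nearby, so a point and its image must coincide.
  set h : E → E := fun u => ∑ i ∈ Finset.range k, inChart g^[i] x u with hh
  have hdh : HasFDerivAt h (∑ i ∈ Finset.range k, ContinuousLinearMap.id ℝ E) (φ x) :=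
    HasFDerivAt.fun_sum fun i _ => hdi i
  have hch : ContDiffAt ℝ ∞ h (φ x) :=
    ContDiffAt.sum fun i _ => contDiffAt_inChart (hgi i).contMDiffAt (hxi i)
  have hk' : (k : ℝ) ≠ 0 := by exact_mod_cast hk
  let e : E ≃L[ℝ] E := ContinuousLinearEquiv.smulLeft (Units.mk0 (k : ℝ) hk')
  have he : (e : E →L[ℝ] E) = ∑ i ∈ Finset.range k, ContinuousLinearMap.id ℝ E := by
    ext1 v
    simp only [Finset.sum_const, Finset.card_range]
    change (k : ℝ) • v = (k • ContinuousLinearMap.id ℝ E) v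
    simp [Nat.cast_smul_eq_nsmul]
  rw [← he] at hdh
  have hstrict := hch.hasStrictFDerivAt' hdh (by norm_num)
  set Φ := hstrict.toOpenPartialHomeomorph h
  have hΦ : Φ.source ∈ 𝓝 (φ x) := Φ.open_source.mem_nhds hstrict.mem_toOpenPartialHomeomorph_source
  have hφ : ContinuousAt φ x := continuousAt_extChartAt x
  have hev : ∀ᶠ y in 𝓝 x, φ y ∈ Φ.source ∧ y ∈ φ.source :=
    (hφ.eventually hΦ).and (extChartAt_source_mem_nhds (I := 𝓡 n) x)
  have hev' : ∀ᶠ y in 𝓝 x, φ (g y) ∈ Φ.source ∧ g y ∈ φ.source := by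
    have := hg.continuous.continuousAt (x := x)
    rw [ContinuousAt, hx] at this
    exact this.eventually hev
  filter_upwards [hev, hev'] with y hy hy'
  have hsum : h (φ (g y)) = h (φ y) := by
    simp only [hh, inChart]
    rw [show φ.symm (φ (g y)) = g y from φ.left_inv hy'.2,
      show φ.symm (φ y) = y from φ.left_inv hy.2]
    simp only [← Function.iterate_succ_apply]
    -- The sum over `k + 1` iterates is split off at its last and at its first term; these terms
    -- agree since `g^[k] y = y`.
    have h1 := Finset.sum_range_succ (fun i => φ (g^[i] y)) k
    have h2 := Finset.sum_range_succ' (fun i => φ (g^[i] y)) k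
    rw [hgk y] at h1
    rw [h1] at h2
    exact (add_right_cancel h2).symm
  have := Φ.injOn hy'.1 hy.1 hsum
  exact φ.injOn hy'.2 hy.2 this

variable {G : Type*} [Group G] [Finite G] [MulAction G M]

theorem eventually_smul_eq_self [IsManifold (𝓡 n) ∞ M]
    (hG : ∀ g : G, ContMDiff (𝓡 n) (𝓡 n) ∞ fun v : M => g • v) {g : G} {x : M}
    (hx : g • x = x) (hd : HasFDerivAt (inChart (fun v => g • v) x)
      (ContinuousLinearMap.id ℝ (EuclideanSpace ℝ (Fin n))) (extChartAt (𝓡 n) x x)) :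
    ∀ᶠ y in 𝓝 x, g • y = y :=
  eventually_eq_self_of_iterate (hG g) (orderOf_pos g).ne'
    (fun y => by simp [smul_iterate, pow_orderOf_eq_one]) hx hd

theorem hasFDerivAt_inChart_of_frequently {f : M → M} {x : M}
    (hf : ContMDiffAt (𝓡 n) (𝓡 n) ∞ f x) (hfx : f x = x)
    {f' : EuclideanSpace ℝ (Fin n) →L[ℝ] EuclideanSpace ℝ (Fin n)} {g : M → M}
    (hg : ContMDiffAt (𝓡 n) (𝓡 n) ∞ g x) (hgx : g x = x)
    (hg' : HasFDerivAt (inChart g x) f' (extChartAt (𝓡 n) x x))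
    (h : ∃ᶠ z in 𝓝 x, f =ᶠ[𝓝 z] g) :
    HasFDerivAt (inChart f x) f' (extChartAt (𝓡 n) x x) := by
  rw [← hg'.fderiv, ← fderiv_inChart_eq_of_frequently hf hg hfx hgx h]
  exact ((contDiffAt_inChart hf hfx).differentiableAt (by norm_num)).hasFDerivAt

/-- An element of a finite group of diffeomorphisms of a connected manifold that acts trivially near
a point acts trivially. -/
theorem smul_eq_self_of_eventually [IsManifold (𝓡 n) ∞ M] [T2Space M] [PreconnectedSpace M]
    (hG : ∀ g : G, ContMDiff (𝓡 n) (𝓡 n) ∞ fun v : M => g • v) {g : G} {x : M}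
    (h : ∀ᶠ y in 𝓝 x, g • y = y) (y : M) : g • y = y := by
  -- Openness is built into the definition. At a limit point the derivative is 1 by continuity, and
  -- the averaging lemma puts the point back into the set.
  have hclopen : IsClopen {x : M | ∀ᶠ y in 𝓝 x, g • y = y} := by
    refine ⟨isClosed_of_closure_subset fun z hz => ?_, isOpen_setOfPred_eventually_nhds⟩
    have hz' : ∃ᶠ w in 𝓝 z, ∀ᶠ y in 𝓝 w, g • y = y := mem_closure_iff_frequently.1 hz
    have hzz : g • z = z := by
      have hc : IsClosed {y : M | g • y = y} := isClosed_eq (hG g).continuous continuous_id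
      exact hc.mem_of_frequently_of_tendsto (hz'.mono fun w hw => hw.self_of_nhds) Filter.tendsto_id
    exact eventually_smul_eq_self hG hzz (hasFDerivAt_inChart_of_frequently (hG g).contMDiffAt hzz
      contMDiffAt_id rfl (hasFDerivAt_inChart_id z) hz')
  have := hclopen.eq_univ ⟨x, h⟩
  have hy : y ∈ {x : M | ∀ᶠ y in 𝓝 x, g • y = y} := this ▸ Set.mem_univ y
  exact Filter.Eventually.self_of_nhds (p := fun y => g • y = y) hy

/-- Two smooth maps of a connected manifold into `M`, the first of them a local diffeomorphism, that
agree modulo a finite group acting effectively on `M` differ by an element of the group. -/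
theorem exists_smul_eq_of_forall_exists [IsManifold (𝓡 n) ∞ M] [T2Space M] [PreconnectedSpace M]
    (hG : ∀ g : G, ContMDiff (𝓡 n) (𝓡 n) ∞ fun v : M => g • v)
    (heff : ∀ g : G, (∀ v : M, g • v = v) → g = 1)
    {N : Type*} [TopologicalSpace N] [ChartedSpace (EuclideanSpace ℝ (Fin n)) N]
    [T2Space N] [ConnectedSpace N] {i i' : N → M}
    (hi : IsLocalDiffeomorph (𝓡 n) (𝓡 n) ∞ i) (hi' : ContMDiff (𝓡 n) (𝓡 n) ∞ i')
    (h : ∀ v, ∃ g : G, i' v = g • i v) : ∃ g : G, ∀ v, i' v = g • i v := by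
  classical
  have hci : Continuous i := hi.contMDiff.continuous
  have : LocallyCompactSpace N :=
    ChartedSpace.locallyCompactSpace (EuclideanSpace ℝ (Fin n)) N
  set F : G → Set N := fun g => {v | i' v = g • i v}
  have hF : ∀ g, IsClosed (F g) := fun g =>
    isClosed_eq hi'.continuous ((hG g).continuous.comp hci)
  -- Finitely many closed sets `F g` cover `N`, so by Baire their interiors are dense.
  have hdense : Dense (⋃ g, interior (F g)) :=
    dense_iUnion_interior_of_closed hF (by
      ext v; simpa [F] using h v)
  have hcover : ⋃ g, closure (interior (F g)) = Set.univ := by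
    rw [← closure_iUnion_of_finite, hdense.closure_eq]
  -- At a common limit point consider `ψ = g'⁻¹ ∘ i' ∘ i⁻¹`. It agrees with 1 and with `g'⁻¹ * g` on
  -- open sets accumulating there, so `g'⁻¹ * g` has derivative 1 and is trivial.
  have hdisj : ∀ g g' v, v ∈ closure (interior (F g)) → v ∈ closure (interior (F g')) → g = g' := by
    intro g g' v hv hv'
    have hvF : i' v = g • i v := (hF g).closure_subset_iff.2 interior_subset hv
    have hvF' : i' v = g' • i v := (hF g').closure_subset_iff.2 interior_subset hv'
    set s := (hi v).localInverse
    have hs : s (i v) = v := (hi v).localInverse_left_inv (hi v).localInverse_mem_target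
    set ψ : M → M := fun z => g'⁻¹ • i' (s z)
    have hψ : ContMDiffAt (𝓡 n) (𝓡 n) ∞ ψ (i v) :=
      ((hG g'⁻¹).comp hi').contMDiffAt.comp (i v) (hi v).localInverse_contMDiffAt
    have hψv : ψ (i v) = i v := by
      simp only [ψ]; rw [hs, hvF', inv_smul_smul]
    have key : ∀ g₁, v ∈ closure (interior (F g₁)) →
        ∃ᶠ z in 𝓝 (i v), ψ =ᶠ[𝓝 z] fun z => (g'⁻¹ * g₁) • z := by
      intro g₁ hv₁
      have hfr : ∃ᶠ w in 𝓝 v, w ∈ interior (F g₁) := mem_closure_iff_frequently.1 hv₁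
      have hloc : ∀ᶠ w in 𝓝 v, w ∈ s.target :=
        s.open_target.mem_nhds (hi v).localInverse_mem_target
      refine hci.continuousAt.frequently ((hfr.and_eventually hloc).mono ?_)
      rintro w ⟨hw, hws⟩
      rw [← hi.isLocalHomeomorph.map_nhds_eq w]
      refine Filter.eventually_map.2 ?_
      filter_upwards [isOpen_interior.mem_nhds hw, s.open_target.mem_nhds hws] with w' h1 h2
      have h3 : w' ∈ F g₁ := interior_subset h1
      replace h3 : i' w' = g₁ • i w' := h3
      simp only [ψ]
      rw [show s (i w') = w' from (hi v).localInverse_left_inv h2, h3, mul_smul]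
    have hkv : (g'⁻¹ * g) • i v = i v := by rw [mul_smul, ← hvF, hvF', inv_smul_smul]
    have hid : HasFDerivAt (inChart ψ (i v))
        (ContinuousLinearMap.id ℝ (EuclideanSpace ℝ (Fin n))) (extChartAt (𝓡 n) (i v) (i v)) :=
      hasFDerivAt_inChart_of_frequently hψ hψv (g := fun z => z)
        contMDiffAt_id rfl (hasFDerivAt_inChart_id _)
        ((key g' hv').mono fun z hz => by simpa [id_def] using hz)
    have hk := hasFDerivAt_inChart_of_frequently (hG (g'⁻¹ * g)).contMDiffAt hkv hψ hψv hid
      ((key g hv).mono fun z hz => hz.symm)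
    have := heff _ (smul_eq_self_of_eventually hG (eventually_smul_eq_self hG hkv hk))
    exact (inv_mul_eq_one.1 this).symm
  obtain ⟨v₀⟩ := (inferInstance : Nonempty N)
  obtain ⟨g, hg⟩ := Set.mem_iUnion.1 (hcover.symm ▸ Set.mem_univ v₀)
  -- A finite partition of a connected space into closed sets has only one nonempty member.
  have hclopen : IsClopen (closure (interior (F g))) := by
    refine ⟨isClosed_closure, ?_⟩
    have : closure (interior (F g)) = (⋃ g' : {g' : G // g' ≠ g}, closure (interior (F g')))ᶜ := by
      ext v
      simp only [Set.mem_compl_iff, Set.mem_iUnion, not_exists]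
      constructor
      · intro hv g' hv'
        exact g'.2 (hdisj _ _ v hv' hv)
      · intro hv
        obtain ⟨g', hg'⟩ := Set.mem_iUnion.1 (hcover.symm ▸ Set.mem_univ v)
        by_cases hgg : g' = g
        · exact hgg ▸ hg'
        · exact absurd hg' (hv ⟨g', hgg⟩)
    rw [this]
    exact (isClosed_iUnion_of_finite fun _ => isClosed_closure).isOpen_compl
  refine ⟨g, fun v => ?_⟩
  have hv : v ∈ closure (interior (F g)) := hclopen.eq_univ ⟨v₀, hg⟩ ▸ Set.mem_univ v
  exact (hF g).closure_subset_iff.2 interior_subset hv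

end FiniteActions

end

section

/-! ### Local diffeomorphisms -/

section LocalDiffeomorphisms

variable {n m k : ℕ}
  {M : Type*} [TopologicalSpace M] [ChartedSpace (EuclideanSpace ℝ (Fin n)) M]
  {M' : Type*} [TopologicalSpace M'] [ChartedSpace (EuclideanSpace ℝ (Fin m)) M']
  {N : Type*} [TopologicalSpace N] [ChartedSpace (EuclideanSpace ℝ (Fin k)) N]

theorem _root_.IsLocalDiffeomorphAt.congr_of_eventuallyEq {f g : M → M'} {x : M}
    (hf : IsLocalDiffeomorphAt (𝓡 n) (𝓡 m) ∞ f x) (h : g =ᶠ[𝓝 x] f) :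
    IsLocalDiffeomorphAt (𝓡 n) (𝓡 m) ∞ g x := by
  obtain ⟨Φ, hx, hΦ⟩ := hf
  obtain ⟨s, hs, hso, hxs⟩ := eventually_nhds_iff.1 h
  let Ψ := Φ.toOpenPartialHomeomorph.restrOpen s hso
  have hsub : Ψ.source ⊆ Φ.source := Set.inter_subset_left
  have htgt : Ψ.target ⊆ Φ.target := Set.inter_subset_left
  exact ⟨⟨Ψ.toPartialEquiv, Ψ.open_source, Ψ.open_target, Φ.contMDiffOn_toFun.mono hsub,
    Φ.contMDiffOn_invFun.mono htgt⟩, ⟨hx, hxs⟩, fun y hy => (hs y hy.2).trans (hΦ hy.1)⟩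

theorem _root_.IsLocalDiffeomorph.of_comp {i : M → M'} {d : N → M}
    (hi : IsLocalDiffeomorph (𝓡 n) (𝓡 m) ∞ i)
    (hc : IsLocalDiffeomorph (𝓡 k) (𝓡 m) ∞ fun x => i (d x)) (hd : Continuous d) :
    IsLocalDiffeomorph (𝓡 k) (𝓡 n) ∞ d := fun x =>
  ((hc x).comp (𝓡 n) M (hi (d x)).localInverse_isLocalDiffeomorphAt).congr_of_eventuallyEq
    (hd.continuousAt.eventually ((hi (d x)).localInverse_eventuallyEq_left.mono
      fun _ hy => hy.symm))

theorem _root_.IsLocalDiffeomorph.contMDiffAt_of_comp {i : M → M'} {d : N → M} {x : N}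
    (hi : IsLocalDiffeomorphAt (𝓡 n) (𝓡 m) ∞ i (d x))
    (hc : ContMDiffAt (𝓡 k) (𝓡 m) ∞ (fun x => i (d x)) x) (hd : ContinuousAt d x) :
    ContMDiffAt (𝓡 k) (𝓡 n) ∞ d x :=
  (hi.localInverse_contMDiffAt.comp x hc).congr_of_eventuallyEq
    (hd.eventually (hi.localInverse_eventuallyEq_left.mono fun _ hy => hy.symm))

theorem isLocalDiffeomorph_subtype_val [IsManifold (𝓡 n) ∞ M] (U : TopologicalSpace.Opens M) :
    IsLocalDiffeomorph (𝓡 n) (𝓡 n) ∞ (Subtype.val : U → M) := by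
  intro x
  let e := U.openPartialHomeomorphSubtypeCoe ⟨x⟩
  have hinv : ∀ y : U, e.symm y = y := fun y => e.left_inv (by simp [e])
  refine ⟨⟨e.toPartialEquiv, e.open_source, e.open_target, contMDiff_subtype_val.contMDiffOn, ?_⟩,
    by simp [e], fun y _ => rfl⟩
  intro y hy
  have hyU : y ∈ U := by simpa [e] using hy
  refine ContMDiffAt.contMDiffWithinAt ?_
  have := (contMDiffAt_subtype_iff (I := 𝓡 n) (I' := 𝓡 n) (n := ∞) (f := e.symm) (x := ⟨y, hyU⟩)).1
  refine this (contMDiffAt_id.congr_of_eventuallyEq (Filter.Eventually.of_forall hinv))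

end LocalDiffeomorphisms

/-! ### Reduced uniformizing systems -/

variable {n m : ℕ} {X Y : Type u} [TopologicalSpace X] [TopologicalSpace Y]

namespace UniformizingSystem

variable (A B : UniformizingSystem n X)

instance : ContinuousConstSMul A.G A.V := ⟨fun g => (A.smooth_smul g).continuous⟩

instance : LocallyCompactSpace A.V :=
  ChartedSpace.locallyCompactSpace (EuclideanSpace ℝ (Fin n)) A.V

instance : LocallyConnectedSpace A.V :=
  ChartedSpace.locallyConnectedSpace (EuclideanSpace ℝ (Fin n)) A.V

variable {A B}

theorem proj_eq_iff {a b : A.V} : A.proj a = A.proj b ↔ ∃ g : A.G, b = g • a := by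
  constructor
  · intro h
    have := A.isOpenEmbedding_quotient.injective (a₁ := Quotient.mk _ b) (a₂ := Quotient.mk _ a)
      h.symm
    obtain ⟨g, hg⟩ := Quotient.exact this
    exact ⟨g, hg.symm⟩
  · rintro ⟨g, rfl⟩
    exact (A.proj_smul g a).symm

theorem isOpenMap_proj : IsOpenMap A.proj :=
  A.isOpenEmbedding_quotient.isOpenMap.comp (isOpenMap_quotient_mk'_mul (Γ := A.G))

theorem isOpen_U : IsOpen A.U := isOpenMap_proj.isOpen_range

theorem isLocalDiffeomorph_smul (g : A.G) :
    IsLocalDiffeomorph (𝓡 n) (𝓡 n) ∞ fun v : A.V => g • v :=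
  Diffeomorph.isLocalDiffeomorph
    { toEquiv := MulAction.toPerm g
      contMDiff_toFun := A.smooth_smul g
      contMDiff_invFun := A.smooth_smul g⁻¹ }

theorem mem_ker {g : A.G} : g ∈ A.ker ↔ ∀ v : A.V, g • v = v := by
  simp [ker, MonoidHom.mem_ker, Equiv.ext_iff]

theorem eq_one_of_forall (hA : A.ker = ⊥) {g : A.G} (h : ∀ v : A.V, g • v = v) : g = 1 := by
  simpa [hA] using mem_ker.2 h

theorem eq_one_of_eventually (hA : A.ker = ⊥) {g : A.G} {x : A.V}
    (h : ∀ᶠ y in 𝓝 x, g • y = y) : g = 1 :=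
  eq_one_of_forall hA (smul_eq_self_of_eventually A.smooth_smul h)

theorem eq_of_eventually (hA : A.ker = ⊥) {g g' : A.G} {x : A.V}
    (h : ∀ᶠ y in 𝓝 x, g • y = g' • y) : g = g' := by
  have : g'⁻¹ * g = 1 := eq_one_of_eventually hA (x := x)
    (h.mono fun y hy => by rw [mul_smul, hy, inv_smul_smul])
  exact (inv_mul_eq_one.1 this).symm

theorem exists_smul_eq (hB : B.ker = ⊥)
    {N : Type*} [TopologicalSpace N] [ChartedSpace (EuclideanSpace ℝ (Fin n)) N]
    [T2Space N] [ConnectedSpace N] {i i' : N → B.V}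
    (hi : IsLocalDiffeomorph (𝓡 n) (𝓡 n) ∞ i) (hi' : ContMDiff (𝓡 n) (𝓡 n) ∞ i')
    (h : ∀ v, B.proj (i v) = B.proj (i' v)) : ∃ g : B.G, ∀ v, i' v = g • i v :=
  exists_smul_eq_of_forall_exists B.smooth_smul (fun _ => eq_one_of_forall hB) hi hi'
    fun v => proj_eq_iff.1 (h v)

/-- The system induced on a connected open subset `N` of `V` whose translates that meet `N` are the
translates by elements of the subgroup `S`, all equal to `N`. -/
def restrict (A : UniformizingSystem n X) (N : TopologicalSpace.Opens A.V)
    (hN : IsConnected (N : Set A.V)) (S : Subgroup A.G) (hS : ∀ g ∈ S, ∀ v ∈ N, g • v ∈ N)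
    (hS' : ∀ g : A.G, ∀ v ∈ N, g • v ∈ N → g ∈ S) : UniformizingSystem n X :=
  letI : MulAction S N :=
    { smul := fun g v => ⟨(g : A.G) • (v : A.V), hS g g.2 v v.2⟩
      one_smul := fun v => Subtype.ext (one_smul A.G (v : A.V))
      mul_smul := fun g h v => Subtype.ext (mul_smul (g : A.G) (h : A.G) (v : A.V)) }
  haveI : ConnectedSpace N := isConnected_iff_connectedSpace.1 hN
  haveI : ContinuousConstSMul S N :=
    ⟨fun g => ((continuous_const_smul (g : A.G)).comp continuous_subtype_val).subtype_mk _⟩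
  { V := N
    G := S
    smooth_smul := fun g v => IsLocalDiffeomorph.contMDiffAt_of_comp
      (isLocalDiffeomorph_subtype_val N _)
      ((A.smooth_smul g).comp contMDiff_subtype_val).contMDiffAt
      (continuous_const_smul g).continuousAt
    proj := fun v => A.proj v
    continuous_proj := A.continuous_proj.comp continuous_subtype_val
    proj_smul := fun g v => A.proj_smul g v
    isOpenEmbedding_quotient := by
      refine IsOpenEmbedding.of_continuous_injective_isOpenMap
        (Continuous.quotient_lift (A.continuous_proj.comp continuous_subtype_val) _) ?_ ?_
      · rintro ⟨v⟩ ⟨w⟩ h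
        obtain ⟨g, hg⟩ := proj_eq_iff.1 (show A.proj w = A.proj v from h.symm)
        refine Quotient.sound ⟨⟨g, hS' g w w.2 (hg ▸ v.2)⟩, Subtype.ext hg.symm⟩
      · exact IsOpenMap.of_comp continuous_quotient_mk' Quotient.mk_surjective
          (isOpenMap_proj.comp N.2.isOpenMap_subtype_val) }

end UniformizingSystem

/-! ### Rigidity of injections between reduced systems -/

namespace Injection

open UniformizingSystem

variable {A B C D : UniformizingSystem n X}

theorem injective (i : Injection A B) : Function.Injective i.toFun := i.isOpenEmbedding.injective

theorem continuous (i : Injection A B) : Continuous i.toFun := i.isOpenEmbedding.continuous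

theorem ker_source (i : Injection A B) (hB : B.ker = ⊥) : A.ker = ⊥ := by
  have := i.map_ker
  rw [hB] at this
  exact (Subgroup.map_eq_bot_iff_of_injective _ i.hom_injective).1 this

theorem ker_target (i : Injection A B) (hA : A.ker = ⊥) : B.ker = ⊥ := by
  rw [← i.map_ker, hA, Subgroup.map_bot]

theorem U_subset (i : Injection A B) : A.U ⊆ B.U := by
  rintro _ ⟨v, rfl⟩
  exact ⟨i.toFun v, i.proj_comp v⟩

/-- The image is open, and an element of an effective group is determined by its action on an open
set; so the map determines the homomorphism. -/
theorem eq_of_toFun_eq (hB : B.ker = ⊥) {i j : Injection A B} (h : ∀ v, i.toFun v = j.toFun v) :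
    i = j := by
  refine Injection.ext (funext h) (MonoidHom.ext fun g => ?_)
  obtain ⟨v⟩ := (inferInstance : Nonempty A.V)
  refine eq_of_eventually hB (x := i.toFun v) ?_
  rw [← i.isOpenEmbedding.map_nhds_eq, Filter.eventually_map]
  refine Filter.Eventually.of_forall fun w => ?_
  rw [← i.equivariant, h w, ← j.equivariant, h]

/-- A smooth open embedding over `X` of reduced systems underlies an injection. -/
theorem exists_toFun_eq (hA : A.ker = ⊥) (hB : B.ker = ⊥) (φ : A.V → B.V) (ho : IsOpenEmbedding φ)
    (hφ : IsLocalDiffeomorph (𝓡 n) (𝓡 n) ∞ φ) (hp : ∀ v, B.proj (φ v) = A.proj v) :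
    ∃ i : Injection A B, i.toFun = φ := by
  have hex : ∀ g : A.G, ∃ g' : B.G, ∀ v, φ (g • v) = g' • φ v := fun g =>
    exists_smul_eq hB hφ (hφ.contMDiff.comp (A.smooth_smul g)) fun v => by
      simp only [hp, A.proj_smul]
  choose f hf using hex
  obtain ⟨v₀⟩ := (inferInstance : Nonempty A.V)
  -- A group element is determined by its action on the open image of `φ`. This makes the chosen `f`
  -- multiplicative.
  have huniq : ∀ {g g' : B.G}, (∀ v, g • φ v = g' • φ v) → g = g' := fun {g g'} h =>
    eq_of_eventually hB (x := φ v₀) (by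
      rw [← ho.map_nhds_eq, Filter.eventually_map]
      exact Filter.Eventually.of_forall h)
  let F : A.G →* B.G :=
    { toFun := f
      map_one' := huniq fun v => by rw [← hf, one_smul, one_smul]
      map_mul' := fun g g' => huniq fun v => by rw [← hf, mul_smul, mul_smul, hf, hf] }
  have hinj : Function.Injective F := by
    rw [injective_iff_map_eq_one]
    intro g hg
    refine eq_one_of_forall hA fun v => ho.injective ?_
    rw [hf, show f g = 1 from hg, one_smul]
  exact ⟨⟨φ, F, hinj, by rw [hA, hB, Subgroup.map_bot], ho, hφ, hf, hp⟩, rfl⟩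

/-- Two parallel injections of reduced systems differ by an element of the group. -/
theorem exists_smul_eq (hB : B.ker = ⊥) (i j : Injection A B) :
    ∃ g : B.G, ∀ v, j.toFun v = g • i.toFun v :=
  UniformizingSystem.exists_smul_eq hB i.isLocalDiffeomorph j.isLocalDiffeomorph.contMDiff
    fun v => by rw [i.proj_comp, j.proj_comp]

/-- The two injections differ by a group element, which here fixes an open set pointwise and is
therefore 1. -/
theorem eq_of_eventuallyEq (hB : B.ker = ⊥) {i j : Injection A B} {v : A.V}
    (h : ∀ᶠ w in 𝓝 v, i.toFun w = j.toFun w) : i = j := by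
  obtain ⟨g, hg⟩ := exists_smul_eq hB i j
  have : g = 1 := eq_one_of_eventually hB (x := i.toFun v) (by
    rw [← i.isOpenEmbedding.map_nhds_eq, Filter.eventually_map]
    exact h.mono fun w hw => by rw [← hg, hw])
  exact eq_of_toFun_eq hB fun w => by rw [hg, this, one_smul]

theorem eq_of_comp_eq (hB : B.ker = ⊥) {i j : Injection A B} (c : Injection D A)
    (h : ∀ w, i.toFun (c.toFun w) = j.toFun (c.toFun w)) : i = j := by
  obtain ⟨v⟩ := (inferInstance : Nonempty D.V)
  refine eq_of_eventuallyEq hB (v := c.toFun v) ?_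
  rw [← c.isOpenEmbedding.map_nhds_eq, Filter.eventually_map]
  exact Filter.Eventually.of_forall h

/-- An element of the group of a reduced system, as an injection. -/
theorem exists_smul (hA : A.ker = ⊥) (g : A.G) :
    ∃ i : Injection A A, ∀ v, i.toFun v = g • v := by
  obtain ⟨i, hi⟩ := exists_toFun_eq hA hA (fun v => g • v) (Homeomorph.smul g).isOpenEmbedding
    (isLocalDiffeomorph_smul g) (A.proj_smul g)
  exact ⟨i, fun v => by rw [hi]⟩

theorem exists_smul_comp (hB : B.ker = ⊥) (i : Injection A B) (g : B.G) :
    ∃ j : Injection A B, ∀ v, j.toFun v = g • i.toFun v := by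
  obtain ⟨k, hk⟩ := exists_smul hB g
  exact ⟨k.comp i, fun v => hk _⟩

/-- An injection into `C` with image contained in the image of `A` factors through `A`. -/
theorem exists_factor (hC : C.ker = ⊥) (c : Injection D C) (i : Injection A C)
    (h : Set.range c.toFun ⊆ Set.range i.toFun) :
    ∃ d : Injection D A, ∀ v, i.toFun (d.toFun v) = c.toFun v := by
  choose d hd using fun v => h ⟨v, rfl⟩
  have hfun : (fun v => i.toFun (d v)) = c.toFun := funext hd
  have hcont : Continuous d := by
    rw [i.isOpenEmbedding.isInducing.continuous_iff]
    exact (show Continuous (fun v => i.toFun (d v)) from hfun.symm ▸ c.continuous)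
  have hopen : IsOpenEmbedding d :=
    IsOpenEmbedding.of_comp d i.isOpenEmbedding (show IsOpenEmbedding (fun v => i.toFun (d v)) from
      hfun.symm ▸ c.isOpenEmbedding)
  have hloc : IsLocalDiffeomorph (𝓡 n) (𝓡 n) ∞ d :=
    i.isLocalDiffeomorph.of_comp (hfun.symm ▸ c.isLocalDiffeomorph) hcont
  obtain ⟨e, he⟩ := exists_toFun_eq (c.ker_source hC) (i.ker_source hC) d hopen hloc fun v => by
    rw [← i.proj_comp, hd, c.proj_comp]
  exact ⟨e, fun v => by rw [he, hd]⟩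

end Injection

/-! ### Small restrictions, pullbacks and links between systems -/

namespace UniformizingSystem

variable {A B C : UniformizingSystem n X}

/-- A reduced system restricts to arbitrarily small neighbourhoods of every point. -/
theorem exists_injection_range_subset (hA : A.ker = ⊥) {a : A.V} {s : Set A.V} (hs : s ∈ 𝓝 a) :
    ∃ (W : UniformizingSystem n X) (i : Injection W A) (w : W.V),
      i.toFun w = a ∧ Set.range i.toFun ⊆ s := by
  classical
  set S := MulAction.stabilizer A.G a
  -- Each element that moves `a` is excluded on some neighbourhood of `a` disjoint from its
  -- translate; there are only finitely many.
  have hsep : ∀ g : A.G, ∃ t ∈ 𝓝 a, g ∉ S → ∀ v ∈ t, g • v ∉ t := by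
    intro g
    by_cases hg : g ∈ S
    · exact ⟨Set.univ, Filter.univ_mem, fun h => absurd hg h⟩
    · obtain ⟨t₁, h₁, t₂, h₂, hd⟩ := Filter.disjoint_iff.1
        (disjoint_nhds_nhds.2 (show g • a ≠ a from hg))
      refine ⟨t₂ ∩ (fun v => g • v) ⁻¹' t₁,
        Filter.inter_mem h₂ ((continuous_const_smul g).continuousAt h₁), fun _ v hv hv' => ?_⟩
      exact Set.disjoint_left.1 hd hv.2 hv'.1
  choose t ht hts using hsep
  have hN₁ : interior (s ∩ ⋂ g, t g) ∈ 𝓝 a :=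
    interior_mem_nhds.2 (Filter.inter_mem hs (Filter.iInter_mem.2 ht))
  set N₁ := interior (s ∩ ⋂ g, t g)
  have hsub : N₁ ⊆ s ∩ ⋂ g, t g := interior_subset
  -- Intersecting the translates under the stabilizer makes the neighbourhood invariant. Its
  -- component at `a` stays invariant because the stabilizer fixes `a`.
  set N₀ : Set A.V := ⋂ h : S, (fun v => (h : A.G) • v) ⁻¹' N₁
  have hN₀ : IsOpen N₀ :=
    isOpen_iInter_of_finite fun h => isOpen_interior.preimage (continuous_const_smul _)
  have haN₀ : a ∈ N₀ := Set.mem_iInter.2 fun h => by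
    rw [Set.mem_preimage, show (h : A.G) • a = a from h.2]
    exact mem_of_mem_nhds hN₁
  have hN₀₁ : N₀ ⊆ N₁ := fun v hv => by simpa using Set.mem_iInter.1 hv 1
  have hinv : ∀ g ∈ S, Set.MapsTo (fun v => g • v) N₀ N₀ := fun g hg v hv =>
    Set.mem_iInter.2 fun h => by
      have := Set.mem_iInter.1 hv (h * ⟨g, hg⟩)
      simpa [mul_smul] using this
  let N : TopologicalSpace.Opens A.V := ⟨connectedComponentIn N₀ a, hN₀.connectedComponentIn⟩
  have hNN₀ : (N : Set A.V) ⊆ N₀ := connectedComponentIn_subset _ _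
  have haN : a ∈ N := mem_connectedComponentIn haN₀
  have hNS : ∀ g ∈ S, ∀ v ∈ N, g • v ∈ N := by
    intro g hg v hv
    have := (continuous_const_smul g).continuousOn.mapsTo_connectedComponentIn haN₀ hv
    rw [show g • a = a from hg] at this
    exact connectedComponentIn_mono a (hinv g hg).image_subset this
  have hNS' : ∀ g : A.G, ∀ v ∈ N, g • v ∈ N → g ∈ S := by
    intro g v hv hgv
    by_contra hg
    exact hts g hg v (Set.mem_iInter.1 (hsub (hN₀₁ (hNN₀ hv))).2 g)
      (Set.mem_iInter.1 (hsub (hN₀₁ (hNN₀ hgv))).2 g)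
  have hconn : IsConnected (N : Set A.V) := isConnected_connectedComponentIn_iff.2 haN₀
  let W := A.restrict N hconn S hNS hNS'
  have hW : W.ker = ⊥ := by
    rw [eq_bot_iff]
    intro g hg
    have hg' := mem_ker.1 hg
    have : (g : S).1 = 1 := eq_one_of_eventually hA (x := a) (by
      filter_upwards [N.2.mem_nhds haN] with v hv
      exact congrArg (fun w : N => w.1) (hg' ⟨v, hv⟩))
    exact Subtype.ext this
  obtain ⟨i, hi⟩ := Injection.exists_toFun_eq hW hA (Subtype.val : N → A.V)
    N.2.isOpenEmbedding_subtypeVal (isLocalDiffeomorph_subtype_val N) fun v => rfl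
  refine ⟨W, i, ⟨a, haN⟩, by rw [hi], ?_⟩
  rw [hi]
  rintro _ ⟨v, rfl⟩
  exact (hsub (hN₀₁ (hNN₀ v.2))).1

/-- Injections `A → C ← B` with a common value have a common refinement there. -/
theorem exists_pullback (hC : C.ker = ⊥) (i : Injection A C) (j : Injection B C) {a : A.V} {b : B.V}
    (h : i.toFun a = j.toFun b) :
    ∃ (W : UniformizingSystem n X) (c : Injection W A) (d : Injection W B) (w : W.V),
      c.toFun w = a ∧ d.toFun w = b ∧ ∀ x, i.toFun (c.toFun x) = j.toFun (d.toFun x) := by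
  -- A small restriction of `C` inside the open intersection of both images factors through `A` and
  -- through `B`.
  obtain ⟨W, e, w, hw, hr⟩ := exists_injection_range_subset hC (a := i.toFun a)
    (Filter.inter_mem (i.isOpenEmbedding.isOpen_range.mem_nhds ⟨a, rfl⟩)
      (j.isOpenEmbedding.isOpen_range.mem_nhds ⟨b, h.symm⟩))
  obtain ⟨c, hc⟩ := e.exists_factor hC i (hr.trans Set.inter_subset_left)
  obtain ⟨d, hd⟩ := e.exists_factor hC j (hr.trans Set.inter_subset_right)
  exact ⟨W, c, d, w, i.injective (by rw [hc, hw]), j.injective (by rw [hd, hw, h]),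
    fun x => by rw [hc, hd]⟩

/-- An element of the group of `B` that maps a point of the image of `A` to the image of `A` comes
from the group of `A`. -/
theorem exists_hom_eq (hB : B.ker = ⊥) (i : Injection A B) {g : B.G} {a b : A.V}
    (h : g • i.toFun a = i.toFun b) : ∃ g' : A.G, i.hom g' = g := by
  obtain ⟨j, hj⟩ := i.exists_smul_comp hB g
  -- Pulling back `g ∘ i` along `i` gives parallel injections into `A`, which differ by some `g'`;
  -- then `i.hom g'` and `g` agree on an open set.
  obtain ⟨W, c, d, w, -, -, hcd⟩ := exists_pullback hB j i (a := a) (b := b) (by rw [hj, h])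
  obtain ⟨g', hg'⟩ := Injection.exists_smul_eq (i.ker_source hB) c d
  refine ⟨g', (eq_of_eventually hB (x := (i.comp c).toFun w) ?_).symm⟩
  rw [← (i.comp c).isOpenEmbedding.map_nhds_eq w, Filter.eventually_map]
  refine Filter.Eventually.of_forall fun x => ?_
  change g • i.toFun (c.toFun x) = i.hom g' • i.toFun (c.toFun x)
  rw [← hj, hcd, hg', i.equivariant]

/-- `A` and `B` have a common refinement that identifies the points `a` and `b`. -/
def Linked (A B : UniformizingSystem n X) (a : A.V) (b : B.V) : Prop :=
  ∃ (W : UniformizingSystem n X) (i : Injection W A) (j : Injection W B) (w : W.V),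
    i.toFun w = a ∧ j.toFun w = b

theorem Linked.symm {a : A.V} {b : B.V} : Linked A B a b → Linked B A b a
  | ⟨W, i, j, w, hi, hj⟩ => ⟨W, j, i, w, hj, hi⟩

/-- The two refinements share a point of `B`; their pullback over `B` refines `A` and `C` at once.
-/
theorem Linked.trans (hB : B.ker = ⊥) {a : A.V} {b : B.V} {c : C.V} :
    Linked A B a b → Linked B C b c → Linked A C a c := by
  rintro ⟨W, i, j, w, rfl, rfl⟩ ⟨W', i', j', w', hi', rfl⟩
  obtain ⟨Z, e, e', z, he, he', -⟩ := exists_pullback hB j i' hi'.symm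
  exact ⟨Z, i.comp e, j'.comp e', z, congrArg i.toFun he, congrArg j'.toFun he'⟩

theorem Linked.of_injection (i : Injection A B) (a : A.V) : Linked A B a (i.toFun a) :=
  ⟨A, Injection.id A, i, a, rfl, rfl⟩

theorem Linked.of_proj_eq (hA : A.ker = ⊥) {a b : A.V} (h : A.proj a = A.proj b) :
    Linked A A a b := by
  obtain ⟨g, rfl⟩ := proj_eq_iff.1 h
  obtain ⟨i, hi⟩ := Injection.exists_smul hA g
  exact hi a ▸ Linked.of_injection i a

/-- Equivalence at `p` links some pair of points over `p`. All other points over `p` are obtained by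
group elements, which are themselves injections. -/
theorem _root_.Orb.EquivalentAt.linked (hA : A.ker = ⊥) (hB : B.ker = ⊥) {p : X}
    (h : EquivalentAt p A B) {a : A.V} {b : B.V} (ha : A.proj a = p) (hb : B.proj b = p) :
    Linked A B a b := by
  obtain ⟨W, ⟨w, hw⟩, ⟨i⟩, ⟨j⟩⟩ := h
  have h₁ : Linked A A a (i.toFun w) := .of_proj_eq hA (by rw [ha, i.proj_comp, hw])
  have h₂ : Linked B B (j.toFun w) b := .of_proj_eq hB (by rw [hb, j.proj_comp, hw])
  exact (h₁.trans hA (Linked.of_injection i w).symm).trans (i.ker_source hA)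
    ((Linked.of_injection j w).trans hB h₂)

theorem Linked.equivalentAt {a : A.V} {b : B.V} : Linked A B a b → EquivalentAt (A.proj a) A B
  | ⟨W, i, j, w, hi, _⟩ => ⟨W, ⟨w, by rw [← hi, i.proj_comp]⟩, ⟨i⟩, ⟨j⟩⟩

end UniformizingSystem

/-! ### Charts of a reduced orbifold -/

namespace OrbifoldStructure

open UniformizingSystem

variable {O : OrbifoldStructure n X} {A B : UniformizingSystem n X}

theorem isChart_chart (O : OrbifoldStructure n X) (p : X) : O.IsChart (O.chart p) :=
  O.equivalentAt p

theorem IsChart.ker_eq_bot (hA : O.IsChart A) (hO : O.IsReduced) : A.ker = ⊥ := by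
  obtain ⟨v⟩ := (inferInstance : Nonempty A.V)
  obtain ⟨W, -, ⟨i⟩, ⟨j⟩⟩ := hA _ ⟨v, rfl⟩
  exact i.ker_target (j.ker_source (hO _))

/-- Both charts are linked to the chart of the orbifold structure at the common image point, and
links compose. -/
theorem IsChart.linked (hO : O.IsReduced) (hA : O.IsChart A) (hB : O.IsChart B) {a : A.V} {b : B.V}
    (h : A.proj a = B.proj b) : Linked A B a b := by
  obtain ⟨c, hc⟩ := O.mem_chart (A.proj a)
  have hA' := hA.ker_eq_bot hO
  have hB' := hB.ker_eq_bot hO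
  exact ((hA _ ⟨a, rfl⟩).linked hA' (hO _) rfl hc).trans (hO _)
    ((h ▸ hB _ ⟨b, rfl⟩ : EquivalentAt (A.proj a) B (O.chart (A.proj a))).linked hB' (hO _)
      h.symm hc).symm

theorem IsChart.of_injection (hO : O.IsReduced) (hA : O.IsChart A) (i : Injection B A) :
    O.IsChart B := by
  rintro _ ⟨b, rfl⟩
  obtain ⟨c, hc⟩ := O.mem_chart (B.proj b)
  have : Linked B (O.chart (B.proj b)) b c :=
    (Linked.of_injection i b).trans (hA.ker_eq_bot hO)
      (hA.linked hO (O.isChart_chart _) (by rw [i.proj_comp, hc]))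
  exact this.equivalentAt

end OrbifoldStructure

end

section

/-! ### Disjoint unions of manifolds -/

section Sigma

variable {n : ℕ} {ι : Type u} (M : ι → Type u) [∀ i, TopologicalSpace (M i)]

/-- Precise refinements on the summands, indexed by the given cover, are glued by taking the union
over all summands for each index. -/
theorem paracompactSpace_sigma [∀ i, ParacompactSpace (M i)] : ParacompactSpace (Σ i, M i) where
  locallyFinite_refinement := by
    intro α s ho hc
    have key : ∀ i, ∃ v : α → Set (M i), (∀ a, IsOpen (v a)) ∧ ⋃ a, v a = Set.univ ∧
        LocallyFinite v ∧ ∀ a, v a ⊆ Sigma.mk i ⁻¹' s a := fun i =>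
      precise_refinement (fun a => Sigma.mk i ⁻¹' s a)
        (fun a => (ho a).preimage continuous_sigmaMk) (by rw [← Set.preimage_iUnion, hc]; rfl)
    choose v hvo hvc hvf hvs using key
    refine ⟨α, fun a => ⋃ i, Sigma.mk i '' v i a, fun a => isOpen_iUnion fun i =>
      isOpenMap_sigmaMk _ (hvo i a), ?_, ?_, fun a => ⟨a, ?_⟩⟩
    · refine Set.eq_univ_of_forall fun ⟨i, x⟩ => ?_
      obtain ⟨a, ha⟩ := Set.mem_iUnion.1 (hvc i ▸ Set.mem_univ x)
      exact Set.mem_iUnion.2 ⟨a, Set.mem_iUnion.2 ⟨i, x, ha, rfl⟩⟩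
    · rintro ⟨i, x⟩
      obtain ⟨t, ht, hf⟩ := hvf i x
      refine ⟨Sigma.mk i '' t, isOpenMap_sigmaMk.image_mem_nhds ht, hf.subset ?_⟩
      rintro a ⟨_, hy, y, hyt, rfl⟩
      obtain ⟨j, z, hz, hzy⟩ := Set.mem_iUnion.1 hy
      cases hzy
      exact ⟨y, hz, hyt⟩
    · rintro _ h
      obtain ⟨i, z, hz, rfl⟩ := Set.mem_iUnion.1 h
      exact hvs i a hz

variable [∀ i, ChartedSpace (EuclideanSpace ℝ (Fin n)) (M i)]

theorem isManifold_sigma [h : ∀ i, IsManifold (𝓡 n) ∞ (M i)] :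
    @IsManifold ℝ _ _ _ _ _ _ (𝓡 n) ∞ (Σ i, M i) _ (sigmaChartedSpace M) :=
  letI := sigmaChartedSpace (n := n) M
  { compatible := by
      intro e e' he he'
      obtain ⟨i, f, hf, rfl⟩ := Set.mem_iUnion.1 he
      obtain ⟨j, f', hf', rfl⟩ := Set.mem_iUnion.1 he'
      by_cases hij : i = j
      · subst hij
        dsimp only
        rw [f.lift_openEmbedding_trans f']
        exact (h i).compatible hf hf'
      · apply ContDiffGroupoid.mem_of_source_eq_empty
        ext x
        refine ⟨fun ⟨hx₁, hx₂⟩ => ?_, fun hx => hx.elim⟩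
        obtain ⟨y, hy, hyx⟩ := hx₂
        exact hij (congrArg Sigma.fst hyx).symm }

/-- In corresponding charts of the summand and of the union, the inclusion and its local inverse
both read as the identity. -/
theorem isLocalDiffeomorph_sigmaMk (i : ι) :
    letI := sigmaChartedSpace (n := n) M
    IsLocalDiffeomorph (𝓡 n) (𝓡 n) ∞ (Sigma.mk i : M i → Σ i, M i) := by
  let _ := sigmaChartedSpace (n := n) M
  intro x
  have ho : IsOpenEmbedding (Sigma.mk i : M i → Σ i, M i) := IsOpenEmbedding.sigmaMk
  have : Nonempty (M i) := ⟨x⟩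
  set e := ho.toOpenPartialHomeomorph
  have hinv : ∀ y, e.symm ⟨i, y⟩ = y := fun y => e.left_inv (x := y) trivial
  have hchart : ∀ (y : M i) (z : M i), chartAt (EuclideanSpace ℝ (Fin n)) (⟨i, y⟩ : Σ i, M i) ⟨i, z⟩ =
      chartAt (EuclideanSpace ℝ (Fin n)) y z := fun y z =>
    OpenPartialHomeomorph.lift_openEmbedding_apply _ ho
  have hsymm : ∀ (y : M i) z, (chartAt (EuclideanSpace ℝ (Fin n)) (⟨i, y⟩ : Σ i, M i)).symm z =
      ⟨i, (chartAt (EuclideanSpace ℝ (Fin n)) y).symm z⟩ := fun y z => rfl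
  refine ⟨⟨e.toPartialEquiv, e.open_source, e.open_target, ?_, ?_⟩, trivial, fun y _ => rfl⟩
  · refine ContMDiff.contMDiffOn fun y => ?_
    refine contMDiffAt_iff.2 ⟨continuous_sigmaMk.continuousAt, ?_⟩
    refine contDiffWithinAt_id.congr_of_eventuallyEq ?_ ?_
    · filter_upwards [mem_nhdsWithin_of_mem_nhds (extChartAt_target_mem_nhds (I := 𝓡 n) y)] with u hu
      exact (hchart y _).trans ((extChartAt (𝓡 n) y).right_inv hu)
    · exact (hchart y _).trans ((extChartAt (𝓡 n) y).right_inv (mem_extChartAt_target y))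
  · rintro _ ⟨y, -, rfl⟩
    refine ContMDiffAt.contMDiffWithinAt ?_
    refine contMDiffAt_iff.2 ⟨e.symm.continuousAt (e.map_source (x := y) trivial), ?_⟩
    have hy : e.symm (Sigma.mk i y) = y := hinv y
    refine ContDiffWithinAt.congr_of_eventuallyEq contDiffWithinAt_id ?_ ?_
    · change _ =ᶠ[𝓝[_] (extChartAt (𝓡 n) (⟨i, y⟩ : Σ i, M i) ⟨i, y⟩)] _
      filter_upwards [mem_nhdsWithin_of_mem_nhds
        (extChartAt_target_mem_nhds (I := 𝓡 n) (⟨i, y⟩ : Σ i, M i))] with u hu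
      have hu' : u ∈ (chartAt (EuclideanSpace ℝ (Fin n)) y).target := by
        have : u ∈ (chartAt (EuclideanSpace ℝ (Fin n)) (⟨i, y⟩ : Σ i, M i)).target := by
          simpa using hu
        exact this
      change chartAt _ (e.symm ⟨i, y⟩) (e.symm ⟨i, (chartAt _ y).symm u⟩) = u
      rw [hinv, hinv]
      exact (chartAt _ y).right_inv hu'
    · change chartAt (EuclideanSpace ℝ (Fin n)) (e.symm ⟨i, y⟩)
        (e.symm ((chartAt (EuclideanSpace ℝ (Fin n)) (⟨i, y⟩ : Σ i, M i)).symm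
          (chartAt (EuclideanSpace ℝ (Fin n)) (⟨i, y⟩ : Σ i, M i) ⟨i, y⟩))) =
            chartAt (EuclideanSpace ℝ (Fin n)) (⟨i, y⟩ : Σ i, M i) ⟨i, y⟩
      rw [hchart, hsymm, hinv, hinv]
      exact (chartAt _ y).right_inv (mem_chart_target _ y)

end Sigma

end

section

/-! ### Arrows of the groupoid of a reduced orbifold -/

namespace OrbifoldStructure

open UniformizingSystem

variable {n : ℕ} {X : Type u} [TopologicalSpace X] {O : OrbifoldStructure n X}

/-- The objects of the groupoid, as a disjoint union. -/
abbrev Point (O : OrbifoldStructure n X) := Σ p : X, (O.chart p).V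

instance : ChartedSpace (EuclideanSpace ℝ (Fin n)) O.Point :=
  sigmaChartedSpace fun p : X => (O.chart p).V

/-- The source of an arrow. -/
def source (r : O.Arrow) : O.Point := O.groupoid.src r

/-- The target of an arrow. -/
def target (r : O.Arrow) : O.Point := O.groupoid.tgt r

/-- The point of `X` under an object of the groupoid. -/
def Point.proj (x : O.Point) : X := (O.chart x.1).proj x.2

namespace Span

/-- The map `w ↦ λ₁ w`. -/
def src (D : O.Span) (w : D.W.V) : O.Point := ⟨D.p, D.fst.toFun w⟩

/-- The map `w ↦ λ₂ w`. -/
def tgt (D : O.Span) (w : D.W.V) : O.Point := ⟨D.q, D.snd.toFun w⟩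

/-- The map `w ↦ [λ₁, w, λ₂]`. -/
def arr (D : O.Span) (w : D.W.V) : O.Arrow := Quot.mk _ ⟨D, w⟩

theorem ker_eq_bot (hO : O.IsReduced) (D : O.Span) : D.W.ker = ⊥ := D.fst.ker_source (hO _)

theorem src_injective (D : O.Span) : Function.Injective D.src := fun _ _ h =>
  D.fst.injective (eq_of_heq (Sigma.mk.inj_iff.1 h).2)

theorem arr_injective (D : O.Span) : Function.Injective D.arr := fun _ _ h =>
  D.src_injective (congrArg source h)

theorem isOpenEmbedding_src (D : O.Span) : IsOpenEmbedding D.src :=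
  IsOpenEmbedding.sigmaMk.comp D.fst.isOpenEmbedding

theorem isOpenEmbedding_tgt (D : O.Span) : IsOpenEmbedding D.tgt :=
  IsOpenEmbedding.sigmaMk.comp D.snd.isOpenEmbedding

theorem arr_restrict (D : O.Span) {W : UniformizingSystem n X} (γ : Injection W D.W) (w : W.V) :
    (D.restrict γ).arr w = D.arr (γ.toFun w) :=
  (Quot.sound (TripleRel.mk D W γ w)).symm

/-- `(λ₁, w, λ₂)` and `(λ₁', w', λ₂')` have a common restriction. -/
def Meet (D D' : O.Span) (w : D.W.V) (w' : D'.W.V) : Prop :=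
  ∃ (N : UniformizingSystem n X) (c : Injection N D.W) (c' : Injection N D'.W) (x : N.V),
    c.toFun x = w ∧ c'.toFun x = w' ∧ (∀ y, D.src (c.toFun y) = D'.src (c'.toFun y)) ∧
      ∀ y, D.tgt (c.toFun y) = D'.tgt (c'.toFun y)

/-- Two common restrictions that share a point of `D'.W` are merged by a pullback over it. -/
theorem Meet.trans (hO : O.IsReduced) {D D' D'' : O.Span} {w w' w''} :
    Meet D D' w w' → Meet D' D'' w' w'' → Meet D D'' w w'' := by
  rintro ⟨N, c, c', x, rfl, rfl, hs, ht⟩ ⟨M, d, d', y, hy, rfl, hs', ht'⟩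
  obtain ⟨L, e, e', z, he, he', hee⟩ := exists_pullback (D'.ker_eq_bot hO) c' d hy.symm
  refine ⟨L, c.comp e, d'.comp e', z, congrArg c.toFun he, congrArg d'.toFun he', fun l => ?_,
    fun l => ?_⟩
  · exact (hs _).trans ((congrArg D'.src (hee l)).trans (hs' _))
  · exact (ht _).trans ((congrArg D'.tgt (hee l)).trans (ht' _))

theorem Meet.symm {D D' : O.Span} {w w'} : Meet D D' w w' → Meet D' D w' w := by
  rintro ⟨N, c, c', x, h, h', hs, ht⟩
  exact ⟨N, c', c, x, h', h, fun y => (hs y).symm, fun y => (ht y).symm⟩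

/-- Injections into reduced systems are determined by their underlying maps, so the two restricted
spans are literally equal. -/
theorem arr_eq_arr_of_eq (hO : O.IsReduced) {D D' : O.Span} {N : UniformizingSystem n X}
    (c : Injection N D.W) (c' : Injection N D'.W)
    (hs : ∀ y, D.src (c.toFun y) = D'.src (c'.toFun y))
    (ht : ∀ y, D.tgt (c.toFun y) = D'.tgt (c'.toFun y)) (y₀ : N.V) :
    D.arr (c.toFun y₀) = D'.arr (c'.toFun y₀) := by
  obtain ⟨W, p, q, f, g⟩ := D
  obtain ⟨W', p', q', f', g'⟩ := D'
  obtain rfl : p = p' := congrArg Sigma.fst (hs y₀)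
  obtain rfl : q = q' := congrArg Sigma.fst (ht y₀)
  have h₁ : f.comp c = f'.comp c' := Injection.eq_of_toFun_eq (hO p) fun y =>
    eq_of_heq (Sigma.mk.inj_iff.1 (hs y)).2
  have h₂ : g.comp c = g'.comp c' := Injection.eq_of_toFun_eq (hO q) fun y =>
    eq_of_heq (Sigma.mk.inj_iff.1 (ht y)).2
  rw [← arr_restrict, ← arr_restrict]
  change O.arrow (f.comp c) y₀ (g.comp c) = O.arrow (f'.comp c') y₀ (g'.comp c')
  rw [h₁, h₂]

/-- `Meet` is an equivalence relation containing the generating identifications. This turns equality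
in the quotient into concrete data and underlies every later argument on arrows. -/
theorem arr_eq_arr_iff (hO : O.IsReduced) {D D' : O.Span} {w w'} :
    D.arr w = D'.arr w' ↔ Meet D D' w w' := by
  constructor
  · intro h
    have h' : ∀ a b : O.Triple, Relation.EqvGen O.TripleRel a b → Meet a.1 b.1 a.2 b.2 := by
      intro a b hab
      induction hab with
      | rel a b h =>
        obtain ⟨D, W, γ, w⟩ := h
        exact ⟨W, γ, Injection.id W, w, rfl, rfl, fun _ => rfl, fun _ => rfl⟩
      | refl a => exact ⟨_, Injection.id _, Injection.id _, a.2, rfl, rfl, fun _ => rfl, fun _ => rfl⟩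
      | symm a b _ ih => exact ih.symm
      | trans a b c _ _ ih ih' => exact ih.trans hO ih'
    exact h' _ _ (Quot.eqvGen_exact h)
  · rintro ⟨N, c, c', x, rfl, rfl, hs, ht⟩
    exact arr_eq_arr_of_eq hO c c' hs ht x

theorem continuous_arr (D : O.Span) : Continuous D.arr :=
  continuous_quot_mk.comp (continuous_sigmaMk (σ := fun D : O.Span => D.W.V))

/-- These maps serve as charts of the space of arrows. They are open since a common restriction at
one point also identifies all nearby triples. -/
theorem isOpenEmbedding_arr (hO : O.IsReduced) (D : O.Span) : IsOpenEmbedding D.arr := by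
  refine .of_continuous_injective_isOpenMap D.continuous_arr D.arr_injective fun s hs => ?_
  refine isOpen_coinduced.2 (isOpen_sigma_iff.2 fun D' => isOpen_iff_mem_nhds.2 fun w' hw' => ?_)
  obtain ⟨w, hw, h⟩ := hw'
  obtain ⟨N, c, c', x, rfl, rfl, hst⟩ := (arr_eq_arr_iff hO).1 h
  have : c'.toFun '' (c.toFun ⁻¹' s) ∈ 𝓝 (c'.toFun x) :=
    c'.isOpenEmbedding.isOpenMap.image_mem_nhds (c.continuous.continuousAt (hs.mem_nhds hw))
  filter_upwards [this]
  rintro _ ⟨y, hy, rfl⟩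
  exact ⟨c.toFun y, hy, (arr_eq_arr_iff hO).2 ⟨N, c, c', y, rfl, rfl, hst⟩⟩

end Span

theorem exists_arr_eq (r : O.Arrow) : ∃ (D : O.Span) (w : D.W.V), D.arr w = r := by
  obtain ⟨⟨D, w⟩, rfl⟩ := Quot.exists_rep r
  exact ⟨D, w, rfl⟩

section Arrows

variable {W W' A B : UniformizingSystem n X} {p q r : X}

@[simp] theorem source_arrow (f : Injection W (O.chart p)) (w : W.V) (g : Injection W (O.chart q)) :
    source (O.arrow f w g) = ⟨p, f.toFun w⟩ := rfl

@[simp] theorem target_arrow (f : Injection W (O.chart p)) (w : W.V) (g : Injection W (O.chart q)) :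
    target (O.arrow f w g) = ⟨q, g.toFun w⟩ := rfl

theorem arrow_comp (f : Injection W (O.chart p)) (g : Injection W (O.chart q))
    (γ : Injection W' W) (w : W'.V) :
    O.arrow (f.comp γ) w (g.comp γ) = O.arrow f (γ.toFun w) g :=
  Span.arr_restrict ⟨W, p, q, f, g⟩ γ w

theorem isOpenEmbedding_arrow (hO : O.IsReduced) (f : Injection W (O.chart p))
    (g : Injection W (O.chart q)) : IsOpenEmbedding fun w => O.arrow f w g :=
  Span.isOpenEmbedding_arr hO ⟨W, p, q, f, g⟩

theorem arrow_eq_iff (hO : O.IsReduced) {f : Injection W (O.chart p)} {w : W.V}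
    {g : Injection W (O.chart q)} {f' : Injection W' (O.chart p)} {w' : W'.V}
    {g' : Injection W' (O.chart q)} :
    O.arrow f w g = O.arrow f' w' g' ↔
      ∃ (N : UniformizingSystem n X) (c : Injection N W) (c' : Injection N W') (x : N.V),
        c.toFun x = w ∧ c'.toFun x = w' ∧ (∀ y, f.toFun (c.toFun y) = f'.toFun (c'.toFun y)) ∧
          ∀ y, g.toFun (c.toFun y) = g'.toFun (c'.toFun y) := by
  refine (Span.arr_eq_arr_iff hO (D := ⟨W, p, q, f, g⟩) (D' := ⟨W', p, q, f', g'⟩)).trans ?_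
  simp only [Span.Meet, Span.src, Span.tgt, Sigma.mk.injEq, heq_eq_eq, true_and]

/-- Injectivity of `f` makes the two legs of a common restriction equal, and then `g`, `g'` agree on
an open set. Sheets of arrows with different second injections are thus disjoint. -/
theorem eq_of_arrow_eq (hO : O.IsReduced) {f : Injection W (O.chart p)} {w w' : W.V}
    {g g' : Injection W (O.chart q)} (h : O.arrow f w g = O.arrow f w' g') : w = w' ∧ g = g' := by
  obtain ⟨N, c, c', x, rfl, rfl, hs, ht⟩ := (arrow_eq_iff hO).1 h
  have hc : ∀ y, c.toFun y = c'.toFun y := fun y => f.injective (hs y)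
  exact ⟨hc x, Injection.eq_of_comp_eq (hO q) c fun y => by rw [ht y, hc y]⟩

/-- An arrow from a point of `A` to a point of `B` is given by injections into `A` and `B`. -/
theorem exists_arrow_comp_eq (hO : O.IsReduced) (i : Injection A (O.chart p))
    (j : Injection B (O.chart q)) {a : A.V} {b : B.V} {ρ : O.Arrow}
    (hs : source ρ = ⟨p, i.toFun a⟩) (ht : target ρ = ⟨q, j.toFun b⟩) :
    ∃ (N : UniformizingSystem n X) (c : Injection N A) (d : Injection N B) (x : N.V),
      c.toFun x = a ∧ d.toFun x = b ∧ ρ = O.arrow (i.comp c) x (j.comp d) := by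
  obtain ⟨⟨W, p', q', f, g⟩, w, rfl⟩ := exists_arr_eq ρ
  obtain rfl : p' = p := congrArg Sigma.fst hs
  obtain rfl : q' = q := congrArg Sigma.fst ht
  have hs' : f.toFun w = i.toFun a := eq_of_heq (Sigma.mk.inj_iff.1 hs).2
  have ht' : g.toFun w = j.toFun b := eq_of_heq (Sigma.mk.inj_iff.1 ht).2
  obtain ⟨N, c, d, x, rfl, rfl, hcd⟩ := exists_pullback (hO _) f i hs'
  obtain ⟨M, c', d', y, hc', rfl, hcd'⟩ := exists_pullback (hO _) (g.comp c) j ht'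
  refine ⟨M, d.comp c', d', y, congrArg d.toFun hc', rfl, ?_⟩
  change O.arrow f (c.toFun x) g = _
  rw [arrow_eq_iff hO]
  exact ⟨M, c.comp c', Injection.id M, y, congrArg c.toFun hc', rfl,
    fun z => hcd _, fun z => hcd' _⟩

theorem exists_arrow_eq_of_source (hO : O.IsReduced) (i : Injection A (O.chart p)) {a : A.V}
    {ρ : O.Arrow} (hs : source ρ = ⟨p, i.toFun a⟩) :
    ∃ (N : UniformizingSystem n X) (c : Injection N A) (q : X) (d : Injection N (O.chart q))
      (x : N.V), c.toFun x = a ∧ ρ = O.arrow (i.comp c) x d := by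
  obtain ⟨N, c, d, x, hc, -, h⟩ := exists_arrow_comp_eq hO i (Injection.id (O.chart (target ρ).1))
    hs (b := (target ρ).2) rfl
  exact ⟨N, c, _, _, x, hc, h⟩

/-- An arrow from a point of `A` to a point of `B` is given by an injection of `A` into `B`, provided
that there is one. -/
theorem exists_arrow_eq_of_injection (hO : O.IsReduced) (i : Injection A (O.chart p))
    (j : Injection B (O.chart q)) (z : Injection A B) {a : A.V} {b : B.V} {ρ : O.Arrow}
    (hs : source ρ = ⟨p, i.toFun a⟩) (ht : target ρ = ⟨q, j.toFun b⟩) :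
    ∃ g : B.G, ∀ z' : Injection A B, (∀ v, z'.toFun v = g • z.toFun v) →
      ρ = O.arrow i a (j.comp z') := by
  obtain ⟨N, c, d, x, rfl, rfl, rfl⟩ := exists_arrow_comp_eq hO i j hs ht
  have hB : B.ker = ⊥ := j.ker_source (hO _)
  -- The arrow is given by `c` and `d` on a smaller system; `z ∘ c` and `d` are parallel, so `g`
  -- corrects `z`.
  obtain ⟨g, hg⟩ := Injection.exists_smul_eq hB (z.comp c) d
  refine ⟨g, fun z' hz' => ?_⟩
  have : z'.comp c = d := Injection.eq_of_toFun_eq hB fun v => (hz' _).trans (hg v).symm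
  rw [← arrow_comp, ← this]
  rfl

theorem exists_arrow (hO : O.IsReduced) (x y : O.Point) (h : x.proj = y.proj) :
    ∃ ρ : O.Arrow, source ρ = x ∧ target ρ = y := by
  obtain ⟨W, i, j, w, hi, hj⟩ := (O.isChart_chart x.1).linked hO (O.isChart_chart y.1) h
  refine ⟨O.arrow i w j, ?_, ?_⟩
  · rw [source_arrow, hi]
  · rw [target_arrow, hj]

theorem proj_source_eq_proj_target (ρ : O.Arrow) : (source ρ).proj = (target ρ).proj := by
  obtain ⟨D, w, rfl⟩ := exists_arr_eq ρ
  exact (D.fst.proj_comp w).trans (D.snd.proj_comp w).symm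

/-! ### Composition -/

/-- The second arrow can be restricted to a refinement of the system defining the first, so that
both live over one `W`. -/
theorem exists_composable (hO : O.IsReduced) {a b : O.Arrow} (h : target a = source b) :
    ∃ (W : UniformizingSystem n X) (p q r : X) (f : Injection W (O.chart p))
      (g : Injection W (O.chart q)) (k : Injection W (O.chart r)) (w : W.V),
      a = O.arrow f w g ∧ b = O.arrow g w k := by
  obtain ⟨⟨W, p, q, f, g⟩, w, rfl⟩ := exists_arr_eq a
  obtain ⟨N, c, r, d, x, rfl, rfl⟩ := exists_arrow_eq_of_source hO g (a := w) h.symm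
  refine ⟨N, p, q, _, f.comp c, g.comp c, _, x, ?_, rfl⟩
  rw [arrow_comp]
  rfl

/-- Both factors supply common restrictions; pulling these back over `W` gives one restriction on
which all three injections match. Hence the choice in the definition of `mul` is harmless. -/
theorem IsComposite.unique (hO : O.IsReduced) {a b c c' : O.Arrow} :
    O.IsComposite a b c → O.IsComposite a b c' → c = c' := by
  rintro ⟨W, p, q, r, f, g, h, w, rfl, rfl, rfl⟩ ⟨W', p', q', r', f', g', h', w', ha, hb, rfl⟩
  obtain rfl : p = p' := congrArg Sigma.fst (congrArg source ha)
  obtain rfl : q = q' := congrArg Sigma.fst (congrArg target ha)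
  obtain rfl : r = r' := congrArg Sigma.fst (congrArg target hb)
  obtain ⟨N, c, c', x, rfl, rfl, hs, ht⟩ := (arrow_eq_iff hO).1 ha
  obtain ⟨M, d, d', y, hy, hy', hs', ht'⟩ := (arrow_eq_iff hO).1 hb
  obtain ⟨L, e, e', z, rfl, rfl, hee⟩ := exists_pullback (f.ker_source (hO _)) c d hy.symm
  have hee' : ∀ l, c'.toFun (e.toFun l) = d'.toFun (e'.toFun l) := fun l =>
    g'.injective (by rw [← ht, hee, hs'])
  refine (arrow_eq_iff hO).2 ⟨L, c.comp e, c'.comp e, z, rfl, rfl, fun l => hs _, fun l => ?_⟩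
  change h.toFun (c.toFun (e.toFun l)) = h'.toFun (c'.toFun (e.toFun l))
  rw [hee, ht', hee']

theorem mul_arrow (hO : O.IsReduced) (f : Injection W (O.chart p)) (g : Injection W (O.chart q))
    (h : Injection W (O.chart r)) (w : W.V) :
    O.groupoid.mul (O.arrow f w g) (O.arrow g w h) = O.arrow f w h := by
  have hex : ∃ c, O.IsComposite (O.arrow f w g) (O.arrow g w h) c :=
    ⟨_, W, p, q, r, f, g, h, w, rfl, rfl, rfl⟩
  have : O.groupoid.mul (O.arrow f w g) (O.arrow g w h) = hex.choose := dif_pos hex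
  rw [this]
  exact IsComposite.unique hO hex.choose_spec ⟨W, p, q, r, f, g, h, w, rfl, rfl, rfl⟩

theorem arrow_self (f : Injection W (O.chart p)) (w : W.V) :
    O.arrow f w f = O.groupoid.one ⟨p, f.toFun w⟩ :=
  arrow_comp (Injection.id (O.chart p)) (Injection.id (O.chart p)) f w

end Arrows

/-! ### The groupoid is proper and étale -/

section Topology

theorem continuous_source : Continuous (source : O.Arrow → O.Point) :=
  continuous_quot_lift _ (continuous_sigma fun D => D.isOpenEmbedding_src.continuous)

theorem continuous_target : Continuous (target : O.Arrow → O.Point) :=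
  continuous_quot_lift _ (continuous_sigma fun D => D.isOpenEmbedding_tgt.continuous)

theorem continuous_pointProj : Continuous (Point.proj : O.Point → X) :=
  continuous_sigma fun p => (O.chart p).continuous_proj

theorem isLocalHomeomorph_source (hO : O.IsReduced) :
    IsLocalHomeomorph (source : O.Arrow → O.Point) := by
  intro r
  obtain ⟨D, w, rfl⟩ := exists_arr_eq r
  exact IsLocalHomeomorphOn.of_comp_right (g := source) (f := D.arr) (s := Set.univ)
    D.isOpenEmbedding_src.isLocalHomeomorph.isLocalHomeomorphOn
    (D.isOpenEmbedding_arr hO).isLocalHomeomorph.isLocalHomeomorphOn _ ⟨w, trivial, rfl⟩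

theorem isLocalHomeomorph_target (hO : O.IsReduced) :
    IsLocalHomeomorph (target : O.Arrow → O.Point) := by
  intro r
  obtain ⟨D, w, rfl⟩ := exists_arr_eq r
  exact IsLocalHomeomorphOn.of_comp_right (g := target) (f := D.arr) (s := Set.univ)
    D.isOpenEmbedding_tgt.isLocalHomeomorph.isLocalHomeomorphOn
    (D.isOpenEmbedding_arr hO).isLocalHomeomorph.isLocalHomeomorphOn _ ⟨w, trivial, rfl⟩

theorem t2Space_arrow (hO : O.IsReduced) : T2Space O.Arrow := by
  refine ⟨fun r r' hne => ?_⟩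
  by_cases hs : source r = source r'
  · by_cases ht : target r = target r'
    · obtain ⟨⟨W, p, q, f, g⟩, w, rfl⟩ := exists_arr_eq r
      have hW : W.ker = ⊥ := f.ker_source (hO _)
      -- An arrow with the same ends differs from the given one by an element of the group of `W`.
      -- The corresponding sheets over `W` are open, and disjoint if they are not equal.
      obtain ⟨k, hk⟩ := exists_arrow_eq_of_injection hO f g (Injection.id W) (a := w) (b := w)
        (ρ := r') hs.symm ht.symm
      obtain ⟨z, hz⟩ := Injection.exists_smul hW k
      obtain rfl := hk z hz
      refine ⟨Set.range fun w => O.arrow f w g, Set.range fun w => O.arrow f w (g.comp z),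
        (isOpenEmbedding_arrow hO _ _).isOpen_range, (isOpenEmbedding_arrow hO _ _).isOpen_range,
        ⟨w, rfl⟩, ⟨w, rfl⟩, Set.disjoint_left.2 ?_⟩
      rintro _ ⟨x, rfl⟩ ⟨y, hxy⟩
      have : g.comp z = g := (eq_of_arrow_eq hO hxy).2
      exact hne (by rw [this]; rfl)
    · exact separated_by_continuous continuous_target ht
  · exact separated_by_continuous continuous_source hs

theorem isProperMap_source_target [T2Space X] (hO : O.IsReduced) :
    IsProperMap fun r : O.Arrow => (source r, target r) := by
  have hcont : Continuous fun r : O.Arrow => (source r, target r) :=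
    continuous_source.prodMk continuous_target
  rw [isProperMap_iff_ultrafilter_of_t2]
  refine ⟨hcont, fun 𝒰 y hy => ?_⟩
  -- Source and target of an arrow lie over the same point of the Hausdorff space `X`; the limit
  -- does too, so its two components are linked by some `W`.
  have hproj : y.1.proj = y.2.proj := by
    have hc : IsClosed {y : O.Point × O.Point | y.1.proj = y.2.proj} :=
      isClosed_eq (continuous_pointProj.comp continuous_fst)
        (continuous_pointProj.comp continuous_snd)
    exact hc.mem_of_tendsto hy (Filter.Eventually.of_forall proj_source_eq_proj_target)
  obtain ⟨⟨p, a⟩, ⟨q, b⟩⟩ := y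
  obtain ⟨W, i, j, w, rfl, rfl⟩ := (O.isChart_chart p).linked hO (O.isChart_chart q) hproj
  have hW : W.ker = ⊥ := i.ker_source (hO _)
  choose z hz using fun g : W.G => Injection.exists_smul hW g
  have hev : ∀ᶠ r in (𝒰 : Filter O.Arrow), ∃ g : W.G,
      r ∈ Set.range fun x => O.arrow i x (j.comp (z g)) := by
    have h₁ : ∀ᶠ y : O.Point × O.Point in 𝓝 (⟨p, i.toFun w⟩, ⟨q, j.toFun w⟩),
        y.1 ∈ Set.range (Span.src ⟨W, p, q, i, j⟩ : W.V → O.Point) ∧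
          y.2 ∈ Set.range (Span.tgt ⟨W, p, q, i, j⟩ : W.V → O.Point) :=
      prod_mem_nhds ((Span.isOpenEmbedding_src _).isOpen_range.mem_nhds ⟨w, rfl⟩)
        ((Span.isOpenEmbedding_tgt _).isOpen_range.mem_nhds ⟨w, rfl⟩)
    filter_upwards [hy.eventually h₁]
    rintro r ⟨⟨x, hx⟩, ⟨x', hx'⟩⟩
    obtain ⟨g, hg⟩ := exists_arrow_eq_of_injection hO i j (Injection.id W) (a := x) (b := x')
      (ρ := r) hx.symm hx'.symm
    exact ⟨g, x, (hg (z g) (hz g)).symm⟩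
  -- Near the limit all arrows lie in finitely many sheets over `W`, so the ultrafilter concentrates
  -- on one. On that sheet the source is injective, and convergence of sources gives convergence of
  -- arrows.
  obtain ⟨g, hg⟩ : ∃ g : W.G, ∀ᶠ r in (𝒰 : Filter O.Arrow),
      r ∈ Set.range fun x => O.arrow i x (j.comp (z g)) := by
    have : ∀ᶠ r in (𝒰 : Filter O.Arrow),
        r ∈ ⋃ g : W.G, Set.range fun x => O.arrow i x (j.comp (z g)) := by
      simpa using hev
    have hfin := (Ultrafilter.finite_biUnion_mem_iff (f := 𝒰) (is := Set.univ)
      (s := fun g : W.G => Set.range fun x => O.arrow i x (j.comp (z g))) Set.finite_univ).1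
      (by
        rw [Set.biUnion_univ]
        exact this)
    obtain ⟨g, -, hg⟩ := hfin
    exact ⟨g, hg⟩
  refine ⟨O.arrow i w (j.comp (z g)), fun s hs => ?_⟩
  have hs' : (fun x => O.arrow i x (j.comp (z g))) ⁻¹' s ∈ 𝓝 w :=
    (isOpenEmbedding_arrow hO _ _).continuous.continuousAt hs
  have h₂ : ∀ᶠ r in (𝒰 : Filter O.Arrow),
      source r ∈ (Span.src ⟨W, p, q, i, j⟩ : W.V → O.Point) ''
        ((fun x => O.arrow i x (j.comp (z g))) ⁻¹' s) :=
    (continuous_fst.continuousAt.tendsto.comp hy).eventually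
      ((Span.isOpenEmbedding_src ⟨W, p, q, i, j⟩).isOpenMap.image_mem_nhds hs')
  filter_upwards [hg, h₂]
  rintro _ ⟨x, rfl⟩ ⟨x', hx', hxx⟩
  have : x' = x := (Span.src_injective ⟨W, p, q, i, j⟩) hxx
  exact this ▸ hx'

/-- Near a composable pair both factors lie on sheets over one `W`; composability forces equal
parameters, and the product is then a third sheet at the same parameter. -/
theorem continuousOn_mul (hO : O.IsReduced) :
    ContinuousOn (fun x : O.Arrow × O.Arrow => O.groupoid.mul x.1 x.2)
      {x | target x.1 = source x.2} := by
  rintro ⟨a, b⟩ h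
  obtain ⟨W, p, q, r, f, g, k, w, rfl, rfl⟩ := exists_composable hO h
  intro s hs
  dsimp only at hs
  rw [mul_arrow hO] at hs
  have hs' : (fun x => O.arrow f x k) ⁻¹' s ∈ 𝓝 w :=
    (isOpenEmbedding_arrow hO _ _).continuous.continuousAt hs
  have hn : ((fun x => O.arrow f x g) '' ((fun x => O.arrow f x k) ⁻¹' s)) ×ˢ
      (Set.range fun x => O.arrow g x k) ∈ 𝓝 (O.arrow f w g, O.arrow g w k) :=
    prod_mem_nhds ((isOpenEmbedding_arrow hO _ _).isOpenMap.image_mem_nhds hs')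
      ((isOpenEmbedding_arrow hO _ _).isOpen_range.mem_nhds ⟨w, rfl⟩)
  refine Filter.mem_map.2 ?_
  filter_upwards [mem_nhdsWithin_of_mem_nhds hn, self_mem_nhdsWithin]
  rintro ⟨_, _⟩ ⟨⟨x, hx, rfl⟩, ⟨y, rfl⟩⟩ hxy
  obtain rfl : x = y := g.injective (eq_of_heq (Sigma.mk.inj_iff.1 hxy).2)
  change O.groupoid.mul (O.arrow f x g) (O.arrow g x k) ∈ s
  rw [mul_arrow hO]
  exact hx

theorem isLocalDiffeomorph_src (D : O.Span) :
    IsLocalDiffeomorph (𝓡 n) (𝓡 n) ∞ D.src := fun w =>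
  (D.fst.isLocalDiffeomorph w).comp (𝓡 n) O.Point
    (isLocalDiffeomorph_sigmaMk (n := n) (fun p : X => (O.chart p).V) D.p _)

theorem isLocalDiffeomorph_tgt (D : O.Span) :
    IsLocalDiffeomorph (𝓡 n) (𝓡 n) ∞ D.tgt := fun w =>
  (D.snd.isLocalDiffeomorph w).comp (𝓡 n) O.Point
    (isLocalDiffeomorph_sigmaMk (n := n) (fun p : X => (O.chart p).V) D.q _)

/-- A continuous section of the source stays on one sheet locally, where its target is `D.tgt` after
a local inverse of `D.src`. -/
theorem contMDiffOn_target (hO : O.IsReduced) :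
    ∀ (s : Set O.Point) (σ : O.Point → O.Arrow), IsOpen s → ContinuousOn σ s →
    (∀ x ∈ s, source (σ x) = x) → ContMDiffOn (𝓡 n) (𝓡 n) ∞ (fun x => target (σ x)) s := by
  intro s σ hs hσ hsec x hx
  obtain ⟨D, w, hw⟩ := exists_arr_eq (σ x)
  have hwx : D.src w = x := by rw [← hsec x hx, ← hw]; rfl
  subst hwx
  have hd := isLocalDiffeomorph_src D w
  set l := hd.localInverse
  have hlw : l (D.src w) = w := hd.localInverse_left_inv hd.localInverse_mem_target
  have hsmooth : ContMDiffAt (𝓡 n) (𝓡 n) ∞ (fun x => D.tgt (l x)) (D.src w) :=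
    ContMDiffAt.comp (g := D.tgt) (D.src w) ((isLocalDiffeomorph_tgt D).contMDiff.contMDiffAt)
      hd.localInverse_contMDiffAt
  refine (hsmooth.congr_of_eventuallyEq ?_).contMDiffWithinAt
  have hmem : D.arr '' l.target ∈ 𝓝 (σ (D.src w)) := by
    rw [← hw]
    exact (D.isOpenEmbedding_arr hO).isOpenMap.image_mem_nhds
      (l.open_target.mem_nhds hd.localInverse_mem_target)
  filter_upwards [hs.mem_nhds hx, (hσ.continuousAt (hs.mem_nhds hx)).eventually hmem]
  rintro y hy ⟨v, hv, hvy⟩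
  have hvy' : D.src v = y := by rw [← hsec y hy, ← hvy]; rfl
  rw [← hvy, ← hvy', show l (D.src v) = v from hd.localInverse_left_inv hv]
  rfl

theorem isProperEtale_groupoid [T2Space X] (hO : O.IsReduced) : O.groupoid.IsProperEtale where
  isManifold := isManifold_sigma (n := n) fun p : X => (O.chart p).V
  t2_obj := (inferInstance : T2Space O.Point)
  paracompact_obj := paracompactSpace_sigma fun p : X => (O.chart p).V
  t2_arr := t2Space_arrow hO
  src_one := fun _ => rfl
  tgt_one := fun _ => rfl
  src_mul := fun a b h => by
    obtain ⟨W, p, q, r, f, g, k, w, rfl, rfl⟩ := exists_composable hO h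
    rw [mul_arrow hO]
    rfl
  tgt_mul := fun a b h => by
    obtain ⟨W, p, q, r, f, g, k, w, rfl, rfl⟩ := exists_composable hO h
    rw [mul_arrow hO]
    rfl
  mul_assoc := fun a b c hab hbc => by
    obtain ⟨W, p, q, r, f, g, k, w, rfl, rfl⟩ := exists_composable hO hab
    obtain ⟨N, e, r', d, x, rfl, rfl⟩ := exists_arrow_eq_of_source hO k (a := w) (ρ := c) hbc.symm
    rw [← arrow_comp f g, ← arrow_comp g k, mul_arrow hO, mul_arrow hO, mul_arrow hO, mul_arrow hO]
  one_mul := fun a => by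
    obtain ⟨⟨W, p, q, f, g⟩, w, rfl⟩ := exists_arr_eq a
    change O.groupoid.mul (O.groupoid.one ⟨p, f.toFun w⟩) (O.arrow f w g) = O.arrow f w g
    rw [← arrow_self, mul_arrow hO]
  mul_one := fun a => by
    obtain ⟨⟨W, p, q, f, g⟩, w, rfl⟩ := exists_arr_eq a
    change O.groupoid.mul (O.arrow f w g) (O.groupoid.one ⟨q, g.toFun w⟩) = O.arrow f w g
    rw [← arrow_self, mul_arrow hO]
  inv_inv := fun a => by
    obtain ⟨D, w, rfl⟩ := exists_arr_eq a
    rfl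
  src_inv := fun a => by
    obtain ⟨D, w, rfl⟩ := exists_arr_eq a
    rfl
  tgt_inv := fun a => by
    obtain ⟨D, w, rfl⟩ := exists_arr_eq a
    rfl
  mul_inv := fun a => by
    obtain ⟨⟨W, p, q, f, g⟩, w, rfl⟩ := exists_arr_eq a
    change O.groupoid.mul (O.arrow f w g) (O.arrow g w f) = O.groupoid.one ⟨p, f.toFun w⟩
    rw [← arrow_self, mul_arrow hO]
  inv_mul := fun a => by
    obtain ⟨⟨W, p, q, f, g⟩, w, rfl⟩ := exists_arr_eq a
    change O.groupoid.mul (O.arrow g w f) (O.arrow f w g) = O.groupoid.one ⟨q, g.toFun w⟩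
    rw [← arrow_self, mul_arrow hO]
  continuous_one := continuous_sigma fun p =>
    Span.continuous_arr ⟨O.chart p, p, p, Injection.id _, Injection.id _⟩
  continuous_inv := continuous_quot_lift _ (continuous_sigma fun D =>
    Span.continuous_arr ⟨D.W, D.q, D.p, D.snd, D.fst⟩)
  continuousOn_mul := continuousOn_mul hO
  isLocalHomeomorph_src := isLocalHomeomorph_source hO
  isLocalHomeomorph_tgt := isLocalHomeomorph_target hO
  contMDiffOn_tgt := contMDiffOn_target hO
  isProperMap := isProperMap_source_target hO

end Topology

end OrbifoldStructure

end

section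

/-! ### Bases of decorated open sets -/

section DecoratedBases

/-- A finite-to-one family of decorated open sets in which inclusions are decorated. -/
structure IsDecorated {X D : Type*} [TopologicalSpace X] (U : D → Set X) (le : D → D → Prop)
    (𝒟 : Set D) : Prop where
  locallyFinite : ∀ x, ∃ t ∈ 𝓝 x, {d ∈ 𝒟 | (U d ∩ t).Nonempty}.Finite
  injOn : Set.InjOn U 𝒟
  le_of_subset : ∀ d ∈ 𝒟, ∀ d' ∈ 𝒟, U d ⊆ U d' → le d d'

variable {X D : Type*} [MetricSpace X] [LocallyCompactSpace X] [SigmaCompactSpace X]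
  {U : D → Set X} {le : D → D → Prop}

/-- One stage of the construction, adding small sets to `𝒟`. Each point gets small candidates lying
under all old members that contain it; a locally finite subcover is thinned to its maximal sets, and
those containing an old member are dropped. An old set is then never inside a new one, a new set
inside an old one is decorated by choice of the candidate, and nested new sets are equal by
maximality. -/
theorem IsDecorated.exists_extension (hU : ∀ d, IsOpen (U d)) (hne : ∀ d, (U d).Nonempty)
    (hrefl : ∀ d, le d d)
    (H : ∀ (p : X) (S : Set D), S.Finite → (∀ s ∈ S, p ∈ U s) → ∀ N ∈ 𝓝 p,
      ∃ d, p ∈ U d ∧ U d ⊆ N ∧ ∀ s ∈ S, le d s)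
    {𝒟 : Set D} (h𝒟 : IsDecorated U le 𝒟) {ε : ℝ} (hε : 0 < ε) :
    ∃ 𝒟', IsDecorated U le 𝒟' ∧ 𝒟 ⊆ 𝒟' ∧ ∀ p, ∃ d ∈ 𝒟', p ∈ U d ∧ U d ⊆ Metric.ball p ε := by
  classical
  -- The radius is halved because a set near its centre must later lie in the `ε`-ball of any of its
  -- points. The last clause allows an old subset only if it is the singleton of the centre, which
  -- cannot be avoided at isolated points.
  let good : X → D → Prop := fun p d => p ∈ U d ∧ U d ⊆ Metric.ball p (ε / 2) ∧
    (∀ s ∈ 𝒟, p ∈ U s → le d s ∧ U d ⊆ U s) ∧ ∀ s ∈ 𝒟, U s ⊆ U d → U s = {p}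
  have hbasis : ∀ p, (𝓝 p).HasBasis (good p) U := by
    refine fun p => ⟨fun N => ⟨fun hN => ?_, fun ⟨d, hd, hdN⟩ =>
      Filter.mem_of_superset ((hU d).mem_nhds hd.1) hdN⟩⟩
    obtain ⟨t, ht, hfin⟩ := h𝒟.locallyFinite p
    have hS : {s ∈ 𝒟 | p ∈ U s}.Finite :=
      hfin.subset fun s hs => ⟨hs.1, p, hs.2, mem_of_mem_nhds ht⟩
    -- In every old set other than `{p}` a point different from `p` is marked. A neighbourhood of
    -- `p` omitting the finitely many relevant marked points contains no such old set.
    have hx : ∀ s, ∃ x, U s ≠ {p} → x ∈ U s ∧ x ≠ p := by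
      intro s
      by_cases hs : U s = {p}
      · exact ⟨p, fun h => absurd hs h⟩
      · by_contra! hcon
        refine hs (Set.eq_singleton_iff_nonempty_unique_mem.2 ⟨hne s, fun x hx => ?_⟩)
        by_contra hxp
        exact hxp ((hcon x).2 hx)
    choose x hx using hx
    have h₁ : (⋂ s ∈ {s ∈ 𝒟 | p ∈ U s}, U s) ∈ 𝓝 p :=
      (Filter.biInter_mem hS).2 fun s hs => (hU s).mem_nhds hs.2
    have h₂ : (⋂ s ∈ {d ∈ 𝒟 | (U d ∩ t).Nonempty}, {y | U s ≠ {p} → y ≠ x s}) ∈ 𝓝 p := by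
      refine (Filter.biInter_mem hfin).2 fun s _ => ?_
      by_cases hs : U s = {p}
      · simp [hs]
      · filter_upwards [isOpen_ne.mem_nhds (hx s hs).2.symm] with y hy _ using hy
    obtain ⟨d, hpd, hdN, hle⟩ := H p _ hS (fun s hs => hs.2) _
      (Filter.inter_mem (Filter.inter_mem hN (Metric.ball_mem_nhds p (half_pos hε)))
        (Filter.inter_mem ht (Filter.inter_mem h₁ h₂)))
    refine ⟨d, ⟨hpd, fun y hy => (hdN hy).1.2, fun s hs hps => ⟨hle s ⟨hs, hps⟩, fun y hy =>
      Set.mem_iInter₂.1 (hdN hy).2.2.1 s ⟨hs, hps⟩⟩, fun s hs hsd => ?_⟩, fun y hy => (hdN hy).1.1⟩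
    by_contra hsp
    obtain ⟨y, hy⟩ := hne s
    have hxd := hsd (hx s hsp).1
    exact Set.mem_iInter₂.1 (hdN hxd).2.2.2 s ⟨hs, y, hy, (hdN (hsd hy)).2.1⟩ hsp rfl
  obtain ⟨α, c, r, hgood, hcov, hlf⟩ :=
    refinement_of_locallyCompact_sigmaCompact_of_nhds_basis (ι := fun _ => D) (B := fun _ => U) hbasis
  have hcov' : ∀ p, ∃ a, p ∈ U (r a) := fun p => Set.mem_iUnion.1 (hcov ▸ Set.mem_univ p)
  let ℳ : Set (Set X) := {V | Maximal (· ∈ Set.range fun a => U (r a)) V}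
  have hrep : ∀ V : ℳ, ∃ a, U (r a) = V := fun V => V.2.prop
  choose rep hrep using hrep
  let ℰ : Set D := {d | ∃ V : ℳ, d = r (rep V) ∧ ∀ s ∈ 𝒟, ¬ U s ⊆ U d}
  -- Local finiteness leaves finitely many sets through a given point, so each is contained in a
  -- maximal one.
  have hmax : ∀ a, ∃ V : ℳ, U (r a) ⊆ V := by
    intro a
    obtain ⟨y, hy⟩ := hne (r a)
    have hfin : {V ∈ Set.range fun a => U (r a) | y ∈ V}.Finite := by
      refine ((hlf.point_finite y).image fun a => U (r a)).subset ?_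
      rintro _ ⟨⟨b, rfl⟩, hb⟩
      exact ⟨b, hb, rfl⟩
    obtain ⟨V, hV, hVmax⟩ := hfin.exists_le_maximal (a := U (r a)) ⟨⟨a, rfl⟩, hy⟩
    exact ⟨⟨V, hVmax.prop.1, fun V' hV' hVV' => hVmax.le_of_ge ⟨hV', hVV' hVmax.prop.2⟩ hVV'⟩, hV⟩
  have hle : ∀ d ∈ 𝒟 ∪ ℰ, ∀ d' ∈ 𝒟 ∪ ℰ, U d ⊆ U d' → le d d' ∧ (U d' ⊆ U d → d = d') := by
    rintro d (hd | ⟨V, rfl, hV⟩) d' (hd' | ⟨V', rfl, hV'⟩) hdd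
    · exact ⟨h𝒟.le_of_subset d hd d' hd' hdd, fun h => h𝒟.injOn hd hd' (hdd.antisymm h)⟩
    · exact absurd hdd (hV' d hd)
    · exact ⟨((hgood _).2.2.1 d' hd' (hdd (hgood _).1)).1, fun h => absurd h (hV d' hd')⟩
    · have : V = V' := by
        rw [hrep, hrep] at hdd
        exact Subtype.ext (V.2.eq_of_le V'.2.prop hdd)
      subst this
      exact ⟨hrefl _, fun _ => rfl⟩
  refine ⟨𝒟 ∪ ℰ, ⟨fun x => ?_, fun d hd d' hd' h => (hle d hd d' hd' h.subset).2 h.symm.subset,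
    fun d hd d' hd' h => (hle d hd d' hd' h).1⟩, Set.subset_union_left, fun p => ?_⟩
  · obtain ⟨t, ht, hfin⟩ := h𝒟.locallyFinite x
    obtain ⟨t', ht', hfin'⟩ := hlf x
    refine ⟨t ∩ t', Filter.inter_mem ht ht', (hfin.union (hfin'.image r)).subset ?_⟩
    rintro d ⟨hd | ⟨V, rfl, -⟩, y, hy, hyt, hyt'⟩
    · exact Or.inl ⟨hd, y, hy, hyt⟩
    · exact Or.inr ⟨_, ⟨y, hy, hyt'⟩, rfl⟩
  · obtain ⟨a, ha⟩ := hcov' p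
    obtain ⟨V, hV⟩ := hmax a
    have hp : p ∈ U (r (rep V)) := by rw [hrep]; exact hV ha
    have hg := hgood (rep V)
    have hball : U (r (rep V)) ⊆ Metric.ball p ε := fun y hy => by
      have h₁ := hg.2.1 hp
      have h₂ := hg.2.1 hy
      rw [Metric.mem_ball] at *
      have := dist_triangle_right y p (c (rep V))
      linarith
    -- If the maximal set was dropped, it contains an old singleton at its centre. Being a good
    -- candidate it also lies inside that old set, which therefore covers `p` in its place.
    by_cases hs : ∃ s ∈ 𝒟, U s ⊆ U (r (rep V))
    · obtain ⟨s, hs, hsV⟩ := hs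
      have hsc := hg.2.2.2 s hs hsV
      have := (hg.2.2.1 s hs (hsc ▸ rfl)).2
      exact ⟨s, Or.inl hs, this hp, hsV.trans hball⟩
    · push Not at hs
      exact ⟨_, Or.inr ⟨V, rfl, hs⟩, hp, hball⟩

end DecoratedBases

/-- If every finite family of decorated neighbourhoods of a point has a small common refinement, then
there is a basis of the topology by decorated open sets such that all inclusions between its members
are decorated. -/
theorem exists_decorated_basis {X : Type*} [TopologicalSpace X] [T2Space X]
    [SecondCountableTopology X] [LocallyCompactSpace X] {D : Type*} {U : D → Set X}
    {le : D → D → Prop}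
    (hU : ∀ d, IsOpen (U d)) (hne : ∀ d, (U d).Nonempty) (hrefl : ∀ d, le d d)
    (H : ∀ (p : X) (S : Set D), S.Finite → (∀ s ∈ S, p ∈ U s) → ∀ N ∈ 𝓝 p,
      ∃ d, p ∈ U d ∧ U d ⊆ N ∧ ∀ s ∈ S, le d s) :
    ∃ 𝒟 : Set D, Set.InjOn U 𝒟 ∧ (∀ p, ∀ N ∈ 𝓝 p, ∃ d ∈ 𝒟, p ∈ U d ∧ U d ⊆ N) ∧
      ∀ d ∈ 𝒟, ∀ d' ∈ 𝒟, U d ⊆ U d' → le d d' := by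
  let _ : MetricSpace X := TopologicalSpace.metrizableSpaceMetric X
  have hstep : ∀ (k : ℕ) (𝒟 : {𝒟 : Set D // IsDecorated U le 𝒟}),
      ∃ 𝒟' : {𝒟 : Set D // IsDecorated U le 𝒟}, 𝒟.1 ⊆ 𝒟'.1 ∧
        ∀ p, ∃ d ∈ 𝒟'.1, p ∈ U d ∧ U d ⊆ Metric.ball p (1 / ((k : ℝ) + 1)) := by
    intro k 𝒟
    obtain ⟨𝒟', h, h'⟩ := 𝒟.2.exists_extension hU hne hrefl H (Nat.one_div_pos_of_nat (n := k))
    exact ⟨⟨𝒟', h⟩, h'⟩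
  choose step hsub hsmall using hstep
  -- Stages at scales `1 / (k + 1)`, starting from the empty family. They increase, so any two
  -- members of the union already lie in one stage, where the required properties hold.
  let seq : ℕ → {𝒟 : Set D // IsDecorated U le 𝒟} := fun k => Nat.rec
    ⟨∅, fun x => ⟨Set.univ, Filter.univ_mem, by simp⟩, by simp, by simp⟩ step k
  have hmono : Monotone fun k => (seq k).1 := monotone_nat_of_le_succ fun k => hsub k (seq k)
  have hcommon : ∀ d ∈ ⋃ k, (seq k).1, ∀ d' ∈ ⋃ k, (seq k).1, ∃ k, d ∈ (seq k).1 ∧ d' ∈ (seq k).1 := by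
    intro d hd d' hd'
    obtain ⟨k, hk⟩ := Set.mem_iUnion.1 hd
    obtain ⟨k', hk'⟩ := Set.mem_iUnion.1 hd'
    exact ⟨max k k', hmono (le_max_left _ _) hk, hmono (le_max_right _ _) hk'⟩
  refine ⟨⋃ k, (seq k).1, fun d hd d' hd' h => ?_, fun p N hN => ?_, fun d hd d' hd' h => ?_⟩
  · obtain ⟨k, hk, hk'⟩ := hcommon d hd d' hd'
    exact (seq k).2.injOn hk hk' h
  · obtain ⟨ε, hε, hεN⟩ := Metric.mem_nhds_iff.1 hN
    obtain ⟨k, hk⟩ := exists_nat_one_div_lt hε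
    obtain ⟨d, hd, hp, hb⟩ := hsmall k (seq k) p
    exact ⟨d, Set.mem_iUnion.2 ⟨k + 1, hd⟩, hp,
      (hb.trans (Metric.ball_subset_ball hk.le)).trans hεN⟩
  · obtain ⟨k, hk, hk'⟩ := hcommon d hd d' hd'
    exact (seq k).2.le_of_subset d hk d' hk' h

theorem OrbifoldStructure.locallyCompactSpace {n : ℕ} {X : Type u} [TopologicalSpace X] [T2Space X]
    (O : OrbifoldStructure n X) : LocallyCompactSpace X := by
  have : WeaklyLocallyCompactSpace X := ⟨fun p => by
    obtain ⟨v, hv⟩ := O.mem_chart p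
    obtain ⟨K, hK, hvK⟩ := exists_compact_mem_nhds v
    have := UniformizingSystem.isOpenMap_proj.image_mem_nhds hvK
    rw [hv] at this
    exact ⟨_, hK.image (O.chart p).continuous_proj, this⟩⟩
  infer_instance

end

section

open UniformizingSystem OrbifoldStructure

variable {n m : ℕ} {X Y : Type u} [TopologicalSpace X] [TopologicalSpace Y]

/-! ### Germs of liftings -/

/-- The group condition survives restriction: the element `g'` for the larger chart moves a point of
the image of `j` into that image, so it comes from the group of `Z`. -/
theorem Lifting.exists_restrict {f : X → Y} {A W : UniformizingSystem n X}
    {B Z : UniformizingSystem m Y} (hB : B.ker = ⊥) (L : Lifting f A B) (i : Injection W A)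
    (j : Injection Z B) (h : ∀ w, L.toFun (i.toFun w) ∈ Set.range j.toFun) :
    ∃ L' : Lifting f W Z, ∀ w, j.toFun (L'.toFun w) = L.toFun (i.toFun w) := by
  choose l hl using h
  have hl' : (fun w => j.toFun (l w)) = fun w => L.toFun (i.toFun w) := funext hl
  have hsm : ContMDiff (𝓡 n) (𝓡 m) ∞ fun w => L.toFun (i.toFun w) :=
    L.contMDiff.comp i.isLocalDiffeomorph.contMDiff
  have hc : Continuous l := j.isOpenEmbedding.isInducing.continuous_iff.2
    (show Continuous fun w => j.toFun (l w) from hl' ▸ hsm.continuous)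
  refine ⟨⟨l, fun w => IsLocalDiffeomorph.contMDiffAt_of_comp (j.isLocalDiffeomorph _)
    (hl' ▸ hsm.contMDiffAt) hc.continuousAt, fun w => ?_, fun g => ?_⟩, hl⟩
  · rw [← j.proj_comp, hl, L.proj_comp, i.proj_comp]
  · obtain ⟨g', hg'⟩ := L.exists_smul (i.hom g)
    have key : ∀ w, g' • j.toFun (l w) = j.toFun (l (g • w)) := fun w => by
      rw [hl, hl, i.equivariant, hg']
    obtain ⟨w₀⟩ := (inferInstance : Nonempty W.V)
    obtain ⟨k, rfl⟩ := exists_hom_eq hB j (key w₀)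
    exact ⟨k, fun w => j.injective (by rw [← key, j.equivariant])⟩

section Germs

variable {f f' f'' : X → Y} {A A' A'' : UniformizingSystem n X} {B B' B'' : UniformizingSystem m Y}
  {L : Lifting f A B} {L' : Lifting f' A' B'} {L'' : Lifting f'' A'' B''} {p : X}

theorem SameGerm.symm : SameGerm p L L' → SameGerm p L' L := by
  rintro ⟨W, i, i', Z, j, j', h, hp, h₁, h₂⟩
  exact ⟨W, i', i, Z, j', j, h, hp, h₂, h₁⟩

theorem SameGerm.apply_eq : SameGerm p L L' → f p = f' p := by
  rintro ⟨W, i, i', Z, j, j', h, ⟨w, rfl⟩, h₁, h₂⟩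
  rw [← i.proj_comp, ← L.proj_comp, h₁, j.proj_comp, ← j'.proj_comp, ← h₂, L'.proj_comp,
    i'.proj_comp, i.proj_comp]

theorem SameGerm.trans (hA : A'.ker = ⊥) (hB : B'.ker = ⊥) :
    SameGerm p L L' → SameGerm p L' L'' → SameGerm p L L'' := by
  rintro ⟨W₁, i₁, i₁', Z₁, j₁, j₁', h₁, ⟨w₁, rfl⟩, e₁, e₁'⟩
    ⟨W₂, i₂, i₂', Z₂, j₂, j₂', h₂, ⟨w₂, hw⟩, e₂, e₂'⟩
  -- The two descriptions of the germ of `L'` may use different points over `p`. They are aligned by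
  -- `g` on the domain and by an associated `g'` on the codomain, and then pulled back.
  obtain ⟨g, hg⟩ := proj_eq_iff.1 (show A'.proj (i₂.toFun w₂) = A'.proj (i₁'.toFun w₁) by
    rw [i₂.proj_comp, i₁'.proj_comp, hw])
  obtain ⟨g', hg'⟩ := L'.exists_smul g
  obtain ⟨k, hk⟩ := i₂.exists_smul_comp hA g
  obtain ⟨l, hl⟩ := j₂.exists_smul_comp hB g'
  obtain ⟨Z, d₁, d₂, z, hd₁, hd₂, hd⟩ := exists_pullback hB j₁' l (a := h₁ w₁) (b := h₂ w₂)
    (by rw [hl, ← e₂, ← hg', ← hg, e₁'])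
  obtain ⟨W, c₁, c₂, w, hc₁, hc₂, hc⟩ := exists_pullback hA i₁' k (a := w₁) (b := w₂)
    (by rw [hk, hg])
  have hW : W.ker = ⊥ := (i₁'.comp c₁).ker_source hA
  have hcont : Continuous fun x => L'.toFun (i₁'.toFun (c₁.toFun x)) :=
    L'.contMDiff.continuous.comp (i₁'.continuous.comp c₁.continuous)
  have hmem : (fun x => L'.toFun (i₁'.toFun (c₁.toFun x))) ⁻¹' Set.range (j₁'.comp d₁).toFun ∈ 𝓝 w :=
    hcont.continuousAt ((j₁'.comp d₁).isOpenEmbedding.isOpen_range.mem_nhds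
      ⟨z, by rw [hc₁, e₁']; exact congrArg j₁'.toFun hd₁⟩)
  obtain ⟨V, e, v, hev, her⟩ := exists_injection_range_subset hW hmem
  choose h hh using fun x => her ⟨x, rfl⟩
  refine ⟨V, i₁.comp (c₁.comp e), i₂'.comp (c₂.comp e), Z, j₁.comp d₁, j₂'.comp d₂, h, ⟨v, ?_⟩,
    fun x => ?_, fun x => ?_⟩
  · rw [← e.proj_comp, hev, ← c₁.proj_comp, hc₁]
  · change L.toFun (i₁.toFun (c₁.toFun (e.toFun x))) = j₁.toFun (d₁.toFun (h x))
    rw [e₁]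
    refine congrArg j₁.toFun (j₁'.injective ?_)
    rw [← e₁']
    exact (hh x).symm
  · change L''.toFun (i₂'.toFun (c₂.toFun (e.toFun x))) = j₂'.toFun (d₂.toFun (h x))
    rw [e₂']
    refine congrArg j₂'.toFun (l.injective ?_)
    rw [hl, ← e₂, ← hg', ← hk, ← hc, ← hd]
    exact (hh x).symm

/-- A continuous family of arrows between the values of two liftings shows that they have the same
germ. -/
theorem sameGerm_of_arrow {P : OrbifoldStructure m Y} (hP : P.IsReduced) (hA : A.ker = ⊥) {q q' : Y}
    (j : Injection B (P.chart q)) (j' : Injection B' (P.chart q')) {N : UniformizingSystem n X}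
    (c : Injection N A) (c' : Injection N A') (x : N.V) {ζ : N.V → P.Arrow} (hζ : Continuous ζ)
    (hs : ∀ y, source (ζ y) = ⟨q, j.toFun (L.toFun (c.toFun y))⟩)
    (ht : ∀ y, target (ζ y) = ⟨q', j'.toFun (L'.toFun (c'.toFun y))⟩) :
    SameGerm (N.proj x) L L' := by
  obtain ⟨S, d, d', s, hd, hd', hζx⟩ := exists_arrow_comp_eq hP j j' (hs x) (ht x)
  -- By continuity the arrows stay on one sheet near `x`. Its parameter is the common lifting `h`,
  -- whose two legs are read off from source and target.
  have hmem : ζ ⁻¹' (Set.range fun s => P.arrow (j.comp d) s (j'.comp d')) ∈ 𝓝 x :=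
    hζ.continuousAt ((isOpenEmbedding_arrow hP _ _).isOpen_range.mem_nhds ⟨s, hζx.symm⟩)
  obtain ⟨V, e, v, hev, her⟩ := exists_injection_range_subset (c.ker_source hA) hmem
  choose h hh using fun y => her ⟨y, rfl⟩
  refine ⟨V, c.comp e, c'.comp e, S, d, d', h, ⟨v, by rw [← hev, e.proj_comp]⟩, fun y => ?_,
    fun y => ?_⟩
  · have := hs (e.toFun y)
    rw [← hh y] at this
    exact j.injective (eq_of_heq (Sigma.mk.inj_iff.1 this).2).symm
  · have := ht (e.toFun y)
    rw [← hh y] at this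
    exact j'.injective (eq_of_heq (Sigma.mk.inj_iff.1 this).2).symm

end Germs

/-- Finitely many charts around a point have a common refinement. -/
theorem OrbifoldStructure.exists_finite_refinement {O : OrbifoldStructure n X} (hO : O.IsReduced)
    {A : UniformizingSystem n X} (hA : O.IsChart A) (a : A.V) {ι : Type*}
    (B : ι → UniformizingSystem n X) (hB : ∀ s, O.IsChart (B s)) {S : Set ι} (hS : S.Finite)
    (hmem : ∀ s ∈ S, A.proj a ∈ (B s).U) :
    ∃ (W : UniformizingSystem n X) (i : Injection W A) (w : W.V), i.toFun w = a ∧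
      ∀ s ∈ S, Nonempty (Injection W (B s)) := by
  induction S, hS using Set.Finite.induction_on with
  | empty => exact ⟨A, Injection.id A, a, rfl, by simp⟩
  | @insert s S _ _ ih =>
    obtain ⟨W, i, w, hw, hWS⟩ := ih fun s hs => hmem s (Set.mem_insert_of_mem _ hs)
    obtain ⟨b, hb⟩ := hmem s (Set.mem_insert _ _)
    obtain ⟨V, c, d, v, hc, -⟩ := (hA.of_injection hO i).linked hO (hB s) (a := w) (b := b)
      (by rw [hb, ← hw, i.proj_comp])
    refine ⟨V, i.comp c, v, (congrArg i.toFun hc).trans hw, ?_⟩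
    rintro t (rfl | ht)
    · exact ⟨d⟩
    · obtain ⟨k⟩ := hWS t ht
      exact ⟨k.comp c⟩

/-! ### Generalized morphisms between the groupoids of two orbifolds -/

/-- A morphism to the groupoid of `P` from the groupoid obtained by pulling back the groupoid of `O`
to a space étale over its space of objects. -/
structure Bridge (O : OrbifoldStructure n X) (P : OrbifoldStructure m Y) where
  T : Type w
  [topT : TopologicalSpace T]
  base : T → O.Point
  val : T → P.Point
  act : T → O.Arrow → T → P.Arrow
  source_act : ∀ {x r y}, source r = base x → target r = base y → source (act x r y) = val x
  target_act : ∀ {x r y}, source r = base x → target r = base y → target (act x r y) = val y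
  act_mul : ∀ {x r y r' z}, source r = base x → target r = base y → source r' = base y →
    target r' = base z → act x (O.groupoid.mul r r') z = P.groupoid.mul (act x r y) (act y r' z)
  continuousOn_act : ContinuousOn (fun t : T × O.Arrow × T => act t.1 t.2.1 t.2.2)
    {t | source t.2.1 = base t.1 ∧ target t.2.1 = base t.2.2}
  exists_section : ∀ x, ∃ (N : Set O.Point) (τ : O.Point → T), IsOpen N ∧ base x ∈ N ∧
    ContinuousOn τ N ∧ τ (base x) = x ∧ (∀ y ∈ N, base (τ y) = y) ∧
    ContMDiffOn (𝓡 n) (𝓡 m) ∞ (fun y => val (τ y)) N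
  exists_proj_eq : ∀ p, ∃ x, (base x).proj = p

attribute [instance] Bridge.topT

/-! ### From a generalized morphism to a good map -/

namespace Bridge

variable {O : OrbifoldStructure n X} {P : OrbifoldStructure m Y} (Γ : Bridge.{u, w} O P)

/-- The map of spaces underlying a generalized morphism. -/
def map (p : X) : Y := (Γ.val (Γ.exists_proj_eq p).choose).proj

/-- Two points of `T` over the same point of `X` are joined by an arrow of `O`; the action turns it
into an arrow between their values. -/
theorem map_proj (hO : O.IsReduced) (x : Γ.T) : Γ.map (Γ.base x).proj = (Γ.val x).proj := by
  obtain ⟨r, hs, ht⟩ := exists_arrow hO _ _ (Γ.exists_proj_eq (Γ.base x).proj).choose_spec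
  rw [map, ← Γ.source_act hs ht, proj_source_eq_proj_target, Γ.target_act hs ht]

/-- A local lifting of the map underlying a generalized morphism. -/
structure LocalLift where
  p : X
  W : UniformizingSystem n X
  i : Injection W (O.chart p)
  q : Y
  Z : UniformizingSystem m Y
  j : Injection Z (P.chart q)
  τ : W.V → Γ.T
  toFun : W.V → Z.V
  continuous_τ : Continuous τ
  base_τ : ∀ w, Γ.base (τ w) = ⟨p, i.toFun w⟩
  val_τ : ∀ w, Γ.val (τ w) = ⟨q, j.toFun (toFun w)⟩
  contMDiff_toFun : ContMDiff (𝓡 n) (𝓡 m) ∞ toFun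

namespace LocalLift

variable {Γ} (d d' : Γ.LocalLift)

theorem isChart_W (hO : O.IsReduced) : O.IsChart d.W := (O.isChart_chart d.p).of_injection hO d.i

theorem isChart_Z (hP : P.IsReduced) : P.IsChart d.Z := (P.isChart_chart d.q).of_injection hP d.j

theorem proj_base_τ (w : d.W.V) : (Γ.base (d.τ w)).proj = d.W.proj w := by
  rw [d.base_τ]
  exact d.i.proj_comp w

theorem proj_toFun (hO : O.IsReduced) (w : d.W.V) :
    d.Z.proj (d.toFun w) = Γ.map (d.W.proj w) := by
  rw [← d.proj_base_τ, Γ.map_proj hO, d.val_τ]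
  exact (d.j.proj_comp _).symm

variable {d' d}

/-- The arrows between the values of two local liftings over a common refinement. -/
def family {N : UniformizingSystem n X} (c : Injection N d.W) (c' : Injection N d'.W) (y : N.V) :
    P.Arrow :=
  Γ.act (d.τ (c.toFun y)) (O.arrow (d.i.comp c) y (d'.i.comp c')) (d'.τ (c'.toFun y))

section Family

variable {N : UniformizingSystem n X} (c : Injection N d.W) (c' : Injection N d'.W)

theorem source_family (y : N.V) :
    source (family c c' y) = ⟨d.q, d.j.toFun (d.toFun (c.toFun y))⟩ := by
  rw [family, Γ.source_act, d.val_τ]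
  · rw [d.base_τ]; rfl
  · rw [d'.base_τ]; rfl

theorem target_family (y : N.V) :
    target (family c c' y) = ⟨d'.q, d'.j.toFun (d'.toFun (c'.toFun y))⟩ := by
  rw [family, Γ.target_act, d'.val_τ]
  · rw [d.base_τ]; rfl
  · rw [d'.base_τ]; rfl

theorem continuous_family (hO : O.IsReduced) : Continuous (family c c') := by
  refine Γ.continuousOn_act.comp_continuous (f := fun y => (d.τ (c.toFun y),
    O.arrow (d.i.comp c) y (d'.i.comp c'), d'.τ (c'.toFun y))) ?_ fun y => ⟨?_, ?_⟩
  · exact (d.continuous_τ.comp c.continuous).prodMk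
      ((isOpenEmbedding_arrow hO _ _).continuous.prodMk (d'.continuous_τ.comp c'.continuous))
  · exact (d.base_τ _).symm
  · exact (d'.base_τ _).symm

end Family

theorem sameGerm (hO : O.IsReduced) (hP : P.IsReduced) {f f' : X → Y} {L : Lifting f d.W d.Z}
    {L' : Lifting f' d'.W d'.Z} (hL : ∀ w, L.toFun w = d.toFun w)
    (hL' : ∀ w, L'.toFun w = d'.toFun w) {p : X} (hp : p ∈ d.W.U) (hp' : p ∈ d'.W.U) :
    SameGerm p L L' := by
  obtain ⟨w, rfl⟩ := hp
  obtain ⟨w', hw'⟩ := hp'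
  obtain ⟨N, c, c', y, hc, -⟩ := (d.isChart_W hO).linked hO (d'.isChart_W hO) hw'.symm
  rw [← hc, c.proj_comp]
  exact sameGerm_of_arrow hP ((d.isChart_W hO).ker_eq_bot hO) d.j d'.j c c' y
    (continuous_family c c' hO) (fun y => by rw [source_family, hL])
    fun y => by rw [target_family, hL']

/-- The injection of targets induced by an injection of the domains of two local liftings. -/
theorem exists_transfer (hO : O.IsReduced) (hP : P.IsReduced) (c : Injection d.W d'.W)
    (z : Injection d.Z d'.Z) :
    ∃ z' : Injection d.Z d'.Z, (∃ g : d'.Z.G, ∀ v, z'.toFun v = g • z.toFun v) ∧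
      ∀ w, family (Injection.id d.W) c w = P.arrow d.j (d.toFun w) (d'.j.comp z') := by
  have hZ : d'.Z.ker = ⊥ := d'.j.ker_source (hP _)
  choose zg hzg using fun g : d'.Z.G => z.exists_smul_comp hZ g
  have hex : ∀ w, ∃ g : d'.Z.G,
      family (Injection.id d.W) c w = P.arrow d.j (d.toFun w) (d'.j.comp (zg g)) := fun w => by
    obtain ⟨g, hg⟩ := exists_arrow_eq_of_injection hP d.j d'.j z
      (source_family (Injection.id d.W) c w) (target_family (Injection.id d.W) c w)
    exact ⟨g, hg _ (hzg g)⟩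
  choose γ hγ using hex
  -- Arrows on the sheet of a fixed injection form an open set, so `γ` is locally constant; the
  -- domain is connected, and one injection `zg (γ w₀)` works throughout.
  have hloc : IsLocallyConstant γ := by
    rw [IsLocallyConstant.iff_eventually_eq]
    intro w
    have hmem := (continuous_family (Injection.id d.W) c hO).continuousAt
      ((isOpenEmbedding_arrow hP d.j (d'.j.comp (zg (γ w)))).isOpen_range.mem_nhds
        ⟨d.toFun w, (hγ w).symm⟩)
    filter_upwards [hmem] with w' hw'
    obtain ⟨v, hv⟩ := hw'
    have h₁ := (eq_of_arrow_eq hP (hv.trans (hγ w'))).2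
    obtain ⟨v₀⟩ := (inferInstance : Nonempty d.Z.V)
    have h₂ : zg (γ w) = zg (γ w') := Injection.eq_of_toFun_eq hZ fun v =>
      d'.j.injective (congrArg (fun k : Injection d.Z (P.chart d'.q) => k.toFun v) h₁)
    refine eq_of_eventually hZ (x := z.toFun v₀) ?_
    rw [← z.isOpenEmbedding.map_nhds_eq, Filter.eventually_map]
    exact Filter.Eventually.of_forall fun v => by rw [← hzg, ← hzg, h₂]
  obtain ⟨w₀⟩ := (inferInstance : Nonempty d.W.V)
  exact ⟨zg (γ w₀), ⟨γ w₀, hzg _⟩, fun w => by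
    rw [hγ w, hloc.apply_eq_of_preconnectedSpace w w₀]⟩

/-- One arrow determines the transferred injection, so identities between transfers need checking at
a single point only. -/
theorem transfer_unique (hP : P.IsReduced) {w : d.W.V} {z z' : Injection d.Z d'.Z}
    (h : P.arrow d.j (d.toFun w) (d'.j.comp z) = P.arrow d.j (d.toFun w) (d'.j.comp z')) :
    z = z' := by
  have h₁ := (eq_of_arrow_eq hP h).2
  exact Injection.eq_of_toFun_eq (d'.j.ker_source (hP _)) fun v =>
    d'.j.injective (congrArg (fun k : Injection d.Z (P.chart d'.q) => k.toFun v) h₁)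

theorem toFun_eq_of_family_eq {c : Injection d.W d'.W} {z : Injection d.Z d'.Z} {w : d.W.V}
    (h : family (Injection.id d.W) c w = P.arrow d.j (d.toFun w) (d'.j.comp z)) :
    d'.toFun (c.toFun w) = z.toFun (d.toFun w) := by
  have := congrArg target h
  rw [target_family] at this
  exact d'.j.injective (eq_of_heq (Sigma.mk.inj_iff.1 this).2)

theorem family_comp {d'' : Γ.LocalLift} (hO : O.IsReduced) (c : Injection d.W d'.W)
    (c' : Injection d'.W d''.W)
    (w : d.W.V) : family (Injection.id d.W) (c'.comp c) w =
      P.groupoid.mul (family (Injection.id d.W) c w)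
        (family (Injection.id d'.W) c' (c.toFun w)) := by
  have h₁ : O.arrow (d.i.comp (Injection.id d.W)) w (d''.i.comp (c'.comp c)) = O.groupoid.mul
      (O.arrow (d.i.comp (Injection.id d.W)) w (d'.i.comp c))
      (O.arrow (d'.i.comp (Injection.id d'.W)) (c.toFun w) (d''.i.comp c')) := by
    rw [← arrow_comp (d'.i.comp (Injection.id d'.W)) (d''.i.comp c') c]
    exact (mul_arrow hO _ _ _ _).symm
  have h₂ := Γ.act_mul (x := d.τ w) (y := d'.τ (c.toFun w)) (z := d''.τ (c'.toFun (c.toFun w)))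
    (r := O.arrow (d.i.comp (Injection.id d.W)) w (d'.i.comp c))
    (r' := O.arrow (d'.i.comp (Injection.id d'.W)) (c.toFun w) (d''.i.comp c'))
    (d.base_τ _).symm (d'.base_τ _).symm (d'.base_τ _).symm (d''.base_τ _).symm
  rw [← h₁] at h₂
  exact h₂

variable (d)

/-- The lifting given by a local lifting. -/
def lifting (hO : O.IsReduced) (hP : P.IsReduced) : Lifting Γ.map d.W d.Z where
  toFun := d.toFun
  contMDiff := d.contMDiff_toFun
  proj_comp := d.proj_toFun hO
  exists_smul := fun g => by
    -- The group element is itself an injection of the domain; its transfer is an injection of the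
    -- target differing from the identity by the element sought.
    obtain ⟨c, hc⟩ := Injection.exists_smul ((d.isChart_W hO).ker_eq_bot hO) g
    obtain ⟨z, ⟨g', hg'⟩, hz⟩ := exists_transfer hO hP c (Injection.id d.Z)
    exact ⟨g', fun v => by rw [← hc, toFun_eq_of_family_eq (hz v), hg']; rfl⟩

end LocalLift

/-- Sections of `T` yield arbitrarily small local liftings whose domain and target both refine those
of a prescribed finite family. This is the hypothesis of `exists_decorated_basis`. -/
theorem exists_localLift (hO : O.IsReduced) (hP : P.IsReduced) (x : Γ.T) {S : Set Γ.LocalLift}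
    (hS : S.Finite) (hxS : ∀ s ∈ S, (Γ.base x).proj ∈ s.W.U) {N : Set X}
    (hN : N ∈ 𝓝 (Γ.base x).proj) :
    ∃ (d : Γ.LocalLift) (w : d.W.V), d.τ w = x ∧ d.W.U ⊆ N ∧
      ∀ s ∈ S, Nonempty (Injection d.W s.W) ∧ Nonempty (Injection d.Z s.Z) := by
  obtain ⟨M, τ, hM, hxM, hτ, hτx, hβ, hsm⟩ := Γ.exists_section x
  obtain ⟨W, i, w, hw, hWS⟩ := exists_finite_refinement hO (O.isChart_chart (Γ.base x).1)
    (Γ.base x).2 (fun s : Γ.LocalLift => s.W) (fun s => s.isChart_W hO) hS hxS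
  obtain ⟨Z, j, z, hz, hZS⟩ := exists_finite_refinement hP (P.isChart_chart (Γ.val x).1)
    (Γ.val x).2 (fun s : Γ.LocalLift => s.Z) (fun s => s.isChart_Z hP) hS fun s hs => by
      obtain ⟨v, hv⟩ := hxS s hs
      refine ⟨s.toFun v, ?_⟩
      rw [s.proj_toFun hO, hv, Γ.map_proj hO]
      rfl
  have hiw : (⟨(Γ.base x).1, i.toFun w⟩ : O.Point) = Γ.base x := by rw [hw]
  set I : W.V → O.Point := fun v => ⟨(Γ.base x).1, i.toFun v⟩ with hI
  set J : Span P := ⟨Z, (Γ.val x).1, (Γ.val x).1, j, j⟩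
  have hIc : Continuous I := continuous_sigmaMk.comp i.continuous
  have hIsm : ContMDiff (𝓡 n) (𝓡 n) ∞ I :=
    (isLocalDiffeomorph_src ⟨W, (Γ.base x).1, (Γ.base x).1, i, i⟩).contMDiff
  have hIw : I w = Γ.base x := hiw
  have h₁ : I ⁻¹' M ∈ 𝓝 w := hIc.continuousAt (by rw [hIw]; exact hM.mem_nhds hxM)
  have h₂ : W.proj ⁻¹' N ∈ 𝓝 w := W.continuous_proj.continuousAt (by
    rw [← i.proj_comp, hw]
    exact hN)
  have hvc : ContinuousAt (fun v => Γ.val (τ (I v))) w := by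
    refine ContinuousAt.comp (g := fun y => Γ.val (τ y)) ?_ hIc.continuousAt
    rw [hIw]
    exact hsm.continuousOn.continuousAt (hM.mem_nhds hxM)
  have h₃ : (fun v => Γ.val (τ (I v))) ⁻¹' Set.range J.src ∈ 𝓝 w := by
    refine hvc (J.isOpenEmbedding_src.isOpen_range.mem_nhds ⟨z, ?_⟩)
    change (⟨(Γ.val x).1, j.toFun z⟩ : P.Point) = _
    rw [hz]
    dsimp only
    rw [hIw, hτx]
  -- The domain is shrunk so that the section is defined on it, it lies over `N`, and the values
  -- fall into the chosen target chart `Z`.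
  obtain ⟨W', e, w', hw', her⟩ := exists_injection_range_subset
    (i.ker_source (hO _)) (Filter.inter_mem h₁ (Filter.inter_mem h₂ h₃))
  have hsub : ∀ v, e.toFun v ∈ I ⁻¹' M ∩ (W.proj ⁻¹' N ∩
    (fun v => Γ.val (τ (I v))) ⁻¹' Set.range J.src) := fun v => her ⟨v, rfl⟩
  choose l hl using fun v => (hsub v).2.2
  have hl' : (fun v => J.src (l v)) = fun v => Γ.val (τ (I (e.toFun v))) := funext hl
  have hsmooth : ContMDiff (𝓡 n) (𝓡 m) ∞ fun v => J.src (l v) := by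
    rw [hl']
    intro v
    have h₄ : ContMDiffAt (𝓡 n) (𝓡 m) ∞ (fun y => Γ.val (τ y)) (I (e.toFun v)) :=
      hsm.contMDiffAt (hM.mem_nhds (hsub v).1)
    exact ContMDiffAt.comp (g := fun y => Γ.val (τ y)) (f := fun v => I (e.toFun v)) v h₄
      (hIsm.comp e.isLocalDiffeomorph.contMDiff).contMDiffAt
  have hlc : Continuous l :=
    J.isOpenEmbedding_src.isInducing.continuous_iff.2 hsmooth.continuous
  refine ⟨⟨(Γ.base x).1, W', i.comp e, (Γ.val x).1, Z, j, fun v => τ (I (e.toFun v)), l,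
    hτ.comp_continuous (hIc.comp e.continuous) fun v => (hsub v).1, fun v => hβ _ (hsub v).1,
    fun v => (hl v).symm, fun v => IsLocalDiffeomorph.contMDiffAt_of_comp
      (isLocalDiffeomorph_src J _) hsmooth.contMDiffAt hlc.continuousAt⟩, w', ?_, ?_, ?_⟩
  · change τ (I (e.toFun w')) = x
    rw [hw', hIw, hτx]
  · rintro _ ⟨v, rfl⟩
    change W'.proj v ∈ N
    rw [← e.proj_comp]
    exact (hsub v).2.1
  · intro s hs
    obtain ⟨k⟩ := hWS s hs
    exact ⟨⟨k.comp e⟩, hZS s hs⟩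

theorem exists_localLift_mem (hO : O.IsReduced) (hP : P.IsReduced) (p : X) :
    ∃ d : Γ.LocalLift, p ∈ d.W.U := by
  obtain ⟨x, rfl⟩ := Γ.exists_proj_eq p
  obtain ⟨d, w, hw, -⟩ := Γ.exists_localLift hO hP x Set.finite_empty (by simp) Filter.univ_mem
  exact ⟨d, w, by rw [← hw, d.proj_base_τ]⟩

theorem continuous_map (hO : O.IsReduced) (hP : P.IsReduced) : Continuous Γ.map := by
  rw [continuous_iff_continuousAt]
  intro p
  obtain ⟨d, w, rfl⟩ := Γ.exists_localLift_mem hO hP p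
  have h : Continuous fun w => Γ.map (d.W.proj w) := by
    simp only [← d.proj_toFun hO]
    exact d.Z.continuous_proj.comp d.contMDiff_toFun.continuous
  intro s hs
  have := isOpenMap_proj.image_mem_nhds (h.continuousAt (x := w) hs)
  refine Filter.mem_map.2 (Filter.mem_of_superset this ?_)
  rintro _ ⟨v, hv, rfl⟩
  exact hv

/-- The smooth map of orbifolds given by a generalized morphism. -/
def orbifoldMap (hO : O.IsReduced) (hP : P.IsReduced) : OrbifoldMap O P where
  toFun := Γ.map
  continuous_toFun := Γ.continuous_map hO hP
  dom := fun p => (Γ.exists_localLift_mem hO hP p).choose.W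
  cod := fun p => (Γ.exists_localLift_mem hO hP p).choose.Z
  isChart_dom := fun _ => LocalLift.isChart_W _ hO
  isChart_cod := fun _ => LocalLift.isChart_Z _ hP
  mem_dom := fun p => (Γ.exists_localLift_mem hO hP p).choose_spec
  lift := fun _ => LocalLift.lifting _ hO hP
  sameGerm := fun _ q hq => LocalLift.sameGerm hO hP (fun _ => rfl) (fun _ => rfl)
    (Γ.exists_localLift_mem hO hP q).choose_spec hq

theorem sameGerm_orbifoldMap (hO : O.IsReduced) (hP : P.IsReduced) {d : Γ.LocalLift} {f : X → Y}
    {L : Lifting f d.W d.Z} (hL : ∀ w, L.toFun w = d.toFun w) {p : X} (hp : p ∈ d.W.U) :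
    SameGerm p L ((Γ.orbifoldMap hO hP).lift p) :=
  LocalLift.sameGerm hO hP hL (fun _ => rfl) hp (Γ.exists_localLift_mem hO hP p).choose_spec

/-- The decoration consists of injections of domains and of targets. The latter are only a starting
point: correcting them by `exists_transfer` gives the functorial `ν`. -/
theorem isGood_orbifoldMap [T2Space X] [SecondCountableTopology X] (hO : O.IsReduced)
    (hP : P.IsReduced) : (Γ.orbifoldMap hO hP).IsGood := by
  have := O.locallyCompactSpace
  obtain ⟨𝒟, hinj, hbasis, hle⟩ := exists_decorated_basis (X := X)
    (U := fun d : Γ.LocalLift => d.W.U)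
    (le := fun d d' => Nonempty (Injection d.W d'.W) ∧ Nonempty (Injection d.Z d'.Z))
    (fun d => isOpen_U) (fun d => Set.range_nonempty _)
    (fun d => ⟨⟨Injection.id _⟩, ⟨Injection.id _⟩⟩) (by
      intro p S hS hpS N hN
      obtain ⟨x, rfl⟩ := Γ.exists_proj_eq p
      obtain ⟨d, w, hw, hdN, hdS⟩ := Γ.exists_localLift hO hP x hS hpS hN
      exact ⟨d, ⟨w, by rw [← hw, d.proj_base_τ]⟩, hdN, hdS⟩)
  -- Indexing by the open sets keeps the index type in `Type u`, since local liftings form a larger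
  -- type, and makes the cover injective in its index.
  let ι : Type u := {V : Set X // ∃ d ∈ 𝒟, d.W.U = V}
  choose δ hδ hδU using fun V : ι => V.2
  have hδle : ∀ V V' : ι, (δ V).W.U ⊆ (δ V').W.U →
      Nonempty (Injection (δ V).W (δ V').W) ∧ Nonempty (Injection (δ V).Z (δ V').Z) :=
    fun V V' h => hle _ (hδ V) _ (hδ V') h
  have hex : ∀ {V V' : ι} (c : Injection (δ V).W (δ V').W),
      ∃ z : Injection (δ V).Z (δ V').Z, ∀ w, LocalLift.family (Injection.id (δ V).W) c w =
        P.arrow (δ V).j ((δ V).toFun w) ((δ V').j.comp z) := fun {V V'} c => by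
    obtain ⟨z⟩ := (hδle V V' c.U_subset).2
    obtain ⟨z', -, hz'⟩ := LocalLift.exists_transfer hO hP c z
    exact ⟨z', hz'⟩
  choose ν hν using @hex
  refine ⟨⟨⟨ι, fun V => (δ V).W, fun V => (δ V).isChart_W hO, ?_, ?_, fun V V' h => (hδle V V' h).1,
    ?_⟩, fun V => (δ V).Z, fun V => (δ V).isChart_Z hP, ?_, fun V => (δ V).lifting hO hP, ν,
    fun c v => LocalLift.toFun_eq_of_family_eq (hν c v), ?_, fun V p hp =>
      Γ.sameGerm_orbifoldMap hO hP (fun _ => rfl) hp⟩⟩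
  · intro V V' h
    have : (δ V).W.U = (δ V').W.U := h
    rw [hδU, hδU] at this
    exact Subtype.ext this
  · intro p
    obtain ⟨d, hd, hp, -⟩ := hbasis p Set.univ Filter.univ_mem
    exact ⟨⟨d.W.U, d, hd, rfl⟩, by rw [hδU]; exact hp⟩
  · intro V V' p hp
    obtain ⟨d, hd, hpd, hdN⟩ := hbasis p _ ((isOpen_U.inter isOpen_U).mem_nhds hp)
    exact ⟨⟨d.W.U, d, hd, rfl⟩, by rw [hδU]; exact hpd, by rw [hδU]; exact hdN⟩
  · intro V V' h
    obtain ⟨z⟩ := (hδle V V' h).2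
    exact z.U_subset
  · intro V V' V'' b a
    obtain ⟨w⟩ := (inferInstance : Nonempty (δ V).W.V)
    -- Both candidates are read off from the arrow of the composite, which is the product of the two
    -- arrows by functoriality of the action.
    refine LocalLift.transfer_unique hP (w := w) ?_
    rw [← hν (b.comp a), LocalLift.family_comp hO, hν a, hν b,
      LocalLift.toFun_eq_of_family_eq (hν a w),
      ← arrow_comp (δ V').j ((δ V'').j.comp (ν b)) (ν a), mul_arrow hP]
    rfl

end Bridge

end

section

open UniformizingSystem OrbifoldStructure

/-! ### Morita morphisms -/

namespace GroupoidData

variable {n m : ℕ}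

namespace IsProperEtale

variable {A : GroupoidData.{u, v} n}

theorem continuous_src (hA : A.IsProperEtale) : Continuous A.src := hA.isLocalHomeomorph_src.continuous

theorem continuous_tgt (hA : A.IsProperEtale) : Continuous A.tgt := hA.isLocalHomeomorph_tgt.continuous

theorem isMorita_id (hA : A.IsProperEtale) : (Hom.id A).IsMorita where
  etale := (Diffeomorph.refl (𝓡 n) A.Obj ∞).isLocalDiffeomorph
  surjective := fun y => ⟨⟨(y, A.one y), (hA.tgt_one y).symm⟩, hA.src_one y⟩
  isFiberProduct := by
    refine (Homeomorph.mk (Equiv.mk _ (fun x => x.1.2) (fun r => rfl) ?_) ?_ ?_).isHomeomorph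
    · rintro ⟨⟨⟨x, y⟩, r⟩, h⟩
      exact Subtype.ext (Prod.ext h.symm rfl)
    · exact ((hA.continuous_src.prodMk hA.continuous_tgt).prodMk continuous_id).subtype_mk _
    · exact continuous_snd.comp continuous_subtype_val

/-- The inner `ρ₂` and its inverse cancel. This gives multiplicativity of the arrows between Morita
triples. -/
theorem conj_mul_conj (hA : A.IsProperEtale) {ρ₁ ρ₂ ρ₃ s s' : A.Arr}
    (h₁ : A.src ρ₁ = A.src s) (h₂ : A.tgt s = A.src ρ₂)
    (h₃ : A.src ρ₂ = A.src s') (h₄ : A.tgt s' = A.src ρ₃) :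
    A.mul (A.inv ρ₁) (A.mul (A.mul s s') ρ₃) =
      A.mul (A.mul (A.inv ρ₁) (A.mul s ρ₂)) (A.mul (A.inv ρ₂) (A.mul s' ρ₃)) := by
  have e₁ : A.src (A.mul s' ρ₃) = A.src s' := hA.src_mul _ _ h₄
  have e₂ : A.src (A.mul (A.inv ρ₂) (A.mul s' ρ₃)) = A.tgt ρ₂ := by
    rw [hA.src_mul, hA.src_inv]
    rw [hA.tgt_inv, e₁, h₃]
  have e₃ : A.mul ρ₂ (A.mul (A.inv ρ₂) (A.mul s' ρ₃)) = A.mul s' ρ₃ := by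
    rw [← hA.mul_assoc _ _ _ (hA.src_inv ρ₂).symm (by rw [hA.tgt_inv, e₁, h₃]), hA.mul_inv, h₃, ← e₁,
      hA.one_mul]
  rw [hA.mul_assoc (A.inv ρ₁) (A.mul s ρ₂) _ (by rw [hA.tgt_inv, hA.src_mul _ _ h₂, h₁])
    (by rw [hA.tgt_mul _ _ h₂, e₂]), hA.mul_assoc s ρ₂ _ h₂ e₂.symm, e₃,
    hA.mul_assoc s s' ρ₃ (h₂.trans h₃) h₄]

theorem src_conj (hA : A.IsProperEtale) {ρ₁ ρ₂ s : A.Arr}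
    (h₁ : A.src ρ₁ = A.src s) (h₂ : A.tgt s = A.src ρ₂) :
    A.src (A.mul (A.inv ρ₁) (A.mul s ρ₂)) = A.tgt ρ₁ := by
  rw [hA.src_mul, hA.src_inv]
  rw [hA.tgt_inv, hA.src_mul _ _ h₂, h₁]

theorem tgt_conj (hA : A.IsProperEtale) {ρ₁ ρ₂ s : A.Arr}
    (h₁ : A.src ρ₁ = A.src s) (h₂ : A.tgt s = A.src ρ₂) :
    A.tgt (A.mul (A.inv ρ₁) (A.mul s ρ₂)) = A.tgt ρ₂ := by
  rw [hA.tgt_mul, hA.tgt_mul _ _ h₂]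
  rw [hA.tgt_inv, hA.src_mul _ _ h₂, h₁]

end IsProperEtale

namespace Hom

variable {A B : GroupoidData.{u, v} n} {φ : Hom A B}

open Classical in
/-- The arrow `x → y` over a given arrow, for a Morita morphism. -/
def liftArr (φ : Hom A B) (x y : A.Obj) (r : B.Arr) : A.Arr :=
  if h : ∃ κ, A.src κ = x ∧ A.tgt κ = y ∧ φ.arr κ = r then h.choose else A.one x

section

variable {x y : A.Obj} {r : B.Arr}

theorem liftArr_spec (hφ : φ.IsMorita) (hs : B.src r = φ.obj x) (ht : B.tgt r = φ.obj y) :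
    A.src (φ.liftArr x y r) = x ∧ A.tgt (φ.liftArr x y r) = y ∧ φ.arr (φ.liftArr x y r) = r := by
  have hex : ∃ κ, A.src κ = x ∧ A.tgt κ = y ∧ φ.arr κ = r := by
    obtain ⟨κ, hκ⟩ := hφ.isFiberProduct.bijective.2 ⟨((x, y), r), by rw [hs, ht]⟩
    have := congrArg Subtype.val hκ
    simp only [Prod.mk.injEq] at this
    exact ⟨κ, this.1.1, this.1.2, this.2⟩
  rw [liftArr, dif_pos hex]
  exact hex.choose_spec

theorem eq_liftArr (hφ : φ.IsMorita) {κ : A.Arr} (hs : A.src κ = x) (ht : A.tgt κ = y)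
    (hr : φ.arr κ = r) : κ = φ.liftArr x y r := by
  obtain ⟨h₁, h₂, h₃⟩ := liftArr_spec (x := x) (y := y) (r := r) hφ (by rw [← hr, φ.src_arr, hs])
    (by rw [← hr, φ.tgt_arr, ht])
  refine hφ.isFiberProduct.bijective.1 (Subtype.ext ?_)
  simp only [hs, ht, hr, h₁, h₂, h₃]

end

/-- On compatible data it is the inverse of the fibre product homeomorphism. -/
theorem continuousOn_liftArr (hφ : φ.IsMorita) :
    ContinuousOn (fun t : (A.Obj × A.Obj) × B.Arr => φ.liftArr t.1.1 t.1.2 t.2)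
      {t | B.src t.2 = φ.obj t.1.1 ∧ B.tgt t.2 = φ.obj t.1.2} := by
  rw [continuousOn_iff_continuous_domRestrict]
  have hc : Continuous fun t : {t : (A.Obj × A.Obj) × B.Arr |
      B.src t.2 = φ.obj t.1.1 ∧ B.tgt t.2 = φ.obj t.1.2} =>
      (hφ.isFiberProduct.homeomorph _).symm ⟨t.1, by rw [t.2.1, t.2.2]⟩ :=
    (Homeomorph.continuous _).comp (continuous_subtype_val.subtype_mk _)
  refine hc.congr fun t => ?_
  rw [Homeomorph.symm_apply_eq]
  obtain ⟨h₁, h₂, h₃⟩ := liftArr_spec hφ t.2.1 t.2.2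
  refine Subtype.ext ?_
  change t.1 = ((A.src (φ.liftArr _ _ _), A.tgt (φ.liftArr _ _ _)), φ.arr (φ.liftArr _ _ _))
  rw [h₁, h₂, h₃]

theorem liftArr_mul (hφ : φ.IsMorita) (hA : A.IsProperEtale) {x y z : A.Obj} {r r' : B.Arr}
    (h₁ : B.src r = φ.obj x) (h₂ : B.tgt r = φ.obj y) (h₃ : B.src r' = φ.obj y)
    (h₄ : B.tgt r' = φ.obj z) :
    φ.liftArr x z (B.mul r r') = A.mul (φ.liftArr x y r) (φ.liftArr y z r') := by
  obtain ⟨e₁, e₂, e₃⟩ := liftArr_spec hφ h₁ h₂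
  obtain ⟨e₁', e₂', e₃'⟩ := liftArr_spec hφ h₃ h₄
  have h : A.tgt (φ.liftArr x y r) = A.src (φ.liftArr y z r') := by rw [e₂, e₁']
  refine (eq_liftArr hφ ?_ ?_ ?_).symm
  · rw [hA.src_mul _ _ h, e₁]
  · rw [hA.tgt_mul _ _ h, e₂']
  · rw [φ.arr_mul _ _ h, e₃, e₃']

end Hom

end GroupoidData

/-! ### The generalized morphism given by a morphism between Morita equivalent groupoids -/

section Morita

variable {n m : ℕ} {X Y : Type u} [TopologicalSpace X] [TopologicalSpace Y]
  {O : OrbifoldStructure n X} {P : OrbifoldStructure m Y}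
  {H : GroupoidData.{u, u + 1} n} {H' : GroupoidData.{u, u + 1} m}
  (E : H.MoritaEquivalence O.groupoid) (E' : H'.MoritaEquivalence P.groupoid) (F : H.Hom H')

open GroupoidData

/-- Triples of an object of the groupoid between `H` and `O.groupoid`, an object of the groupoid
between `H'` and `P.groupoid`, and an arrow of `H'` between their images. -/
def MoritaTriple : Type (u + 1) :=
  {t : E.mid.Obj × E'.mid.Obj × H'.Arr //
    H'.src t.2.2 = F.obj (E.left.obj t.1) ∧ H'.tgt t.2.2 = E'.left.obj t.2.1}

namespace MoritaTriple

instance : TopologicalSpace (MoritaTriple E E' F) := inferInstanceAs (TopologicalSpace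
  {t : E.mid.Obj × E'.mid.Obj × H'.Arr //
    H'.src t.2.2 = F.obj (E.left.obj t.1) ∧ H'.tgt t.2.2 = E'.left.obj t.2.1})

variable {E E' F}

/-- The arrow of `H'` between the images in `E'.mid` of two triples. -/
def conj (x : MoritaTriple E E' F) (r : O.Arrow) (y : MoritaTriple E E' F) : H'.Arr :=
  H'.mul (H'.inv x.1.2.2)
    (H'.mul (F.arr (E.left.arr (E.right.liftArr x.1.1 y.1.1 r))) y.1.2.2)

/-- The arrow of `P.groupoid` between the values of two triples. -/
def act (x : MoritaTriple E E' F) (r : O.Arrow) (y : MoritaTriple E E' F) : P.Arrow :=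
  E'.right.arr (E'.left.liftArr x.1.2.1 y.1.2.1 (conj x r y))

section

variable {x y z : MoritaTriple E E' F} {r r' : O.Arrow}

theorem src_middle (hs : source r = E.right.obj x.1.1) (ht : target r = E.right.obj y.1.1) :
    H'.src x.1.2.2 = H'.src (F.arr (E.left.arr (E.right.liftArr x.1.1 y.1.1 r))) := by
  obtain ⟨h₁, h₂, h₃⟩ := Hom.liftArr_spec E.isMorita_right hs ht
  rw [x.2.1, F.src_arr, E.left.src_arr, h₁]

theorem tgt_middle (hs : source r = E.right.obj x.1.1) (ht : target r = E.right.obj y.1.1) :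
    H'.tgt (F.arr (E.left.arr (E.right.liftArr x.1.1 y.1.1 r))) = H'.src y.1.2.2 := by
  obtain ⟨h₁, h₂, h₃⟩ := Hom.liftArr_spec E.isMorita_right hs ht
  rw [y.2.1, F.tgt_arr, E.left.tgt_arr, h₂]

theorem src_conj (hH' : H'.IsProperEtale)
    (hs : source r = E.right.obj x.1.1) (ht : target r = E.right.obj y.1.1) :
    H'.src (conj x r y) = E'.left.obj x.1.2.1 :=
  (hH'.src_conj (src_middle hs ht) (tgt_middle hs ht)).trans x.2.2

theorem tgt_conj (hH' : H'.IsProperEtale)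
    (hs : source r = E.right.obj x.1.1) (ht : target r = E.right.obj y.1.1) :
    H'.tgt (conj x r y) = E'.left.obj y.1.2.1 :=
  (hH'.tgt_conj (src_middle hs ht) (tgt_middle hs ht)).trans y.2.2

theorem source_act (hH' : H'.IsProperEtale)
    (hs : source r = E.right.obj x.1.1) (ht : target r = E.right.obj y.1.1) :
    source (act x r y) = E'.right.obj x.1.2.1 := by
  obtain ⟨h₁, -, -⟩ := Hom.liftArr_spec E'.isMorita_left (src_conj hH' hs ht) (tgt_conj hH' hs ht)
  exact (E'.right.src_arr _).trans (congrArg _ h₁)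

theorem target_act (hH' : H'.IsProperEtale)
    (hs : source r = E.right.obj x.1.1) (ht : target r = E.right.obj y.1.1) :
    target (act x r y) = E'.right.obj y.1.2.1 := by
  obtain ⟨-, h₂, -⟩ := Hom.liftArr_spec E'.isMorita_left (src_conj hH' hs ht) (tgt_conj hH' hs ht)
  exact (E'.right.tgt_arr _).trans (congrArg _ h₂)

theorem conj_mul (hH' : H'.IsProperEtale)
    (h₁ : source r = E.right.obj x.1.1) (h₂ : target r = E.right.obj y.1.1)
    (h₃ : source r' = E.right.obj y.1.1) (h₄ : target r' = E.right.obj z.1.1) :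
    conj x (O.groupoid.mul r r') z = H'.mul (conj x r y) (conj y r' z) := by
  obtain ⟨-, e₂, -⟩ := Hom.liftArr_spec E.isMorita_right h₁ h₂
  obtain ⟨e₁', -, -⟩ := Hom.liftArr_spec E.isMorita_right h₃ h₄
  have h : E.mid.tgt (E.right.liftArr x.1.1 y.1.1 r) =
      E.mid.src (E.right.liftArr y.1.1 z.1.1 r') := by rw [e₂, e₁']
  have hl : F.arr (E.left.arr (E.right.liftArr x.1.1 z.1.1 (O.groupoid.mul r r'))) =
      H'.mul (F.arr (E.left.arr (E.right.liftArr x.1.1 y.1.1 r)))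
        (F.arr (E.left.arr (E.right.liftArr y.1.1 z.1.1 r'))) := by
    rw [← F.arr_mul _ _ (by rw [E.left.src_arr, E.left.tgt_arr, h]), ← E.left.arr_mul _ _ h,
      ← Hom.liftArr_mul E.isMorita_right E.isProperEtale h₁ h₂ h₃ h₄]
  exact (congrArg (fun s => H'.mul (H'.inv x.1.2.2) (H'.mul s z.1.2.2)) hl).trans
    (hH'.conj_mul_conj (src_middle h₁ h₂) (tgt_middle h₁ h₂) (src_middle h₃ h₄)
      (tgt_middle h₃ h₄))

theorem act_mul (hH' : H'.IsProperEtale)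
    (h₁ : source r = E.right.obj x.1.1) (h₂ : target r = E.right.obj y.1.1)
    (h₃ : source r' = E.right.obj y.1.1) (h₄ : target r' = E.right.obj z.1.1) :
    act x (O.groupoid.mul r r') z = P.groupoid.mul (act x r y) (act y r' z) := by
  obtain ⟨-, e₂, -⟩ := Hom.liftArr_spec E'.isMorita_left (src_conj hH' h₁ h₂) (tgt_conj hH' h₁ h₂)
  obtain ⟨e₁', -, -⟩ := Hom.liftArr_spec E'.isMorita_left (src_conj hH' h₃ h₄) (tgt_conj hH' h₃ h₄)
  refine (congrArg (fun s => E'.right.arr (E'.left.liftArr x.1.2.1 z.1.2.1 s))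
    (conj_mul hH' h₁ h₂ h₃ h₄)).trans ?_
  refine (congrArg E'.right.arr (Hom.liftArr_mul E'.isMorita_left E'.isProperEtale
    (src_conj hH' h₁ h₂) (tgt_conj hH' h₁ h₂) (src_conj hH' h₃ h₄) (tgt_conj hH' h₃ h₄))).trans ?_
  exact E'.right.arr_mul _ _ (by rw [e₂, e₁'])

theorem continuousOn_act (hH' : H'.IsProperEtale) : ContinuousOn
    (fun t : MoritaTriple E E' F × O.Arrow × MoritaTriple E E' F => act t.1 t.2.1 t.2.2)
    {t | source t.2.1 = E.right.obj t.1.1.1 ∧ target t.2.1 = E.right.obj t.2.2.1.1} := by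
  set S := {t : MoritaTriple E E' F × O.Arrow × MoritaTriple E E' F |
    source t.2.1 = E.right.obj t.1.1.1 ∧ target t.2.1 = E.right.obj t.2.2.1.1}
  rw [continuousOn_iff_continuous_domRestrict]
  have hval : Continuous fun x : MoritaTriple E E' F => x.1 := continuous_subtype_val
  have hx : Continuous fun t : S => t.1.1.1 :=
    hval.comp (continuous_fst.comp continuous_subtype_val)
  have hy : Continuous fun t : S => t.1.2.2.1 :=
    hval.comp (continuous_snd.comp (continuous_snd.comp continuous_subtype_val))
  have hr : Continuous fun t : S => t.1.2.1 :=
    continuous_fst.comp (continuous_snd.comp continuous_subtype_val)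
  have h₁ : Continuous fun t : S => E.right.liftArr t.1.1.1.1 t.1.2.2.1.1 t.1.2.1 :=
    (Hom.continuousOn_liftArr E.isMorita_right).comp_continuous
      (f := fun t : S => ((t.1.1.1.1, t.1.2.2.1.1), t.1.2.1))
      (((continuous_fst.comp hx).prodMk (continuous_fst.comp hy)).prodMk hr) fun t => t.2
  have h₂ : Continuous fun t : S =>
      H'.mul (F.arr (E.left.arr (E.right.liftArr t.1.1.1.1 t.1.2.2.1.1 t.1.2.1))) t.1.2.2.1.2.2 :=
    hH'.continuousOn_mul.comp_continuous
      (f := fun t : S => (F.arr (E.left.arr (E.right.liftArr t.1.1.1.1 t.1.2.2.1.1 t.1.2.1)),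
        t.1.2.2.1.2.2))
      ((F.continuous_arr.comp (E.left.continuous_arr.comp h₁)).prodMk
        (continuous_snd.comp (continuous_snd.comp hy))) fun t => tgt_middle t.2.1 t.2.2
  have h₃ : Continuous fun t : S => conj t.1.1 t.1.2.1 t.1.2.2 :=
    hH'.continuousOn_mul.comp_continuous
      (f := fun t : S => (H'.inv t.1.1.1.2.2,
        H'.mul (F.arr (E.left.arr (E.right.liftArr t.1.1.1.1 t.1.2.2.1.1 t.1.2.1))) t.1.2.2.1.2.2))
      ((hH'.continuous_inv.comp (continuous_snd.comp (continuous_snd.comp hx))).prodMk h₂)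
      fun t => by
        change H'.tgt (H'.inv _) = H'.src (H'.mul _ _)
        rw [hH'.tgt_inv, hH'.src_mul _ _ (tgt_middle t.2.1 t.2.2), src_middle t.2.1 t.2.2]
  have h₄ : Continuous fun t : S =>
      E'.left.liftArr t.1.1.1.2.1 t.1.2.2.1.2.1 (conj t.1.1 t.1.2.1 t.1.2.2) :=
    (Hom.continuousOn_liftArr E'.isMorita_left).comp_continuous
      (f := fun t : S => ((t.1.1.1.2.1, t.1.2.2.1.2.1), conj t.1.1 t.1.2.1 t.1.2.2))
      (((continuous_fst.comp (continuous_snd.comp hx)).prodMk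
        (continuous_fst.comp (continuous_snd.comp hy))).prodMk h₃)
      fun t => ⟨src_conj hH' t.2.1 t.2.2, tgt_conj hH' t.2.1 t.2.2⟩
  exact E'.right.continuous_arr.comp h₄

/-- Invert `E.right.obj` locally, map to `H'`, follow a local section of the source map through `ρ`,
and invert `E'.left.obj` locally at the target of the resulting arrow. Every step is smooth on
objects. -/
theorem exists_section (hH' : H'.IsProperEtale) (x : MoritaTriple E E' F) :
    ∃ (N : Set O.Point) (τ : O.Point → MoritaTriple E E' F), IsOpen N ∧ E.right.obj x.1.1 ∈ N ∧
      ContinuousOn τ N ∧ τ (E.right.obj x.1.1) = x ∧ (∀ y ∈ N, E.right.obj (τ y).1.1 = y) ∧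
      ContMDiffOn (𝓡 n) (𝓡 m) ∞
        (fun y => (show P.Point from E'.right.obj (τ y).1.2.1)) N := by
  classical
  obtain ⟨⟨k, k', ρ⟩, hs, ht⟩ := x
  dsimp only at hs ht
  have hb := E.isMorita_right.etale k
  have ha := E'.isMorita_left.etale k'
  set l := hb.localInverse
  set l' := ha.localInverse
  obtain ⟨e, hρe, hsrc⟩ := hH'.isLocalHomeomorph_src ρ
  have hsrc' : ∀ z ∈ e.target, H'.src (e.symm z) = z := fun z hz => by rw [hsrc, e.right_inv hz]
  set φ : O.Point → H'.Obj := fun y => F.obj (E.left.obj (l y))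
  have hφ : ContMDiffOn (𝓡 n) (𝓡 m) ∞ φ l.source :=
    (F.contMDiff_obj.comp E.left.contMDiff_obj).comp_contMDiffOn hb.localInverse_contMDiffOn
  have htgt : ContMDiffOn (𝓡 m) (𝓡 m) ∞ (fun z => H'.tgt (e.symm z)) e.target :=
    hH'.contMDiffOn_tgt e.target e.symm e.open_target e.continuousOn_symm hsrc'
  set N₁ : Set O.Point := l.source ∩ φ ⁻¹' e.target
  have hN₁ : IsOpen N₁ := hφ.continuousOn.isOpen_inter_preimage l.open_source e.open_target
  have hψ : ContMDiffOn (𝓡 n) (𝓡 m) ∞ (fun y => H'.tgt (e.symm (φ y))) N₁ :=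
    htgt.comp (hφ.mono Set.inter_subset_left) Set.inter_subset_right
  set N : Set O.Point := N₁ ∩ (fun y => H'.tgt (e.symm (φ y))) ⁻¹' l'.source
  have hN : IsOpen N := hψ.continuousOn.isOpen_inter_preimage hN₁ l'.open_source
  have hlk : l (E.right.obj k) = k := hb.localInverse_left_inv hb.localInverse_mem_target
  have hφk : φ (E.right.obj k) = H'.src ρ := by rw [hs]; simp only [φ, hlk]
  have heρ : e.symm (H'.src ρ) = ρ := by rw [hsrc, e.left_inv hρe]
  have hkN : E.right.obj k ∈ N := by
    refine ⟨⟨hb.localInverse_mem_source, ?_⟩, ?_⟩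
    · change φ (E.right.obj k) ∈ e.target
      rw [hφk, hsrc]
      exact e.map_source hρe
    · change H'.tgt (e.symm (φ (E.right.obj k))) ∈ l'.source
      rw [hφk, heρ, ht]
      exact ha.localInverse_mem_source
  let τ₀ : O.Point → E.mid.Obj × E'.mid.Obj × H'.Arr := fun y =>
    (l y, l' (H'.tgt (e.symm (φ y))), e.symm (φ y))
  have hτ₀ : ∀ y ∈ N, H'.src (τ₀ y).2.2 = F.obj (E.left.obj (τ₀ y).1) ∧
      H'.tgt (τ₀ y).2.2 = E'.left.obj (τ₀ y).2.1 := fun y hy =>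
    ⟨hsrc' _ hy.1.2, (ha.localInverse_right_inv hy.2).symm⟩
  -- Outside `N` the value is arbitrary; the original triple serves as default.
  let τ : O.Point → MoritaTriple E E' F := fun y =>
    if hy : y ∈ N then ⟨τ₀ y, hτ₀ y hy⟩ else ⟨(k, k', ρ), hs, ht⟩
  have hτ : ∀ y ∈ N, (τ y).1 = τ₀ y := fun y hy =>
    congrArg Subtype.val (dif_pos hy)
  have hl'c : ContMDiffOn (𝓡 n) (𝓡 m) ∞ (fun y => l' (H'.tgt (e.symm (φ y)))) N :=
    ha.localInverse_contMDiffOn.comp (hψ.mono Set.inter_subset_left) Set.inter_subset_right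
  refine ⟨N, τ, hN, hkN, ?_, Subtype.ext ?_, fun y hy => ?_, ?_⟩
  · have hind : IsInducing fun x : MoritaTriple E E' F => x.1 := IsInducing.subtypeVal
    rw [hind.continuousOn_iff]
    refine ContinuousOn.congr (f := τ₀) ?_ hτ
    refine (hb.localInverse_contMDiffOn.continuousOn.mono fun y hy => hy.1.1).prodMk
      (hl'c.continuousOn.prodMk ?_)
    exact e.continuousOn_symm.comp (hφ.continuousOn.mono fun y hy => hy.1.1) fun y hy => hy.1.2
  · refine (hτ _ hkN).trans ?_
    simp only [τ₀, hlk, hφk, heρ]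
    rw [ht]
    exact congrArg (fun z => (k, z, ρ)) (ha.localInverse_left_inv ha.localInverse_mem_target)
  · rw [hτ y hy]
    exact hb.localInverse_right_inv hy.1.1
  · have h₁ : ContMDiffOn (𝓡 n) (𝓡 m) ∞
        (fun y => (show P.Point from E'.right.obj (l' (H'.tgt (e.symm (φ y)))))) N :=
      E'.right.contMDiff_obj.comp_contMDiffOn hl'c
    exact h₁.congr fun y hy => by rw [hτ y hy]

end

variable (E E' F) in
theorem exists_fst_eq (k : E.mid.Obj) : ∃ x : MoritaTriple E E' F, x.1.1 = k := by
  obtain ⟨⟨⟨k', ρ⟩, h⟩, hρ⟩ := E'.isMorita_left.surjective (F.obj (E.left.obj k))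
  exact ⟨⟨(k, k', ρ), hρ, h.symm⟩, rfl⟩

theorem exists_proj_eq (E : H.MoritaEquivalence O.groupoid) (p : X) :
    ∃ k : E.mid.Obj, Point.proj (show O.Point from E.right.obj k) = p := by
  obtain ⟨v, hv⟩ := O.mem_chart p
  obtain ⟨⟨⟨k, r⟩, h⟩, hr⟩ := E.isMorita_right.surjective ⟨p, v⟩
  refine ⟨k, ?_⟩
  have h₁ := proj_source_eq_proj_target (O := O) r
  rw [show source r = ⟨p, v⟩ from hr] at h₁
  rw [show E.right.obj k = target r from h]
  exact h₁.symm.trans hv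

end MoritaTriple

/-- The generalized morphism given by a morphism between Morita equivalent groupoids. -/
def moritaBridge (hH' : H'.IsProperEtale) : Bridge.{u, u + 1} O P where
  T := MoritaTriple E E' F
  base := fun x => E.right.obj x.1.1
  val := fun x => E'.right.obj x.1.2.1
  act := MoritaTriple.act
  source_act := MoritaTriple.source_act hH'
  target_act := MoritaTriple.target_act hH'
  act_mul := MoritaTriple.act_mul hH'
  continuousOn_act := MoritaTriple.continuousOn_act hH'
  exists_section := MoritaTriple.exists_section hH'
  exists_proj_eq := fun p => by
    obtain ⟨k, hk⟩ := MoritaTriple.exists_proj_eq E p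
    obtain ⟨x, hx⟩ := MoritaTriple.exists_fst_eq E E' F k
    exact ⟨x, by rw [hx]; exact hk⟩

/-- A morphism between groupoids Morita equivalent to those of two reduced orbifolds induces a unique
smooth map of orbifolds, and this map is good. -/
theorem exists_induces [T2Space X] [SecondCountableTopology X] (hO : O.IsReduced) (hP : P.IsReduced)
    (hH' : H'.IsProperEtale) :
    ∃ f : OrbifoldMap O P, Induces E.left E.right F E'.left E'.right f ∧ f.IsGood ∧
      ∀ g : OrbifoldMap O P, Induces E.left E.right F E'.left E'.right g → f.Same g := by
  set Γ := moritaBridge E E' F hH'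
  refine ⟨Γ.orbifoldMap hO hP, fun k => ?_, Γ.isGood_orbifoldMap hO hP, fun g hg => ?_⟩
  · obtain ⟨x, rfl⟩ := MoritaTriple.exists_fst_eq E E' F k
    obtain ⟨d, w, hw, -⟩ := Γ.exists_localLift hO hP x Set.finite_empty (by simp) Filter.univ_mem
    have hval : Continuous fun x : MoritaTriple E E' F => x.1 := continuous_subtype_val
    have hτ : Continuous fun w => (show MoritaTriple E E' F from d.τ w).1 :=
      hval.comp d.continuous_τ
    exact ⟨d.p, d.W, d.i, w, fun w => (show MoritaTriple E E' F from d.τ w).1.1, d.q, d.Z, d.j,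
      d.lifting hO hP, fun w => (show MoritaTriple E E' F from d.τ w).1.2.1,
      fun w => (show MoritaTriple E E' F from d.τ w).1.2.2, continuous_fst.comp hτ,
      congrArg (fun x : MoritaTriple E E' F => x.1.1) hw, d.base_τ,
      continuous_snd.comp (continuous_snd.comp hτ), fun w => (d.τ w).2.1, fun w => (d.τ w).2.2,
      continuous_fst.comp (continuous_snd.comp hτ), d.val_τ,
      Γ.sameGerm_orbifoldMap hO hP (fun _ => rfl) ⟨w, rfl⟩⟩
  · have key : ∀ p, SameGerm p ((Γ.orbifoldMap hO hP).lift p) (g.lift p) := by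
      intro p
      obtain ⟨k, rfl⟩ := MoritaTriple.exists_proj_eq E p
      obtain ⟨p', W, i, w, τ, q, Z, j, L, τ', ρ, hτ, rfl, hb, hρ, hρs, hρt, hτ', hb', hgerm⟩ := hg k
      -- The data by which `g` is induced near `k` constitute a local lifting of the bridge, so `L`
      -- has the germ of the constructed map as well as that of `g`.
      let d : Γ.LocalLift :=
        { p := p', W := W, i := i, q := q, Z := Z, j := j
          τ := fun w => (⟨(τ w, τ' w, ρ w), hρs w, hρt w⟩ : MoritaTriple E E' F)
          toFun := L.toFun
          continuous_τ := (hτ.prodMk (hτ'.prodMk hρ)).subtype_mk _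
          base_τ := hb
          val_τ := hb'
          contMDiff_toFun := L.contMDiff }
      have hw : Point.proj (show O.Point from E.right.obj (τ w)) = W.proj w := by
        rw [hb]
        exact i.proj_comp w
      rw [hw]
      exact (Γ.sameGerm_orbifoldMap hO hP (d := d) (L := L) (fun _ => rfl) ⟨w, rfl⟩).symm.trans
        (i.ker_source (hO _)) (j.ker_source (hP _)) hgerm
    exact ⟨funext fun p => (key p).apply_eq, key⟩

end Morita

/-- The identity Morita equivalence. -/
def GroupoidData.IsProperEtale.moritaRefl {n : ℕ} {A : GroupoidData.{u, v} n}
    (hA : A.IsProperEtale) : A.MoritaEquivalence A :=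
  ⟨A, hA, .id A, .id A, hA.isMorita_id, hA.isMorita_id⟩

end

section

/-! ### Maps out of disjoint unions -/

section SigmaDesc

variable {n m : ℕ} {ι : Type u} {M : ι → Type u} [∀ i, TopologicalSpace (M i)]
  [∀ i, ChartedSpace (EuclideanSpace ℝ (Fin n)) (M i)]
  {N : Type*} [TopologicalSpace N] [ChartedSpace (EuclideanSpace ℝ (Fin m)) N] {f : (Σ i, M i) → N}

theorem isLocalDiffeomorph_sigma
    (h : ∀ i, IsLocalDiffeomorph (𝓡 n) (𝓡 m) ∞ fun x : M i => f ⟨i, x⟩) :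
    letI := sigmaChartedSpace (n := n) M
    IsLocalDiffeomorph (𝓡 n) (𝓡 m) ∞ f := by
  let _ := sigmaChartedSpace (n := n) M
  rintro ⟨i, x⟩
  have hd := isLocalDiffeomorph_sigmaMk (n := n) M i x
  exact (hd.localInverse_isLocalDiffeomorphAt.comp (𝓡 m) N (h i _)).congr_of_eventuallyEq
    (hd.localInverse_eventuallyEq_right.mono fun y hy => congrArg f hy.symm)

theorem contMDiff_sigma (h : ∀ i, ContMDiff (𝓡 n) (𝓡 m) ∞ fun x : M i => f ⟨i, x⟩) :
    letI := sigmaChartedSpace (n := n) M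
    ContMDiff (𝓡 n) (𝓡 m) ∞ f := by
  let _ := sigmaChartedSpace (n := n) M
  rintro ⟨i, x⟩
  have hd := isLocalDiffeomorph_sigmaMk (n := n) M i x
  exact (ContMDiffAt.comp _ (h i _) hd.localInverse_contMDiffAt).congr_of_eventuallyEq
    (hd.localInverse_eventuallyEq_right.mono fun y hy => congrArg f hy.symm)

end SigmaDesc

/-! ### Refinements of an orbifold structure -/

namespace OrbifoldStructure

open UniformizingSystem

variable {n : ℕ} {X : Type u} [TopologicalSpace X]

/-- A choice of a smaller chart around every point. -/
structure Refinement (O : OrbifoldStructure n X) where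
  W : X → UniformizingSystem n X
  mem_W : ∀ p, p ∈ (W p).U
  inj : ∀ p, Injection (W p) (O.chart p)

namespace Refinement

variable {O : OrbifoldStructure n X} (R : O.Refinement) (hO : O.IsReduced)

/-- The orbifold structure given by the smaller charts. -/
def orbifold : OrbifoldStructure n X where
  chart := R.W
  mem_chart := R.mem_W
  equivalentAt := by
    rintro p q ⟨w, rfl⟩
    obtain ⟨w', hw'⟩ := R.mem_W ((R.W p).proj w)
    exact (((O.isChart_chart _).of_injection hO (R.inj _)).linked hO
      ((O.isChart_chart _).of_injection hO (R.inj _)) hw'.symm).equivalentAt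

theorem isReduced_orbifold : (R.orbifold hO).IsReduced := fun p => (R.inj p).ker_source (hO p)

/-- The map on objects. -/
def obj (x : (R.orbifold hO).Point) : O.Point := ⟨x.1, (R.inj x.1).toFun x.2⟩

/-- The map on pairs of injections. -/
def span (D : (R.orbifold hO).Span) : O.Span :=
  ⟨D.W, D.p, D.q, (R.inj D.p).comp D.fst, (R.inj D.q).comp D.snd⟩

/-- The map on arrows. -/
def arr : (R.orbifold hO).Arrow → O.Arrow :=
  Quot.map (fun x => ⟨R.span hO x.1, x.2⟩) (by
    rintro _ _ ⟨D, W, γ, w⟩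
    exact TripleRel.mk (R.span hO D) W γ w)

theorem obj_injective : Function.Injective (R.obj hO) := by
  rintro ⟨p, x⟩ ⟨q, y⟩ h
  obtain rfl : p = q := congrArg Sigma.fst h
  exact congrArg (Sigma.mk p) ((R.inj p).injective (eq_of_heq (Sigma.mk.inj_iff.1 h).2))

theorem isLocalDiffeomorph_obj : IsLocalDiffeomorph (𝓡 n) (𝓡 n) ∞ (R.obj hO) :=
  isLocalDiffeomorph_sigma fun p => fun w => ((R.inj p).isLocalDiffeomorph w).comp (𝓡 n) O.Point
    (isLocalDiffeomorph_sigmaMk (n := n) (fun p : X => (O.chart p).V) p _)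

theorem continuous_arr : Continuous (R.arr hO) :=
  continuous_quot_lift _ (continuous_sigma fun D => (R.span hO D).continuous_arr)

theorem isOpenMap_arr : IsOpenMap (R.arr hO) := by
  intro s hs
  refine isOpen_iff_mem_nhds.2 ?_
  rintro _ ⟨r, hr, rfl⟩
  obtain ⟨D, w, rfl⟩ := exists_arr_eq r
  have h : (R.span hO D).arr '' (D.arr ⁻¹' s) ∈ 𝓝 ((R.span hO D).arr w) :=
    ((R.span hO D).isOpenEmbedding_arr hO).isOpenMap.image_mem_nhds
      (D.continuous_arr.continuousAt (hs.mem_nhds hr))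
  filter_upwards [h]
  rintro _ ⟨v, hv, rfl⟩
  exact ⟨D.arr v, hv, rfl⟩

theorem source_arr (r) : source (R.arr hO r) = R.obj hO (source r) := by
  obtain ⟨D, w, rfl⟩ := exists_arr_eq r
  rfl

theorem target_arr (r) : target (R.arr hO r) = R.obj hO (target r) := by
  obtain ⟨D, w, rfl⟩ := exists_arr_eq r
  rfl

/-- A common restriction in `O` is already one for the smaller charts, since their injections into
the charts of `O` are injective. -/
theorem eq_of_arr_eq {r r' : (R.orbifold hO).Arrow} (hs : source r = source r')
    (ht : target r = target r') (h : R.arr hO r = R.arr hO r') : r = r' := by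
  obtain ⟨⟨W, p, q, f, g⟩, w, rfl⟩ := exists_arr_eq r
  obtain ⟨⟨W', p', q', f', g'⟩, w', rfl⟩ := exists_arr_eq r'
  obtain rfl : p = p' := congrArg Sigma.fst hs
  obtain rfl : q = q' := congrArg Sigma.fst ht
  obtain ⟨N, c, c', x, hx, hx', h₁, h₂⟩ := (arrow_eq_iff hO).1 h
  exact (arrow_eq_iff (R.isReduced_orbifold hO)).2 ⟨N, c, c', x, hx, hx',
    fun y => (R.inj p).injective (h₁ y), fun y => (R.inj q).injective (h₂ y)⟩

theorem exists_arr_eq_of_source_target {x y : (R.orbifold hO).Point} {ρ : O.Arrow}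
    (hs : source ρ = R.obj hO x) (ht : target ρ = R.obj hO y) :
    ∃ r, source r = x ∧ target r = y ∧ R.arr hO r = ρ := by
  obtain ⟨N, c, d, z, hc, hd, rfl⟩ := exists_arrow_comp_eq hO (R.inj x.1) (R.inj y.1) hs ht
  exact ⟨(R.orbifold hO).arrow (p := x.1) (q := y.1) c z d, congrArg (Sigma.mk x.1) hc,
    congrArg (Sigma.mk y.1) hd, rfl⟩

/-- The morphism from the groupoid of the refined structure. -/
def hom : (R.orbifold hO).groupoid.Hom O.groupoid where
  obj := R.obj hO
  arr := R.arr hO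
  contMDiff_obj := (R.isLocalDiffeomorph_obj hO).contMDiff
  continuous_arr := R.continuous_arr hO
  src_arr := R.source_arr hO
  tgt_arr := R.target_arr hO
  arr_one := fun x => arrow_self (R.inj x.1) x.2
  arr_mul := fun a b h => by
    obtain ⟨W, p, q, r, f, g, k, w, rfl, rfl⟩ := exists_composable (R.isReduced_orbifold hO) h
    rw [mul_arrow (R.isReduced_orbifold hO)]
    exact (mul_arrow hO ((R.inj p).comp f) ((R.inj q).comp g) ((R.inj r).comp k) w).symm
  arr_inv := fun a => by
    obtain ⟨D, w, rfl⟩ := exists_arr_eq a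
    rfl

theorem isMorita_hom : (R.hom hO).IsMorita where
  etale := R.isLocalDiffeomorph_obj hO
  surjective := fun y => by
    obtain ⟨w, hw⟩ := R.mem_W (Point.proj (show O.Point from y))
    obtain ⟨ρ, hs, ht⟩ := exists_arrow hO y (R.obj hO ⟨_, w⟩)
      (hw.symm.trans ((R.inj _).proj_comp w).symm)
    exact ⟨⟨(⟨_, w⟩, ρ), ht.symm⟩, hs⟩
  isFiberProduct := by
    refine ⟨?_, fun s hs => ?_, fun r r' h => ?_, ?_⟩
    · exact ((continuous_source.prodMk continuous_target).prodMk (R.continuous_arr hO)).subtype_mk _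
    -- The map on objects is injective, so a point of the fibre product is determined by its arrow;
    -- openness reduces to that of `R.arr`.
    · have ho : IsOpen (X := O.groupoid.Arr) (R.arr hO '' s) := R.isOpenMap_arr hO s hs
      have hc : Continuous fun t : {x : ((R.orbifold hO).groupoid.Obj ×
          (R.orbifold hO).groupoid.Obj) × O.groupoid.Arr //
          ((R.hom hO).obj x.1.1, (R.hom hO).obj x.1.2) = (O.groupoid.src x.2, O.groupoid.tgt x.2)} =>
          t.1.2 := continuous_snd.comp continuous_subtype_val
      refine isOpen_iff_mem_nhds.2 ?_
      rintro _ ⟨r, hr, rfl⟩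
      refine Filter.mem_of_superset ((ho.preimage hc).mem_nhds ⟨r, hr, rfl⟩) ?_
      rintro ⟨⟨⟨x, y⟩, ρ⟩, hρ⟩ ⟨r, hr, rfl⟩
      refine ⟨r, hr, Subtype.ext (Prod.ext (Prod.ext ?_ ?_) rfl)⟩
      · exact R.obj_injective hO ((R.source_arr hO r).symm.trans (congrArg Prod.fst hρ).symm)
      · exact R.obj_injective hO ((R.target_arr hO r).symm.trans (congrArg Prod.snd hρ).symm)
    · exact R.eq_of_arr_eq hO (congrArg (fun t => t.1.1.1) h) (congrArg (fun t => t.1.1.2) h)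
        (congrArg (fun t => t.1.2) h)
    · rintro ⟨⟨⟨x, y⟩, ρ⟩, hρ⟩
      obtain ⟨r, hx, hy, hr⟩ := R.exists_arr_eq_of_source_target hO (congrArg Prod.fst hρ).symm
        (congrArg Prod.snd hρ).symm
      exact ⟨r, Subtype.ext (Prod.ext (Prod.ext hx hy) hr)⟩

end Refinement

end OrbifoldStructure

end

section

/-! ### Arrows between points of larger charts -/

namespace OrbifoldStructure

open UniformizingSystem

variable {n : ℕ} {X : Type u} [TopologicalSpace X]

/-- A system with injections into a chart of the orbifold structure and into another chart `B`. -/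
structure Frame (O : OrbifoldStructure n X) (B : UniformizingSystem n X) where
  p : X
  Z : UniformizingSystem n X
  e : Injection Z B
  j : Injection Z (O.chart p)

variable {O : OrbifoldStructure n X} {A A' B B' B'' : UniformizingSystem n X}

/-- The arrow `r` between the charts of two frames is given near `z` by the injections `α : A → B`
and `β : A → B'`. -/
def ArrowOver (φ : O.Frame B) (ψ : O.Frame B') (α : Injection A B) (β : Injection A B') (z : A.V)
    (r : O.Arrow) : Prop :=
  ∃ (S : UniformizingSystem n X) (s : Injection S A) (t : Injection S φ.Z) (t' : Injection S ψ.Z)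
    (σ : S.V), s.toFun σ = z ∧ (∀ x, φ.e.toFun (t.toFun x) = α.toFun (s.toFun x)) ∧
      (∀ x, ψ.e.toFun (t'.toFun x) = β.toFun (s.toFun x)) ∧
      r = O.arrow (φ.j.comp t) σ (ψ.j.comp t')

namespace ArrowOver

variable {φ : O.Frame B} {ψ : O.Frame B'} {χ : O.Frame B''} {α : Injection A B} {β : Injection A B'}
  {γ : Injection A B''} {z : A.V} {r r' : O.Arrow}

theorem symm : ArrowOver φ ψ α β z r → ArrowOver ψ φ β α z (O.groupoid.inv r) := by
  rintro ⟨S, s, t, t', σ, h, h₁, h₂, rfl⟩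
  exact ⟨S, s, t', t, σ, h, h₂, h₁, rfl⟩

theorem source_eq {x : φ.Z.V} (hx : φ.e.toFun x = α.toFun z) :
    ArrowOver φ ψ α β z r → source r = ⟨φ.p, φ.j.toFun x⟩ := by
  rintro ⟨S, s, t, t', σ, rfl, h₁, h₂, rfl⟩
  rw [φ.e.injective (hx.trans (h₁ σ).symm)]
  rfl

theorem target_eq {x : ψ.Z.V} (hx : ψ.e.toFun x = β.toFun z) :
    ArrowOver φ ψ α β z r → target r = ⟨ψ.p, ψ.j.toFun x⟩ := by
  rintro ⟨S, s, t, t', σ, rfl, h₁, h₂, rfl⟩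
  rw [ψ.e.injective (hx.trans (h₂ σ).symm)]
  rfl

theorem exists_source : ArrowOver φ ψ α β z r →
    ∃ x, φ.e.toFun x = α.toFun z ∧ source r = ⟨φ.p, φ.j.toFun x⟩ := by
  rintro ⟨S, s, t, t', σ, rfl, h₁, h₂, rfl⟩
  exact ⟨t.toFun σ, h₁ σ, rfl⟩

theorem exists_target : ArrowOver φ ψ α β z r →
    ∃ x, ψ.e.toFun x = β.toFun z ∧ target r = ⟨ψ.p, ψ.j.toFun x⟩ := by
  rintro ⟨S, s, t, t', σ, rfl, h₁, h₂, rfl⟩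
  exact ⟨t'.toFun σ, h₂ σ, rfl⟩

/-- Two such arrows at the same point of `A` are given by injections of one system. -/
theorem exists_common (hA : A.ker = ⊥) (h : ArrowOver φ ψ α β z r)
    {C C' : UniformizingSystem n X} {φ' : O.Frame C} {ψ' : O.Frame C'} {α' : Injection A C}
    {β' : Injection A C'} (h' : ArrowOver φ' ψ' α' β' z r') :
    ∃ (S : UniformizingSystem n X) (s : Injection S A) (t : Injection S φ.Z) (t' : Injection S ψ.Z)
      (u : Injection S φ'.Z) (u' : Injection S ψ'.Z) (σ : S.V), s.toFun σ = z ∧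
      (∀ x, φ.e.toFun (t.toFun x) = α.toFun (s.toFun x)) ∧
      (∀ x, ψ.e.toFun (t'.toFun x) = β.toFun (s.toFun x)) ∧
      (∀ x, φ'.e.toFun (u.toFun x) = α'.toFun (s.toFun x)) ∧
      (∀ x, ψ'.e.toFun (u'.toFun x) = β'.toFun (s.toFun x)) ∧
      r = O.arrow (φ.j.comp t) σ (ψ.j.comp t') ∧ r' = O.arrow (φ'.j.comp u) σ (ψ'.j.comp u') := by
  obtain ⟨S, s, t, t', σ, rfl, h₁, h₂, rfl⟩ := h
  obtain ⟨S', s', u, u', σ', hσ, h₁', h₂', rfl⟩ := h'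
  obtain ⟨T, c, c', τ, rfl, rfl, hc⟩ := exists_pullback hA s s' hσ.symm
  refine ⟨T, s.comp c, t.comp c, t'.comp c, u.comp c', u'.comp c', τ, rfl, fun x => h₁ _,
    fun x => h₂ _, fun x => (h₁' _).trans (congrArg α'.toFun (hc x).symm),
    fun x => (h₂' _).trans (congrArg β'.toFun (hc x).symm), ?_, ?_⟩
  · exact (arrow_comp (φ.j.comp t) (ψ.j.comp t') c τ).symm
  · exact (arrow_comp (φ'.j.comp u) (ψ'.j.comp u') c' τ).symm

/-- Over a common system the two injections into `ψ.Z` lie over the same map to `B'`, hence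
coincide, and the arrows compose there. -/
theorem mul (hO : O.IsReduced) (hA : A.ker = ⊥) (h : ArrowOver φ ψ α β z r)
    (h' : ArrowOver ψ χ β γ z r') : ArrowOver φ χ α γ z (O.groupoid.mul r r') := by
  obtain ⟨S, s, t, t', u, u', σ, hσ, h₁, h₂, h₃, h₄, rfl, rfl⟩ := h.exists_common hA h'
  obtain rfl : t' = u := Injection.eq_of_toFun_eq (ψ.j.ker_source (hO _)) fun x =>
    ψ.e.injective ((h₂ x).trans (h₃ x).symm)
  exact ⟨S, s, t, u', σ, hσ, h₁, h₄, mul_arrow hO _ _ _ _⟩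

theorem unique (hO : O.IsReduced) (hA : A.ker = ⊥) (h : ArrowOver φ ψ α β z r)
    (h' : ArrowOver φ ψ α β z r') : r = r' := by
  obtain ⟨S, s, t, t', u, u', σ, hσ, h₁, h₂, h₃, h₄, rfl, rfl⟩ := h.exists_common hA h'
  obtain rfl : t = u := Injection.eq_of_toFun_eq (φ.j.ker_source (hO _)) fun x =>
    φ.e.injective ((h₁ x).trans (h₃ x).symm)
  obtain rfl : t' = u' := Injection.eq_of_toFun_eq (ψ.j.ker_source (hO _)) fun x =>
    ψ.e.injective ((h₂ x).trans (h₄ x).symm)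
  rfl

theorem comp (hA : A.ker = ⊥) (c : Injection A' A) {z' : A'.V} (hz : c.toFun z' = z)
    (h : ArrowOver φ ψ α β z r) : ArrowOver φ ψ (α.comp c) (β.comp c) z' r := by
  obtain ⟨S, s, t, t', σ, rfl, h₁, h₂, rfl⟩ := h
  obtain ⟨T, d, d', τ, rfl, rfl, hd⟩ := exists_pullback hA s c hz.symm
  exact ⟨T, d', t.comp d, t'.comp d, τ, rfl,
    fun x => (h₁ _).trans (congrArg α.toFun (hd x)), fun x => (h₂ _).trans (congrArg β.toFun (hd x)),
    (arrow_comp (φ.j.comp t) (ψ.j.comp t') d τ).symm⟩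

theorem exists_of_mem (hA : A.ker = ⊥) (φ : O.Frame B) (ψ : O.Frame B')
    (α : Injection A B) (β : Injection A B') (h : α.toFun z ∈ Set.range φ.e.toFun)
    (h' : β.toFun z ∈ Set.range ψ.e.toFun) : ∃ r, ArrowOver φ ψ α β z r := by
  have hB : B.ker = ⊥ := α.ker_target hA
  have hB' : B'.ker = ⊥ := β.ker_target hA
  obtain ⟨x, hx⟩ := h
  obtain ⟨y, hy⟩ := h'
  obtain ⟨S, t, s, σ, rfl, rfl, hs⟩ := exists_pullback hB φ.e α hx
  obtain ⟨T, t', c, τ, rfl, rfl, hc⟩ := exists_pullback hB' ψ.e (β.comp s) hy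
  exact ⟨_, T, s.comp c, t.comp c, t', τ, rfl, fun x => hs _, hc, rfl⟩

theorem eq_one (hO : O.IsReduced) {x : φ.Z.V} (hx : φ.e.toFun x = α.toFun z)
    (h : ArrowOver φ φ α α z r) : r = O.groupoid.one ⟨φ.p, φ.j.toFun x⟩ := by
  obtain ⟨S, s, t, t', σ, rfl, h₁, h₂, rfl⟩ := h
  obtain rfl : t = t' := Injection.eq_of_toFun_eq (φ.j.ker_source (hO _)) fun x =>
    φ.e.injective ((h₁ x).trans (h₂ x).symm)
  rw [φ.e.injective (hx.trans (h₁ σ).symm)]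
  exact arrow_self _ _

end ArrowOver

end OrbifoldStructure

/-! ### The morphism given by a compatible system -/

namespace CompatibleCover

open UniformizingSystem OrbifoldStructure

variable {n : ℕ} {X : Type u} [TopologicalSpace X] {O : OrbifoldStructure n X}
  (C : CompatibleCover O) {i j k l : C.ι}

theorem ker_chart (hO : O.IsReduced) (i : C.ι) : (C.chart i).ker = ⊥ := (C.isChart i).ker_eq_bot hO

/-- Any injection into the larger chart hits the right orbit and is corrected by a group element. -/
theorem exists_injection_apply_eq (hO : O.IsReduced) (h : (C.chart k).U ⊆ (C.chart i).U)
    {x : (C.chart i).V} {v : (C.chart k).V} (hv : (C.chart k).proj v = (C.chart i).proj x) :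
    ∃ a : Injection (C.chart k) (C.chart i), a.toFun v = x := by
  obtain ⟨a⟩ := C.exists_injection k i h
  obtain ⟨g, hg⟩ := proj_eq_iff.1 (show (C.chart i).proj (a.toFun v) = (C.chart i).proj x by
    rw [a.proj_comp, hv])
  obtain ⟨b, hb⟩ := a.exists_smul_comp (C.ker_chart hO i) g
  exact ⟨b, by rw [hb, hg]⟩

theorem exists_square (hO : O.IsReduced) (a : Injection (C.chart j) (C.chart i))
    (b : Injection (C.chart k) (C.chart i)) {x : (C.chart j).V} {y : (C.chart k).V}
    (h : a.toFun x = b.toFun y) :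
    ∃ (l : C.ι) (c : Injection (C.chart l) (C.chart j)) (d : Injection (C.chart l) (C.chart k))
      (v : (C.chart l).V), c.toFun v = x ∧ d.toFun v = y ∧ a.comp c = b.comp d := by
  have hp : (C.chart j).proj x = (C.chart k).proj y := by
    rw [← a.proj_comp, ← b.proj_comp, h]
  obtain ⟨l, ⟨v, hv⟩, hl⟩ := C.exists_mem_inter j k _ ⟨⟨x, rfl⟩, ⟨y, hp.symm⟩⟩
  obtain ⟨c, hc⟩ := C.exists_injection_apply_eq hO (hl.trans Set.inter_subset_left) hv
  obtain ⟨d, hd⟩ := C.exists_injection_apply_eq hO (hl.trans Set.inter_subset_right) (hv.trans hp)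
  obtain ⟨g, hg⟩ := Injection.exists_smul_eq (C.ker_chart hO i) (b.comp d) (a.comp c)
  -- The discrepancy `g` fixes the point `b y`, so it comes from the group of `C.chart k` and can be
  -- absorbed into `d`.
  obtain ⟨g', rfl⟩ := exists_hom_eq (C.ker_chart hO i) b (g := g) (a := y) (b := y) (by
    have := hg v
    change a.toFun (c.toFun v) = g • b.toFun (d.toFun v) at this
    rw [hc, hd, h] at this
    exact this.symm)
  obtain ⟨d', hd'⟩ := d.exists_smul_comp (C.ker_chart hO k) g'
  have hcd : a.comp c = b.comp d' := Injection.eq_of_toFun_eq (C.ker_chart hO i) fun w => by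
    refine (hg w).trans ?_
    change b.hom g' • b.toFun (d.toFun w) = b.toFun (d'.toFun w)
    rw [hd', b.equivariant]
  refine ⟨l, c, d', v, hc, b.injective ?_, hcd⟩
  rw [← h, ← hc]
  exact (congrArg (fun e => e.toFun v) hcd).symm

/-- An arrow consists of germs of injections on an arbitrary small system. A member of the cover
around the point has injections into both charts, and group elements adjust them to these germs. -/
theorem exists_arrowOver (hO : O.IsReduced) {Q : OrbifoldStructure n X} (hQ : Q.IsReduced)
    (r : Q.Arrow) (φ : Q.Frame (C.chart i)) (ψ : Q.Frame (C.chart j)) {x : φ.Z.V} {y : ψ.Z.V}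
    (hs : source r = ⟨φ.p, φ.j.toFun x⟩)
    (ht : target r = ⟨ψ.p, ψ.j.toFun y⟩) :
    ∃ (k : C.ι) (a : Injection (C.chart k) (C.chart i)) (b : Injection (C.chart k) (C.chart j))
      (v : (C.chart k).V), ArrowOver φ ψ a b v r := by
  obtain ⟨N, c, d, x, rfl, rfl, rfl⟩ := exists_arrow_comp_eq hQ φ.j ψ.j hs ht
  have hi : (C.chart i).proj (φ.e.toFun (c.toFun x)) = N.proj x := by
    rw [φ.e.proj_comp, c.proj_comp]
  have hj : (C.chart j).proj (ψ.e.toFun (d.toFun x)) = N.proj x := by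
    rw [ψ.e.proj_comp, d.proj_comp]
  obtain ⟨k, ⟨v, hv⟩, hk⟩ := C.exists_mem_inter i j (N.proj x) ⟨⟨_, hi⟩, ⟨_, hj⟩⟩
  obtain ⟨a, ha⟩ := C.exists_injection_apply_eq hO (hk.trans Set.inter_subset_left)
    (hv.trans hi.symm)
  obtain ⟨b₀⟩ := C.exists_injection k j (hk.trans Set.inter_subset_right)
  obtain ⟨T, s, t, τ, hs', rfl, hst⟩ := exists_pullback (C.ker_chart hO i) a (φ.e.comp c)
    (a := v) (b := x) ha
  obtain ⟨g, hg⟩ := Injection.exists_smul_eq (C.ker_chart hO j) (b₀.comp s) ((ψ.e.comp d).comp t)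
  obtain ⟨b, hb⟩ := b₀.exists_smul_comp (C.ker_chart hO j) g
  exact ⟨k, a, b, v, T, s, c.comp t, d.comp t, τ, hs', fun y => (hst y).symm,
    fun y => (hg y).trans (hb _).symm, (arrow_comp (φ.j.comp c) (ψ.j.comp d) t τ).symm⟩

/-- A square for `a`, `a'` aligns the first legs; equality of the arrows then makes the second legs
agree on an open set, hence everywhere. Being an identity between injections of the cover, it can be
fed to `ν`. -/
theorem exists_common_refinement (hO : O.IsReduced) {Q : OrbifoldStructure n X}
    (hQ : Q.IsReduced) {φ : Q.Frame (C.chart i)} {ψ : Q.Frame (C.chart j)} {r : Q.Arrow}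
    {a : Injection (C.chart k) (C.chart i)} {b : Injection (C.chart k) (C.chart j)}
    {v : (C.chart k).V} {a' : Injection (C.chart l) (C.chart i)}
    {b' : Injection (C.chart l) (C.chart j)} {v' : (C.chart l).V} (h : ArrowOver φ ψ a b v r)
    (h' : ArrowOver φ ψ a' b' v' r) :
    ∃ (m : C.ι) (c : Injection (C.chart m) (C.chart k)) (d : Injection (C.chart m) (C.chart l))
      (w : (C.chart m).V), c.toFun w = v ∧ d.toFun w = v' ∧ a.comp c = a'.comp d ∧
      b.comp c = b'.comp d := by
  obtain ⟨x, hx, hxs⟩ := h.exists_source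
  obtain ⟨x', hx', hxs'⟩ := h'.exists_source
  obtain rfl : x = x' := φ.j.injective (eq_of_heq (Sigma.mk.inj_iff.1 (hxs.symm.trans hxs')).2)
  obtain ⟨m, c, d, w, hc, hd, hcd⟩ := C.exists_square hO a a' (hx.symm.trans hx')
  refine ⟨m, c, d, w, hc, hd, hcd, ?_⟩
  obtain ⟨S, s, t, t', σ, hσ, h₁, h₂, hr⟩ := h.comp (C.ker_chart hO k) c hc
  obtain ⟨S', s', u, u', σ', hσ', h₁', h₂', hr'⟩ := h'.comp (C.ker_chart hO l) d hd
  obtain ⟨N, f, f', y, -, -, hs, ht⟩ := (arrow_eq_iff hQ).1 (hr.symm.trans hr')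
  refine Injection.eq_of_comp_eq (C.ker_chart hO j) (s.comp f) fun y => ?_
  have hss : s.toFun (f.toFun y) = s'.toFun (f'.toFun y) := (a.comp c).injective (by
    rw [← h₁, φ.j.injective (hs y), h₁', hcd])
  change (b.comp c).toFun (s.toFun (f.toFun y)) = (b'.comp d).toFun (s.toFun (f.toFun y))
  rw [← h₂, ψ.j.injective (ht y), h₂', hss]

end CompatibleCover

end

/-! ### The functor between groupoids defined by a compatible system -/

section

namespace CompatibleSystem

open UniformizingSystem OrbifoldStructure

variable {n m : ℕ} {X Y : Type u} [TopologicalSpace X] [TopologicalSpace Y]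
  {O : OrbifoldStructure n X} {P : OrbifoldStructure m Y} {f : OrbifoldMap O P}

/-- A choice of liftings of `f` between small charts around every point `p` and its image, which map
to a lifting of the compatible system and to the charts of the orbifold structures. -/
structure Refinement (S : CompatibleSystem f) extends O.Refinement where
  idx : X → S.cover.ι
  e : ∀ p, Injection (W p) (S.cover.chart (idx p))
  Z : X → UniformizingSystem m Y
  e' : ∀ p, Injection (Z p) (S.target (idx p))
  j : ∀ p, Injection (Z p) (P.chart (f.toFun p))
  lift : ∀ p, Lifting f.toFun (W p) (Z p)
  lift_comp : ∀ p w, (e' p).toFun ((lift p).toFun w) = (S.lift (idx p)).toFun ((e p).toFun w)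

/-- A chart linking `S.target i` to the chart of `P` at `f p` serves as codomain; the domain is
shrunk until the lifting maps into it. -/
theorem nonempty_refinement (S : CompatibleSystem f) (hO : O.IsReduced) (hP : P.IsReduced) :
    Nonempty S.Refinement := by
  have key : ∀ p, ∃ (W : UniformizingSystem n X) (_ : p ∈ W.U) (k : Injection W (O.chart p))
      (i : S.cover.ι) (e : Injection W (S.cover.chart i)) (Z : UniformizingSystem m Y)
      (e' : Injection Z (S.target i)) (_ : Injection Z (P.chart (f.toFun p)))
      (L : Lifting f.toFun W Z), ∀ w, e'.toFun (L.toFun w) = (S.lift i).toFun (e.toFun w) := by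
    intro p
    obtain ⟨i, x, hx⟩ := S.cover.cover p
    obtain ⟨y, hy⟩ := P.mem_chart (f.toFun p)
    obtain ⟨y', hy'⟩ := O.mem_chart p
    obtain ⟨Z, e', j, z, hz, -⟩ := (S.isChart_target i).linked hP (P.isChart_chart (f.toFun p))
      (a := (S.lift i).toFun x) (b := y) (by rw [(S.lift i).proj_comp, hx, hy])
    obtain ⟨N, a, b, v, rfl, -⟩ := (S.cover.isChart i).linked hO (O.isChart_chart p)
      (a := x) (b := y') (by rw [hx, hy'])
    have hc : Continuous fun v => (S.lift i).toFun (a.toFun v) :=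
      (S.lift i).contMDiff.continuous.comp a.continuous
    obtain ⟨W, c, w, rfl, hcr⟩ := exists_injection_range_subset (b.ker_source (hO p))
      (hc.continuousAt (e'.isOpenEmbedding.isOpen_range.mem_nhds ⟨z, hz⟩))
    obtain ⟨L, hL⟩ := Lifting.exists_restrict ((S.isChart_target i).ker_eq_bot hP) (S.lift i)
      (a.comp c) e' fun w => hcr ⟨w, rfl⟩
    exact ⟨W, ⟨w, by rw [← hx, a.proj_comp, c.proj_comp]⟩, b.comp c, i, a.comp c, Z, e', j, L, hL⟩
  choose W hW k i e Z e' j L hL using key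
  exact ⟨⟨⟨W, hW, k⟩, i, e, Z, e', j, L, hL⟩⟩

namespace Refinement

variable {S : CompatibleSystem f} (R : S.Refinement) (hO : O.IsReduced) (hP : P.IsReduced)

/-- The orbifold structure given by the domains of the liftings. -/
def dom : OrbifoldStructure n X := R.toRefinement.orbifold hO

theorem isReduced_dom : (R.dom hO).IsReduced := R.toRefinement.isReduced_orbifold hO

/-- The frame of the domain at `p`. -/
def domFrame (p : X) : (R.dom hO).Frame (S.cover.chart (R.idx p)) :=
  ⟨p, R.W p, R.e p, Injection.id (R.W p)⟩

/-- The frame of the codomain at `p`. -/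
def codFrame (p : X) : P.Frame (S.target (R.idx p)) := ⟨f.toFun p, R.Z p, R.e' p, R.j p⟩

/-- The map on objects. -/
def obj (x : (R.dom hO).Point) : P.Point :=
  ⟨f.toFun x.1, (R.j x.1).toFun ((R.lift x.1).toFun x.2)⟩

/-- The graph of the map on arrows. -/
def ArrowRel (r : (R.dom hO).Arrow) (r' : P.Arrow) : Prop :=
  ∃ (p q : X) (k : S.cover.ι) (a : Injection (S.cover.chart k) (S.cover.chart (R.idx p)))
    (b : Injection (S.cover.chart k) (S.cover.chart (R.idx q))) (v : (S.cover.chart k).V),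
    ArrowOver (R.domFrame hO p) (R.domFrame hO q) a b v r ∧
      ArrowOver (R.codFrame p) (R.codFrame q) (S.ν a) (S.ν b) ((S.lift k).toFun v) r'

theorem ker_target (hP : P.IsReduced) (k : S.cover.ι) : (S.target k).ker = ⊥ :=
  (S.isChart_target k).ker_eq_bot hP

variable {R} {hO} {hP}

/-- Compatibility of the liftings with `ν` shows that the image data start in the small codomain
chart, so the image arrow exists. -/
theorem codFrame_e_lift {p : X} {k : S.cover.ι}
    {a : Injection (S.cover.chart k) (S.cover.chart (R.idx p))} {v : (S.cover.chart k).V}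
    {x : (R.W p).V} (hx : (R.e p).toFun x = a.toFun v) :
    (R.codFrame p).e.toFun ((R.lift p).toFun x) = (S.ν a).toFun ((S.lift k).toFun v) := by
  rw [← S.lift_comp, ← hx]
  exact R.lift_comp p x

theorem exists_arrowRel (hP : P.IsReduced) (r : (R.dom hO).Arrow) : ∃ r', R.ArrowRel hO r r' := by
  obtain ⟨k, a, b, v, h⟩ := S.cover.exists_arrowOver hO (R.isReduced_dom hO) r
    (R.domFrame hO (source r).1) (R.domFrame hO (OrbifoldStructure.target r).1) (x := (source r).2)
    (y := (OrbifoldStructure.target r).2) rfl rfl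
  obtain ⟨x, hx, -⟩ := h.exists_source
  obtain ⟨y, hy, -⟩ := h.exists_target
  obtain ⟨r', hr'⟩ := ArrowOver.exists_of_mem (ker_target hP k) (R.codFrame (source r).1)
    (R.codFrame (OrbifoldStructure.target r).1) (S.ν a) (S.ν b) (z := (S.lift k).toFun v)
    ⟨_, codFrame_e_lift hx⟩ ⟨_, codFrame_e_lift hy⟩
  exact ⟨r', _, _, k, a, b, v, h, hr'⟩

/-- Two presentations of `r` have a common refinement within the cover; multiplicativity of `ν`
carries it to the targets, where both image arrows are given by the same pair of injections. -/
theorem ArrowRel.unique (hP : P.IsReduced) {r : (R.dom hO).Arrow} {r₁ r₂ : P.Arrow}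
    (h₁ : R.ArrowRel hO r r₁) (h₂ : R.ArrowRel hO r r₂) : r₁ = r₂ := by
  obtain ⟨p, q, k, a, b, v, h, h'⟩ := h₁
  obtain ⟨p₁, q₁, k₁, a₁, b₁, v₁, h₁, h₁'⟩ := h₂
  obtain ⟨_, -, hs⟩ := h.exists_source
  obtain ⟨_, -, hs₁⟩ := h₁.exists_source
  obtain ⟨_, -, ht⟩ := h.exists_target
  obtain ⟨_, -, ht₁⟩ := h₁.exists_target
  obtain rfl : p = p₁ := congrArg Sigma.fst (hs.symm.trans hs₁)
  obtain rfl : q = q₁ := congrArg Sigma.fst (ht.symm.trans ht₁)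
  obtain ⟨l, c, d, w, rfl, rfl, hac, hbc⟩ :=
    S.cover.exists_common_refinement hO (R.isReduced_dom hO) h h₁
  have e := h'.comp (ker_target hP k) (S.ν c) (S.lift_comp c w).symm
  have e₁ := h₁'.comp (ker_target hP k₁) (S.ν d) (S.lift_comp d w).symm
  rw [← S.ν_comp, ← S.ν_comp] at e e₁
  rw [hac, hbc] at e
  exact e.unique hP (ker_target hP l) e₁

/-- The square of `exists_square` over the middle chart presents both arrows by one member of the
cover, and `ν` preserves the square. -/
theorem ArrowRel.mul (hP : P.IsReduced) {r₁ r₂ : (R.dom hO).Arrow} {s₁ s₂ : P.Arrow}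
    (h₁ : R.ArrowRel hO r₁ s₁) (h₂ : R.ArrowRel hO r₂ s₂)
    (h : OrbifoldStructure.target r₁ = source r₂) :
    R.ArrowRel hO ((R.dom hO).groupoid.mul r₁ r₂) (P.groupoid.mul s₁ s₂) := by
  obtain ⟨p, q, k, a, b, v, h₁, h₁'⟩ := h₁
  obtain ⟨q', p', k', a', b', v', h₂, h₂'⟩ := h₂
  obtain ⟨x, hx, ht⟩ := h₁.exists_target
  obtain ⟨x', hx', hs⟩ := h₂.exists_source
  have hxx := ht.symm.trans (h.trans hs)
  obtain rfl : q = q' := congrArg Sigma.fst hxx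
  obtain rfl : x = x' := eq_of_heq (Sigma.mk.inj_iff.1 hxx).2
  obtain ⟨l, c, d, w, rfl, rfl, hcd⟩ := S.cover.exists_square hO b a' (hx.symm.trans hx')
  have e₁ := h₁.comp (S.cover.ker_chart hO k) c rfl
  have e₂ := h₂.comp (S.cover.ker_chart hO k') d rfl
  have e₁' := h₁'.comp (ker_target hP k) (S.ν c) (S.lift_comp c w).symm
  have e₂' := h₂'.comp (ker_target hP k') (S.ν d) (S.lift_comp d w).symm
  rw [← S.ν_comp, ← S.ν_comp] at e₁' e₂'
  rw [hcd] at e₁ e₁'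
  exact ⟨p, p', l, a.comp c, b'.comp d, w, e₁.mul (R.isReduced_dom hO) (S.cover.ker_chart hO l) e₂,
    e₁'.mul hP (ker_target hP l) e₂'⟩

theorem ArrowRel.inv {r : (R.dom hO).Arrow} {s : P.Arrow} :
    R.ArrowRel hO r s → R.ArrowRel hO ((R.dom hO).groupoid.inv r) (P.groupoid.inv s)
  | ⟨p, q, k, a, b, v, h, h'⟩ => ⟨q, p, k, b, a, v, h.symm, h'.symm⟩

theorem ArrowRel.source_eq {r : (R.dom hO).Arrow} {s : P.Arrow} (h : R.ArrowRel hO r s) :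
    source s = R.obj hO (source r) := by
  obtain ⟨p, q, k, a, b, v, h, h'⟩ := h
  obtain ⟨x, hx, hs⟩ := h.exists_source
  rw [h'.source_eq (codFrame_e_lift hx), hs]
  rfl

theorem ArrowRel.target_eq {r : (R.dom hO).Arrow} {s : P.Arrow} (h : R.ArrowRel hO r s) :
    OrbifoldStructure.target s = R.obj hO (OrbifoldStructure.target r) := by
  obtain ⟨p, q, k, a, b, v, h, h'⟩ := h
  obtain ⟨x, hx, hs⟩ := h.exists_target
  rw [h'.target_eq (codFrame_e_lift hx), hs]
  rfl

/-- The value of `ν` at the identity plays no role: an arrow presented by the same injection on both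
sides is a unit. -/
theorem arrowRel_one (hP : P.IsReduced) (x : (R.dom hO).Point) :
    R.ArrowRel hO ((R.dom hO).groupoid.one x) (P.groupoid.one (R.obj hO x)) := by
  obtain ⟨p, x⟩ := x
  obtain ⟨r, hr⟩ := ArrowOver.exists_of_mem (S.cover.ker_chart hO _) (R.domFrame hO p)
    (R.domFrame hO p) (Injection.id (S.cover.chart (R.idx p))) (Injection.id _)
    (z := (R.e p).toFun x) ⟨x, rfl⟩ ⟨x, rfl⟩
  obtain ⟨s, hs⟩ := ArrowOver.exists_of_mem (ker_target hP _) (R.codFrame p) (R.codFrame p)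
    (S.ν (Injection.id _)) (S.ν (Injection.id _)) (z := (S.lift _).toFun ((R.e p).toFun x))
    ⟨_, codFrame_e_lift (a := Injection.id _) rfl⟩ ⟨_, codFrame_e_lift (a := Injection.id _) rfl⟩
  have hr' := ArrowOver.eq_one (R.isReduced_dom hO) (x := x)
    (show (R.e p).toFun x = (Injection.id _).toFun ((R.e p).toFun x) from rfl) hr
  have hs' := hs.eq_one hP (codFrame_e_lift (a := Injection.id _) rfl)
  subst hr' hs'
  exact ⟨p, p, _, _, _, _, hr, hs⟩

/-- The same injections present all nearby arrows and their images, with only the point of the cover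
chart varying. This gives continuity on arrows. -/
theorem ArrowRel.eventually {r : (R.dom hO).Arrow} {s : P.Arrow} (h : R.ArrowRel hO r s)
    {U : Set P.Arrow} (hU : U ∈ 𝓝 s) : ∀ᶠ r' in 𝓝 r, ∃ s' ∈ U, R.ArrowRel hO r' s' := by
  obtain ⟨p, q, k, a, b, v, ⟨T, c, t, t', σ, rfl, h₁, h₂, rfl⟩,
    T', c', u, u', σ', hσ', h₁', h₂', rfl⟩ := h
  let D : (R.dom hO).Span :=
    ⟨T, p, q, (R.domFrame hO p).j.comp t, (R.domFrame hO q).j.comp t'⟩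
  let D' : P.Span := ⟨T', _, _, (R.codFrame p).j.comp u, (R.codFrame q).j.comp u'⟩
  have hn : c'.toFun '' (D'.arr ⁻¹' U) ∈ 𝓝 ((S.lift k).toFun (c.toFun σ)) := by
    rw [← hσ']
    exact c'.isOpenEmbedding.isOpenMap.image_mem_nhds (D'.continuous_arr.continuousAt hU)
  have hc : Continuous fun x => (S.lift k).toFun (c.toFun x) :=
    (S.lift k).contMDiff.continuous.comp c.continuous
  filter_upwards [(D.isOpenEmbedding_arr (R.isReduced_dom hO)).isOpenMap.image_mem_nhds
    (hc.continuousAt hn)]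
  rintro _ ⟨x, ⟨y, hy, hxy⟩, rfl⟩
  exact ⟨D'.arr y, hy, p, q, k, a, b, c.toFun x, ⟨T, c, t, t', x, rfl, h₁, h₂, rfl⟩,
    T', c', u, u', y, hxy, h₁', h₂', rfl⟩

variable (R) (hO) (hP)

/-- The map on arrows. -/
def arr (r : (R.dom hO).Arrow) : P.Arrow := (exists_arrowRel (R := R) hP r).choose

variable {R} {hO} {hP}

theorem arrowRel_arr (r : (R.dom hO).Arrow) : R.ArrowRel hO r (R.arr hO hP r) :=
  (exists_arrowRel (R := R) hP r).choose_spec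

theorem ArrowRel.arr_eq {r : (R.dom hO).Arrow} {s : P.Arrow} (h : R.ArrowRel hO r s) :
    R.arr hO hP r = s := (arrowRel_arr r).unique hP h

variable (R) (hO) (hP)

theorem contMDiff_obj : ContMDiff (𝓡 n) (𝓡 m) ∞ (R.obj hO) :=
  contMDiff_sigma fun p =>
    (isLocalDiffeomorph_sigmaMk (n := m) (fun q : Y => (P.chart q).V) (f.toFun p)).contMDiff.comp
      ((R.j p).isLocalDiffeomorph.contMDiff.comp (R.lift p).contMDiff)

/-- The morphism of groupoids given by a compatible system. -/
def hom : (R.dom hO).groupoid.Hom P.groupoid where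
  obj := R.obj hO
  arr := R.arr hO hP
  contMDiff_obj := R.contMDiff_obj hO
  continuous_arr := continuous_iff_continuousAt.2 fun r U hU => by
    refine Filter.mem_map.2 (((arrowRel_arr r).eventually hU).mono ?_)
    rintro r' ⟨s, hs, h⟩
    change R.arr hO hP r' ∈ U
    rwa [h.arr_eq]
  src_arr := fun r => (arrowRel_arr r).source_eq
  tgt_arr := fun r => (arrowRel_arr r).target_eq
  arr_one := fun x => (arrowRel_one hP x).arr_eq
  arr_mul := fun r r' h => ((arrowRel_arr r).mul hP (arrowRel_arr r') h).arr_eq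
  arr_inv := fun r => (arrowRel_arr r).inv.arr_eq

/-- The connecting arrows in `H'` are units, and the local lifting is `R.lift p`, whose germ is
compared with that of `f` through the lifting of the compatible system. -/
theorem induces : Induces (.id _) (R.toRefinement.hom hO) (R.hom hO hP) (.id _) (.id _) f := by
  rintro ⟨p, w⟩
  have hc : Continuous fun w : (R.W p).V => R.obj hO ⟨p, w⟩ :=
    (R.contMDiff_obj hO).continuous.comp
      (continuous_sigmaMk (σ := fun p => ((R.dom hO).chart p).V))
  have hm : Continuous fun w : (R.W p).V => (show (R.dom hO).Point from ⟨p, w⟩) :=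
    continuous_sigmaMk (σ := fun p => ((R.dom hO).chart p).V)
  refine ⟨p, R.W p, R.inj p, w, fun w => ⟨p, w⟩, f.toFun p, R.Z p, R.j p, R.lift p,
    fun w => R.obj hO ⟨p, w⟩, fun w => P.groupoid.one (R.obj hO ⟨p, w⟩), hm, rfl,
    fun _ => rfl, ?_, fun _ => rfl, fun _ => rfl, hc, fun _ => rfl, ?_⟩
  · exact (continuous_sigma fun p =>
      Span.continuous_arr ⟨P.chart p, p, p, Injection.id _, Injection.id _⟩ :
        Continuous (X := P.Point) P.groupoid.one).comp hc
  · have h : SameGerm ((R.W p).proj w) (R.lift p) (S.lift (R.idx p)) :=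
      ⟨R.W p, Injection.id _, R.e p, R.Z p, Injection.id _, R.e' p, (R.lift p).toFun, ⟨w, rfl⟩,
        fun _ => rfl, fun w => (R.lift_comp p w).symm⟩
    exact h.trans (S.cover.ker_chart hO _) (ker_target hP _)
      (S.sameGerm _ _ ((R.e p).U_subset ⟨w, rfl⟩))

end Refinement

end CompatibleSystem

/-- A good map is induced by a morphism between groupoids Morita equivalent to those of the
orbifolds. -/
theorem OrbifoldMap.IsGood.exists_induces {n m : ℕ} {X Y : Type u} [TopologicalSpace X] [T2Space X]
    [TopologicalSpace Y] [T2Space Y] {O : OrbifoldStructure n X} {P : OrbifoldStructure m Y}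
    (hO : O.IsReduced) (hP : P.IsReduced) {f : OrbifoldMap O P} (hf : f.IsGood) :
    ∃ (H : GroupoidData.{u, u + 1} n) (H' : GroupoidData.{u, u + 1} m)
      (E : H.MoritaEquivalence O.groupoid) (E' : H'.MoritaEquivalence P.groupoid) (F : H.Hom H'),
      H.IsProperEtale ∧ H'.IsProperEtale ∧ Induces E.left E.right F E'.left E'.right f := by
  obtain ⟨S⟩ := hf
  obtain ⟨R⟩ := S.nonempty_refinement hO hP
  have hH : (R.dom hO).groupoid.IsProperEtale :=
    OrbifoldStructure.isProperEtale_groupoid (R.isReduced_dom hO)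
  have hH' : P.groupoid.IsProperEtale := OrbifoldStructure.isProperEtale_groupoid hP
  exact ⟨(R.dom hO).groupoid, P.groupoid,
    ⟨(R.dom hO).groupoid, hH, .id _, R.toRefinement.hom hO, hH.isMorita_id,
      R.toRefinement.isMorita_hom hO⟩, hH'.moritaRefl, R.hom hO hP, hH, hH', R.induces hO hP⟩

end

end Orb

end

/-- Let `O`, `P` be reduced orbifold structures on `X`, `Y`. (1) The associated groupoids are proper
étale differentiable groupoids. (2) A morphism between them induces a unique smooth map of orbifolds,
and this map is good. (3) The same holds for morphisms between groupoids Morita equivalent to them.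
(4) Every good map is induced by a morphism between groupoids Morita equivalent to them. -/
theorem mainTheorem9 {n m : ℕ} {X Y : Type u}
    [TopologicalSpace X] [T2Space X] [SecondCountableTopology X]
    [TopologicalSpace Y] [T2Space Y] [SecondCountableTopology Y]
    (O : Orb.OrbifoldStructure n X) (P : Orb.OrbifoldStructure m Y)
    (hO : O.IsReduced) (hP : P.IsReduced) :
    (O.groupoid.IsProperEtale ∧ P.groupoid.IsProperEtale) ∧
    (∀ F : O.groupoid.Hom P.groupoid,
      ∃ f : Orb.OrbifoldMap O P,
        Orb.Induces (.id _) (.id _) F (.id _) (.id _) f ∧ f.IsGood ∧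
        ∀ g : Orb.OrbifoldMap O P,
          Orb.Induces (.id _) (.id _) F (.id _) (.id _) g → f.Same g) ∧
    (∀ (H : Orb.GroupoidData.{u, u + 1} n) (H' : Orb.GroupoidData.{u, u + 1} m),
      H.IsProperEtale → H'.IsProperEtale →
      ∀ (E : H.MoritaEquivalence O.groupoid) (E' : H'.MoritaEquivalence P.groupoid)
        (F : H.Hom H'),
      ∃ f : Orb.OrbifoldMap O P,
        Orb.Induces E.left E.right F E'.left E'.right f ∧ f.IsGood ∧
        ∀ g : Orb.OrbifoldMap O P,
          Orb.Induces E.left E.right F E'.left E'.right g → f.Same g) ∧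
    (∀ f : Orb.OrbifoldMap O P, f.IsGood →
      ∃ (H : Orb.GroupoidData.{u, u + 1} n) (H' : Orb.GroupoidData.{u, u + 1} m)
        (E : H.MoritaEquivalence O.groupoid) (E' : H'.MoritaEquivalence P.groupoid)
        (F : H.Hom H'),
        H.IsProperEtale ∧ H'.IsProperEtale ∧
        Orb.Induces E.left E.right F E'.left E'.right f) := by
  refine ⟨⟨Orb.OrbifoldStructure.isProperEtale_groupoid hO,
    Orb.OrbifoldStructure.isProperEtale_groupoid hP⟩, fun F => ?_, fun H H' _ hH' E E' F => ?_, ?_⟩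
  · have h₁ := Orb.OrbifoldStructure.isProperEtale_groupoid hO
    have h₂ := Orb.OrbifoldStructure.isProperEtale_groupoid hP
    exact Orb.exists_induces h₁.moritaRefl h₂.moritaRefl F hO hP h₂
  · exact Orb.exists_induces E E' F hO hP hH'
  · exact fun f hf => hf.exists_induces hO hP
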